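/- Let $m_1,m_2$ be nonnegative integers, $m=m_1+m_2$, and $0<l<\infty$. Let $v$ be a measurable $m_1\times m_2$ complex matrix function which is bounded on $(0,l)$, and put \[ j=\begin{bmatrix} I_{m_1}&0\\0&-I_{m_2}\end{bmatrix},\qquad V=\begin{bmatrix}0&v\\v^*&0\end{bmatrix}. \] For $z\in\mathbb C$ let $u(x,z)$ be the fundamental solution on $[0,l]$ of the skew-self-adjoint Dirac system $u'(x,z)=(izj+jV(x))u(x,z)$, $u(0,z)=I_m$ (absolutely continuous solution, equation holding a.e.). Set \[ \gamma(x)=\begin{bmatrix}0&I_{m_2}\end{bmatrix}u(x,0)=\begin{bmatrix}\gamma_1(x)&\gamma_2(x)\end{bmatrix}, \] where $\gamma_1,\gamma_2$ have $m_1$ and $m_2$ columns. In $L^2_{m_2}(0,l)$ consider the operators $A=-i\int_0^x\cdot\,dt$ and $K=-i\gamma(x)\int_0^x\gamma(t)^*\cdot\,dt$. A bounded operator $E$ with bounded inverse is called a (normalized) similarity operator for $\gamma$ if * $K=EAE^{-1}$; * $(Ef)(x)=\rho(x)f(x)+\int_0^xE(x,t)f(t)\,dt$ with a bounded measurable kernel,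 where $\rho$ is absolutely continuous, $\rho'=\gamma'\gamma^*\rho$ a.e. and $\det\rho(0)\neq0$, and $E^{-1}$ is likewise of triangular form, with diagonal term $\rho^{-1}$ and a bounded measurable kernel; * $E^{\pm1}$ map absolutely continuous functions with bounded derivative on $[0,l]$ into such functions; * $E^{-1}\gamma_2\equiv I_{m_2}$ (with $E^{-1}$ applied columnwise). Given such an $E$, define $S=E^{-1}(E^*)^{-1}$ and $\Pi=\begin{bmatrix}\Phi_1&\Phi_2\end{bmatrix}:\mathbb C^m\to L^2_{m_2}(0,l)$ by $\Phi_1g=(E^{-1}\gamma_1)(x)g$ and $\Phi_2g\equiv g$. For $0\le r\le l$ let $P_r$ be the restriction (orthoprojection) of $L^2_{m_2}(0,l)$ onto $L^2_{m_2}(0,r)$, let $A_r=P_rAP_r^*$, $S_r=P_rSP_r^*$, and let \[ w_A(r,z)=I_m-iz\,\Pi^*P_r^*S_r^{-1}(I-zA_r)^{-1}P_r\Pi . \] Then a normalized similarity operator $E$ for $\gamma$ exists, and for every such $E$ the following holds. 1. $A,S,\Pi$ form an $S$-node: $AS-SA^*=-i\,\Pi\Pi^*$. 2. For all $r\in[0,l]$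 and $z\in\mathbb C$ the operators $S_r$ and $I-zA_r$ are boundedly invertible, so that $w_A(r,z)$ is well defined. 3. For every $z\in\mathbb C$ the function $w(x,z)=w_A(x,z)$ is the fundamental solution on $[0,l]$ of $w'(x,z)=-iz\,\gamma(x)^*\gamma(x)\,w(x,z)$, $w(0,z)=I_m$. 4. For all $x\in[0,l]$ and $z\in\mathbb C$, \[ u(x,z)=e^{ixz}\,u(x,0)\,w(x,2z). \] -/

import Mathlib

open MeasureTheory Set Matrix
open scoped Matrix.Norms.L2Operator ENNReal InnerProduct

noncomputable section

namespace SkewDirac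

/-- Lebesgue measure on the interval `(0, r)`. -/
abbrev vol (r : ℝ) : Measure ℝ := volume.restrict (Ioo 0 r)

/-- The Hilbert space `L²_n(0, r)` of square integrable `ℂⁿ`-valued functions. -/
abbrev L2 (n : ℕ) (r : ℝ) : Type := Lp (EuclideanSpace ℂ (Fin n)) 2 (vol r)

/-- `U` is an absolutely continuous solution on `[0, l]` of `U' = C(x) U` (a.e.). -/
structure IsSolution {n p : Type*} [Fintype n] (l : ℝ)
    (C : ℝ → Matrix n n ℂ) (U : ℝ → Matrix n p ℂ) : Prop where
  ac : ∀ i j, AbsolutelyContinuousOnInterval (fun x => U x i j) 0 l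
  eqn : ∀ᵐ x ∂(vol l), ∀ i j, HasDerivAt (fun s => U s i j) ((C x * U x) i j) x

/-- The fundamental solution: the square solution normalized by `U(0) = I`. -/
structure IsFundamentalSolution {n : Type*} [Fintype n] [DecidableEq n] (l : ℝ)
    (C : ℝ → Matrix n n ℂ) (U : ℝ → Matrix n n ℂ) : Prop extends IsSolution l C U where
  init : U 0 = 1

/-- The coefficient `i z j + j V` of the skew-self-adjoint Dirac system,
`j = diag (I, -I)`, `V = [0 v; v* 0]`. -/
def diracCoeff {m₁ m₂ : ℕ} (v : Matrix (Fin m₁) (Fin m₂) ℂ) (z : ℂ) :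
    Matrix (Fin m₁ ⊕ Fin m₂) (Fin m₁ ⊕ Fin m₂) ℂ :=
  (Complex.I * z) • fromBlocks 1 0 0 (-1) + fromBlocks 1 0 0 (-1) * fromBlocks 0 v vᴴ 0

/-- Boundedly differentiable functions on `[0, l]`: absolutely continuous functions whose
derivative is essentially bounded. -/
def MemB1 {n : ℕ} (l : ℝ) (f : ℝ → EuclideanSpace ℂ (Fin n)) : Prop :=
  AbsolutelyContinuousOnInterval f 0 l ∧ ∃ C : ℝ, ∀ᵐ x ∂(vol l), ‖deriv f x‖ ≤ C

open Classical in
/-- The class in `L²_n(0, l)` of a square integrable function (and `0` for other functions). -/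
def toL2 {n : ℕ} (l : ℝ) (f : ℝ → EuclideanSpace ℂ (Fin n)) : L2 n l :=
  if h : MemLp f 2 (vol l) then h.toLp f else 0

/-- The `j`-th column of a matrix function, as a function with values in `ℂⁿ`. -/
def col {n : ℕ} {p : Type*} (θ : ℝ → Matrix (Fin n) p ℂ) (j : p) :
    ℝ → EuclideanSpace ℂ (Fin n) :=
  fun x => WithLp.toLp 2 (fun i => θ x i j)

/-- The operator `g ↦ ∑ j, g j • c j`, given by its columns `c j ∈ L²_n(0, l)`. -/
def ofCols {n : ℕ} {p : Type*} [Fintype p] {l : ℝ} (c : p → L2 n l) :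
    EuclideanSpace ℂ p →L[ℂ] L2 n l :=
  ∑ j, (EuclideanSpace.proj j : EuclideanSpace ℂ p →L[ℂ] ℂ).smulRight (c j)

/-! ### The operator of integration and the restriction operators -/

lemma integrableOn_coe {n : ℕ} {l : ℝ} (f : L2 n l) :
    IntegrableOn (fun x => f x) (Ioo 0 l) volume :=
  (Lp.memLp f).integrable (by norm_num)

lemma intervalIntegrable_coe {n : ℕ} {l x : ℝ} (f : L2 n l) (hx : x ∈ Ioo 0 l) :
    IntervalIntegrable (fun t => f t) volume 0 x := by
  rw [intervalIntegrable_iff_integrableOn_Ioo_of_le hx.1.le]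
  exact (integrableOn_coe f).mono_set (Ioo_subset_Ioo_right hx.2.le)

/-- The bound used for the operator of integration. -/
lemma norm_primitive_le {n : ℕ} {l x : ℝ} (f : L2 n l) (hx : x ∈ Ioo 0 l) :
    ‖(-Complex.I) • ∫ t in (0 : ℝ)..x, f t‖
      ≤ ((vol l univ) ^ (1 / (1 : ℝ≥0∞).toReal - 1 / (2 : ℝ≥0∞).toReal)).toReal * ‖f‖ := by
  have h1 : ‖(-Complex.I) • ∫ t in (0 : ℝ)..x, f t‖ ≤ ∫ t, ‖f t‖ ∂(vol l) := by
    rw [norm_smul, norm_neg, Complex.norm_I, one_mul]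
    refine (intervalIntegral.norm_integral_le_integral_norm hx.1.le).trans ?_
    rw [intervalIntegral.integral_of_le hx.1.le, integral_Ioc_eq_integral_Ioo]
    exact setIntegral_mono_set (integrableOn_coe f).norm
      (Filter.Eventually.of_forall fun t => norm_nonneg _)
      (Ioo_subset_Ioo_right hx.2.le).eventuallyLE
  refine h1.trans ?_
  rw [integral_norm_eq_lintegral_enorm (Lp.aestronglyMeasurable f), ← eLpNorm_one_eq_lintegral_enorm]
  have h2 := eLpNorm_le_eLpNorm_mul_rpow_measure_univ (μ := vol l) (p := 1) (q := 2)
    (by norm_num) (Lp.aestronglyMeasurable f)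
  have hfin : (vol l univ) ^ (1 / (1 : ℝ≥0∞).toReal - 1 / (2 : ℝ≥0∞).toReal) ≠ ⊤ :=
    ENNReal.rpow_ne_top_of_nonneg (by norm_num) (measure_ne_top _ _)
  have h3 := ENNReal.toReal_mono (ENNReal.mul_ne_top (Lp.eLpNorm_ne_top f) hfin) h2
  rw [ENNReal.toReal_mul] at h3
  rw [Lp.norm_def, mul_comm]
  exact h3

lemma memLp_primitive {n : ℕ} {l : ℝ} (f : L2 n l) :
    MemLp (fun x => (-Complex.I) • ∫ t in (0 : ℝ)..x, f t) 2 (vol l) := by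
  have hc : ContinuousOn (fun x => (-Complex.I) • ∫ t in (0 : ℝ)..x, f t) (Ioo 0 l) := by
    suffices h : ContinuousOn (fun x => ∫ t in (0 : ℝ)..x, f t) (Ioo 0 l) from
      h.const_smul (-Complex.I)
    rcases le_or_gt l 0 with hl | hl
    · intro x hx; exact absurd (hx.1.trans hx.2) (not_lt.mpr hl)
    · have h := intervalIntegral.continuousOn_primitive_interval (μ := volume) (a := 0) (b := l)
        (f := fun t => f t)
        (by rw [uIcc_of_le hl.le, integrableOn_Icc_iff_integrableOn_Ioo]; exact integrableOn_coe f)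
      rw [uIcc_of_le hl.le] at h
      exact h.mono Ioo_subset_Icc_self
  refine MemLp.of_bound (hc.aestronglyMeasurable measurableSet_Ioo)
    (((vol l univ) ^ (1 / (1 : ℝ≥0∞).toReal - 1 / (2 : ℝ≥0∞).toReal)).toReal * ‖f‖) ?_
  · filter_upwards [ae_restrict_mem measurableSet_Ioo] with x hx
    exact norm_primitive_le f hx

/-- The operator `A = -i ∫₀ˣ · dt` on `L²_n(0, l)`. -/
def opA (n : ℕ) (l : ℝ) : L2 n l →L[ℂ] L2 n l :=
  LinearMap.mkContinuousOfExistsBound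
    { toFun := fun f => (memLp_primitive f).toLp _
      map_add' := by
        intro f g
        rw [← MemLp.toLp_add, MemLp.toLp_eq_toLp_iff]
        filter_upwards [ae_restrict_mem measurableSet_Ioo] with x hx
        have h : ∫ t in (0 : ℝ)..x, (f + g) t = ∫ t in (0 : ℝ)..x, (f t + g t) := by
          rw [intervalIntegral.integral_of_le hx.1.le, intervalIntegral.integral_of_le hx.1.le,
            integral_Ioc_eq_integral_Ioo, integral_Ioc_eq_integral_Ioo]
          exact integral_congr_ae
            (ae_restrict_of_ae_restrict_of_subset (Ioo_subset_Ioo_right hx.2.le)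
              (Lp.coeFn_add f g))
        simp only [Pi.add_apply]
        rw [h, intervalIntegral.integral_add (intervalIntegrable_coe f hx)
          (intervalIntegrable_coe g hx), smul_add]
      map_smul' := by
        intro c f
        simp only [RingHom.id_apply]
        rw [← MemLp.toLp_const_smul, MemLp.toLp_eq_toLp_iff]
        filter_upwards [ae_restrict_mem measurableSet_Ioo] with x hx
        have h : ∫ t in (0 : ℝ)..x, (c • f) t = ∫ t in (0 : ℝ)..x, c • f t := by
          rw [intervalIntegral.integral_of_le hx.1.le, intervalIntegral.integral_of_le hx.1.le,
            integral_Ioc_eq_integral_Ioo, integral_Ioc_eq_integral_Ioo]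
          exact integral_congr_ae
            (ae_restrict_of_ae_restrict_of_subset (Ioo_subset_Ioo_right hx.2.le)
              (Lp.coeFn_smul c f))
        simp only [Pi.smul_apply]
        rw [h, intervalIntegral.integral_smul, smul_comm] }
    (by
      refine ⟨measureUnivNNReal (vol l) ^ (2 : ℝ≥0∞).toReal⁻¹ *
        ((vol l univ) ^ (1 / (1 : ℝ≥0∞).toReal - 1 / (2 : ℝ≥0∞).toReal)).toReal, fun f => ?_⟩
      rw [mul_assoc]
      refine Lp.norm_le_of_ae_bound (by positivity) ?_
      filter_upwards [ae_restrict_mem measurableSet_Ioo, (memLp_primitive f).coeFn_toLp]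
        with x hx hfx
      simp only [LinearMap.coe_mk, AddHom.coe_mk]
      rw [hfx]
      exact norm_primitive_le f hx)

lemma memLp_cut {n : ℕ} {l : ℝ} (r : ℝ) (f : L2 n l) :
    MemLp ((Ioo 0 l).indicator (fun x => f x)) 2 (vol r) :=
  ((memLp_indicator_iff_restrict measurableSet_Ioo).mpr (Lp.memLp f)).restrict _

lemma indicator_congr_vol {n : ℕ} {l : ℝ} (r : ℝ) {f g : ℝ → EuclideanSpace ℂ (Fin n)}
    (h : f =ᵐ[vol l] g) : (Ioo 0 l).indicator f =ᵐ[vol r] (Ioo 0 l).indicator g := by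
  refine ae_restrict_of_ae ?_
  have h' := (ae_restrict_iff' measurableSet_Ioo).mp h
  filter_upwards [h'] with x hx
  by_cases hm : x ∈ Ioo 0 l
  · simp [hm, hx hm]
  · simp [hm]

/-- The operator `P_r` from `L²_n(0, l)` to `L²_n(0, r)`, `(P_r f)(x) = f(x)` for `0 < x < r`
(here `r ≤ l`, so that the indicator function is `1` on `(0, r)`). -/
def opP (n : ℕ) (l r : ℝ) : L2 n l →L[ℂ] L2 n r :=
  LinearMap.mkContinuous
    { toFun := fun f => (memLp_cut r f).toLp _
      map_add' := by
        intro f g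
        rw [← MemLp.toLp_add, MemLp.toLp_eq_toLp_iff]
        refine (indicator_congr_vol r (Lp.coeFn_add f g)).trans ?_
        rw [← indicator_add']
      map_smul' := by
        intro c f
        simp only [RingHom.id_apply]
        rw [← MemLp.toLp_const_smul, MemLp.toLp_eq_toLp_iff]
        refine (indicator_congr_vol r (Lp.coeFn_smul c f)).trans ?_
        refine Filter.Eventually.of_forall fun x => ?_
        by_cases hm : x ∈ Ioo 0 l
        · simp [hm]
        · simp [hm] }
    1 (by
      intro f
      simp only [LinearMap.coe_mk, AddHom.coe_mk, one_mul]
      rw [Lp.norm_toLp, Lp.norm_def]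
      refine ENNReal.toReal_mono (Lp.eLpNorm_ne_top f) ?_
      refine (eLpNorm_restrict_le _ _ _ _).trans ?_
      rw [eLpNorm_indicator_eq_eLpNorm_restrict measurableSet_Ioo])

/-! ### Triangular operators and the similarity operator -/

/-- `(T f)(x) = ρ(x) f(x) + ∫₀ˣ k(x,t) f(t) dt` for all `f`, a.e. on `(0, l)`. -/
def IsTriangular {n : ℕ} {l : ℝ} (T : L2 n l →L[ℂ] L2 n l)
    (ρ : ℝ → Matrix (Fin n) (Fin n) ℂ) (k : ℝ → ℝ → Matrix (Fin n) (Fin n) ℂ) : Prop :=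
  ∀ f : L2 n l, ∀ᵐ x ∂(vol l),
    T f x = toEuclideanCLM (𝕜 := ℂ) (ρ x) (f x)
      + ∫ t in (0 : ℝ)..x, toEuclideanCLM (𝕜 := ℂ) (k x t) (f t)

/-- Measurable kernels which are bounded on the triangle `0 < t < x < l`. -/
def IsBoundedKernel {n : ℕ} (l : ℝ) (k : ℝ → ℝ → Matrix (Fin n) (Fin n) ℂ) : Prop :=
  (∀ i j, Measurable fun p : ℝ × ℝ => k p.1 p.2 i j) ∧
    ∃ C : ℝ, ∀ x t, 0 < t → t < x → x < l → ‖k x t‖ ≤ C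

/-- The entrywise derivative of a matrix function. -/
def mderiv {n p : Type*} (θ : ℝ → Matrix n p ℂ) (x : ℝ) : Matrix n p ℂ :=
  Matrix.of fun i j => deriv (fun s => θ s i j) x

/-- `E` is a similarity operator for `γ = [γ₁ γ₂]`, normalized by `E⁻¹ γ₂ = I`. With `F = γ`
and `G = -i γ*`, it transforms `A` into the operator `K = ∫₀ˣ F(x) G(t) · dt`. -/
structure IsSimilarityOperator {m₁ m₂ : ℕ} (l : ℝ)
    (γ : ℝ → Matrix (Fin m₂) (Fin m₁ ⊕ Fin m₂) ℂ) (E : L2 m₂ l ≃L[ℂ] L2 m₂ l) : Prop where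
  /-- `E A E⁻¹ = K`. -/
  similar : IsTriangular ((E : L2 m₂ l →L[ℂ] L2 m₂ l) ∘L opA m₂ l ∘L
      (E.symm : L2 m₂ l →L[ℂ] L2 m₂ l)) (fun _ => 0)
      (fun x t => γ x * ((-Complex.I) • (γ t)ᴴ))
  /-- `E` is triangular with `ρ' = i F' G ρ`, `det ρ(0) ≠ 0`, and the kernels of `E` and `E⁻¹`
  are bounded. -/
  triangular : ∃ (ρ : ℝ → Matrix (Fin m₂) (Fin m₂) ℂ)
      (k k' : ℝ → ℝ → Matrix (Fin m₂) (Fin m₂) ℂ),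
    IsSolution l (fun x => Complex.I • (mderiv γ x * ((-Complex.I) • (γ x)ᴴ))) ρ ∧
    (ρ 0).det ≠ 0 ∧
    IsBoundedKernel l k ∧ IsTriangular (E : L2 m₂ l →L[ℂ] L2 m₂ l) ρ k ∧
    IsBoundedKernel l k' ∧
      IsTriangular (E.symm : L2 m₂ l →L[ℂ] L2 m₂ l) (fun x => (ρ x)⁻¹) k'
  /-- `E` and `E⁻¹` map boundedly differentiable functions into such functions. -/
  map_B1 : ∀ f, MemB1 l f → ∃ g, MemB1 l g ∧ E (toL2 l f) = toL2 l g
  symm_map_B1 : ∀ f, MemB1 l f → ∃ g, MemB1 l g ∧ E.symm (toL2 l f) = toL2 l g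
  /-- `E⁻¹ γ₂ = I`, columnwise. -/
  normalized : ∀ j, E.symm (toL2 l (col (fun x => (γ x).toCols₂) j)) = toL2 l (col (fun _ => 1) j)

/-! ### The S-node recovered from `γ` and its transfer matrix function -/

section Node

variable {m₁ m₂ : ℕ} {l : ℝ}

/-- `S = E⁻¹ (E*)⁻¹`, where `(E*)⁻¹ = (E⁻¹)*`. -/
def opS (E : L2 m₂ l ≃L[ℂ] L2 m₂ l) : L2 m₂ l →L[ℂ] L2 m₂ l :=
  (E.symm : L2 m₂ l →L[ℂ] L2 m₂ l) ∘L
    ContinuousLinearMap.adjoint (E.symm : L2 m₂ l →L[ℂ] L2 m₂ l)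

/-- `Π = [Φ₁ Φ₂]`, `Φ₁ g = (E⁻¹ γ₁) g` with `E⁻¹` applied columnwise, `Φ₂ g ≡ g`. -/
def opPi (γ : ℝ → Matrix (Fin m₂) (Fin m₁ ⊕ Fin m₂) ℂ) (E : L2 m₂ l ≃L[ℂ] L2 m₂ l) :
    EuclideanSpace ℂ (Fin m₁ ⊕ Fin m₂) →L[ℂ] L2 m₂ l :=
  ofCols (Sum.elim
    (fun j => E.symm (toL2 l (col (fun x => (γ x).toCols₁) j)))
    (fun j => toL2 l (col (fun _ => 1) j)))

/-- `A`, `S`, `Π` form an S-node: `A S - S A* = -i Π Π*`. -/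
def IsSNode {p : Type*} [Fintype p] (A S : L2 m₂ l →L[ℂ] L2 m₂ l)
    (Pi : EuclideanSpace ℂ p →L[ℂ] L2 m₂ l) : Prop :=
  A ∘L S - S ∘L ContinuousLinearMap.adjoint A
    = (-Complex.I) • (Pi ∘L ContinuousLinearMap.adjoint Pi)

/-- The compression `T_r = P_r T P_r*` to `L²_n(0, r)`. -/
def compress (r : ℝ) (T : L2 m₂ l →L[ℂ] L2 m₂ l) : L2 m₂ r →L[ℂ] L2 m₂ r :=
  opP m₂ l r ∘L T ∘L ContinuousLinearMap.adjoint (opP m₂ l r)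

/-- The transfer matrix function
`w_A(r, z) = I - i z Π* P_r* S_r⁻¹ (I - z A_r)⁻¹ P_r Π`, as a matrix. -/
def transfer {p : Type*} [Fintype p] [DecidableEq p] (A S : L2 m₂ l →L[ℂ] L2 m₂ l)
    (Pi : EuclideanSpace ℂ p →L[ℂ] L2 m₂ l) (r : ℝ) (z : ℂ) : Matrix p p ℂ :=
  1 - (Complex.I * z) • (toEuclideanCLM (n := p) (𝕜 := ℂ)).symm
    (ContinuousLinearMap.adjoint Pi ∘L ContinuousLinearMap.adjoint (opP m₂ l r) ∘L
      Ring.inverse (compress r S) ∘L Ring.inverse (1 - z • compress r A) ∘L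
      opP m₂ l r ∘L Pi)

end Node

end SkewDirac

end

open SkewDirac

set_option linter.unusedSectionVars false

noncomputable section

/-! Write β and γ for the top and bottom block rows of u(x,0). At z = 0 the coefficient is
skew-Hermitian, so u(x,0) is unitary; hence γγ* = I and βγ* = 0, while γ' = -v*β and β' = vγ.

Existence of E. Let J be integration from 0, Q the Volterra operator with kernel v(x)*v(t), and Y
the one with kernel γ(x)γ(t)*, so that A = -iJ and K = -iY. Integrating the system for β and γ gives
(I + JQ)Y = J and (I + JQ)γ₂ = I (`gramOp_add`, `col_gamma_add`). As I + JQ is invertible, it is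
enough to find an invertible E = I + D with (I + JQ)EJ = JE and (I + JQ)E c = c for constants c:
then EJE⁻¹ = Y and E⁻¹γ₂ = I. On kernels this is the transport equation ∂ₓd + ∂ₛd = -(q + qd) with
d(x,0) = 0. Integrated along the diagonals it becomes the fixed point equation d + `kavg`(q + qd) =
0, which Picard iteration solves (`exists_transmutation`). Averaging R along diagonals satisfies MJ
= JM + JRJ (`kernelOp_kavg_comp_opJ`), which turns the equation for d into the required
intertwining. Since γ'γ* = -v*βγ* = 0, the diagonal term ρ = I is admissible.

Properties of every E. Let Γ have the columns of γ. Normalization gives Π = E⁻¹Γ. Because Y + Y* =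
ΓΓ* (the two triangles make up the square), conjugating K - K* = -iΓΓ* by E⁻¹ gives the node
identity. Triangular operators are causal, so compression to (0,r) is multiplicative on them; thus
S_r = E_r⁻¹(E_r⁻¹)* is invertible and w_A(r,z) = I - iz Γ_r*(I - zK_r)⁻¹Γ_r. The function W =
exp(-izx/2) u(x,0)*u(x,z/2) satisfies W' = -izγ*γW and W(0) = I, so X = γW solves (I - zK)X = Γ, and
the formula collapses to I - iz∫₀ʳγ*γW = W(r). This yields the canonical system, and solving the
definition of W for u gives the factorization. -/

namespace SkewDirac

/-! ### Bounded Volterra kernels -/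

section Kernel

variable {𝔸 : Type*} [NormedRing 𝔸]

/-- Bounded measurable kernels on the plane, supported in the triangle `0 < t < x < l`. -/
structure IsVolterra (l : ℝ) (k : ℝ → ℝ → 𝔸) : Prop where
  meas : StronglyMeasurable (Function.uncurry k)
  bdd : ∃ C, 0 ≤ C ∧ ∀ x t, ‖k x t‖ ≤ C
  supp : ∀ x t, ¬ (0 < t ∧ t < x ∧ x < l) → k x t = 0

namespace IsVolterra

variable {l : ℝ} {k d : ℝ → ℝ → 𝔸}

lemma zero : IsVolterra l (fun _ _ => (0 : 𝔸)) :=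
  ⟨stronglyMeasurable_const, ⟨0, le_rfl, by simp⟩, fun _ _ _ => rfl⟩

lemma add (hk : IsVolterra l k) (hd : IsVolterra l d) :
    IsVolterra l (fun x t => k x t + d x t) := by
  obtain ⟨C, hC, hC'⟩ := hk.bdd
  obtain ⟨B, hB, hB'⟩ := hd.bdd
  exact ⟨hk.meas.add hd.meas, ⟨C + B, by positivity, fun x t => norm_add_le_of_le (hC' x t) (hB' x t)⟩,
    fun x t h => by rw [hk.supp x t h, hd.supp x t h, add_zero]⟩

lemma neg (hk : IsVolterra l k) : IsVolterra l (fun x t => - k x t) := by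
  obtain ⟨C, hC, hC'⟩ := hk.bdd
  exact ⟨hk.meas.neg, ⟨C, hC, fun x t => by rw [norm_neg]; exact hC' x t⟩,
    fun x t h => by rw [hk.supp x t h, neg_zero]⟩

lemma stronglyMeasurable_row (hk : IsVolterra l k) (x : ℝ) : StronglyMeasurable (k x) :=
  hk.meas.comp_measurable measurable_prodMk_left

lemma mul_eq_zero_of_notMem (hk : IsVolterra l k) {x s η : ℝ}
    (h : ¬ (0 < η ∧ η < x)) : k x η * d η s = 0 := by
  rw [hk.supp x η (fun h' => h ⟨h'.1, h'.2.1⟩), zero_mul]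

lemma measurable_avg_integrand (hk : IsVolterra l k) :
    StronglyMeasurable fun p : (ℝ × ℝ) × ℝ => k p.2 (p.2 - p.1.1 + p.1.2) :=
  hk.meas.comp_measurable (f := Function.uncurry k)
    (g := fun p : (ℝ × ℝ) × ℝ => (p.2, p.2 - p.1.1 + p.1.2)) (by fun_prop)

lemma integrableOn_avg (hk : IsVolterra l k) (x s : ℝ) :
    IntegrableOn (fun y => k y (y - x + s)) (Ioo 0 x) := by
  obtain ⟨C, hC, hC'⟩ := hk.bdd
  refine Measure.integrableOn_of_bounded (M := C) measure_Ioo_lt_top.ne ?_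
    (.of_forall fun η => hC' _ _)
  exact ((measurable_avg_integrand hk).comp_measurable
    (measurable_prodMk_left (x := (x, s)))).aestronglyMeasurable

end IsVolterra

/-! ### Composition, diagonal averages and Picard iteration for kernels -/

variable [NormedSpace ℝ 𝔸]

/-- The kernel of the composition of two Volterra operators. -/
def kcomp (k d : ℝ → ℝ → 𝔸) (x s : ℝ) : 𝔸 := ∫ η, k x η * d η s

/-- The integral of a kernel along the lines parallel to the diagonal. -/
def kavg (l : ℝ) (R : ℝ → ℝ → 𝔸) (x s : ℝ) : 𝔸 :=
  if x < l then ∫ y in Ioo 0 x, R y (y - x + s) else 0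

/-- One integration passes from a term of the exponential series to the next; this gain makes
Volterra iterations converge with no smallness assumption on `l` or on the kernel. -/
lemma norm_setIntegral_le_pow {E : Type*} [NormedAddCommGroup E] [NormedSpace ℝ E]
    {h : ℝ → E} {x M : ℝ} {n : ℕ} (hx : 0 < x)
    (hh : ∀ y ∈ Ioo 0 x, ‖h y‖ ≤ M * y ^ n / n.factorial) :
    ‖∫ y in Ioo 0 x, h y‖ ≤ M * x ^ (n + 1) / (n + 1).factorial := by
  have hint : IntegrableOn (fun y : ℝ => M * y ^ n / n.factorial) (Ioo 0 x) :=
    ((Continuous.integrableOn_Icc (by fun_prop)).mono_set Ioo_subset_Icc_self)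
  refine (norm_integral_le_of_norm_le hint ?_).trans_eq ?_
  · filter_upwards [ae_restrict_mem measurableSet_Ioo] with y hy using hh y hy
  · rw [← integral_Ioc_eq_integral_Ioo, ← intervalIntegral.integral_of_le hx.le]
    simp only [mul_div_assoc]
    rw [intervalIntegral.integral_const_mul, intervalIntegral.integral_div, integral_pow,
      Nat.factorial_succ]
    push_cast
    field_simp
    simp

namespace IsVolterra

variable {l : ℝ} {k d : ℝ → ℝ → 𝔸}

lemma kcomp_eq (hk : IsVolterra l k) (d : ℝ → ℝ → 𝔸) (x s : ℝ) :
    kcomp k d x s = ∫ η in Ioo 0 x, k x η * d η s := by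
  rw [kcomp, setIntegral_eq_integral_of_forall_compl_eq_zero]
  exact fun η hη => mul_eq_zero_of_notMem hk hη

lemma integrable_mul (hk : IsVolterra l k) (hd : IsVolterra l d) (x s : ℝ) :
    Integrable (fun η => k x η * d η s) := by
  obtain ⟨C, hC, hC'⟩ := hk.bdd
  obtain ⟨B, hB, hB'⟩ := hd.bdd
  have : IntegrableOn (fun η => k x η * d η s) (Ioo 0 x) := by
    refine Measure.integrableOn_of_bounded (M := C * B) measure_Ioo_lt_top.ne ?_ ?_
    · exact ((hk.meas.comp_measurable measurable_prodMk_left).mul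
        (hd.meas.comp_measurable measurable_prodMk_right)).aestronglyMeasurable
    · exact .of_forall fun η => (norm_mul_le _ _).trans
        (mul_le_mul (hC' _ _) (hB' _ _) (norm_nonneg _) hC)
  rw [← integrable_indicator_iff measurableSet_Ioo] at this
  refine this.congr (.of_forall fun η => ?_)
  by_cases hη : η ∈ Ioo 0 x
  · rw [indicator_of_mem hη]
  · rw [indicator_of_notMem hη]
    exact (mul_eq_zero_of_notMem hk hη).symm

lemma kcomp (hk : IsVolterra l k) (hd : IsVolterra l d) : IsVolterra l (kcomp k d) := by
  obtain ⟨C, hC, hC'⟩ := hk.bdd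
  obtain ⟨B, hB, hB'⟩ := hd.bdd
  have hsupp : ∀ x t, ¬ (0 < t ∧ t < x ∧ x < l) → SkewDirac.kcomp k d x t = 0 := by
    intro x t h
    refine integral_eq_zero_of_ae (.of_forall fun η => ?_)
    simp only [Pi.zero_apply]
    by_cases h1 : 0 < η ∧ η < x ∧ x < l
    · rw [hd.supp η t (fun h2 => h ⟨h2.1, h2.2.1.trans h1.2.1, h1.2.2⟩), mul_zero]
    · rw [hk.supp x η h1, zero_mul]
  refine ⟨?_, ⟨C * B * |l|, by positivity, fun x t => ?_⟩, hsupp⟩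
  · have : StronglyMeasurable (fun p : (ℝ × ℝ) × ℝ => k p.1.1 p.2 * d p.2 p.1.2) :=
      (hk.meas.comp_measurable (f := Function.uncurry k)
        (g := fun p : (ℝ × ℝ) × ℝ => (p.1.1, p.2)) (by fun_prop)).mul
      (hd.meas.comp_measurable (f := Function.uncurry d)
        (g := fun p : (ℝ × ℝ) × ℝ => (p.2, p.1.2)) (by fun_prop))
    exact this.integral_prod_right' (ν := volume)
  · by_cases h : 0 < t ∧ t < x ∧ x < l
    · rw [kcomp_eq hk d]
      refine (norm_setIntegral_le_of_norm_le_const (C := C * B) measure_Ioo_lt_top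
        fun η _ => (norm_mul_le _ _).trans
          (mul_le_mul (hC' _ _) (hB' _ _) (norm_nonneg _) hC)).trans ?_
      have h0 : 0 < x := h.1.trans h.2.1
      rw [Real.volume_real_Ioo_of_le h0.le, sub_zero]
      exact mul_le_mul_of_nonneg_left (h.2.2.le.trans (le_abs_self l)) (by positivity)
    · rw [hsupp x t h, norm_zero]; positivity

lemma kavg (hk : IsVolterra l k) : IsVolterra l (kavg l k) := by
  obtain ⟨C, hC, hC'⟩ := hk.bdd
  have hsupp : ∀ x t, ¬ (0 < t ∧ t < x ∧ x < l) → SkewDirac.kavg l k x t = 0 := by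
    intro x t h
    rw [SkewDirac.kavg]
    split_ifs with hx
    · refine setIntegral_eq_zero_of_forall_eq_zero fun y hy => ?_
      refine hk.supp _ _ fun h' => h ⟨?_, ?_, hx⟩
      · linarith [h'.1, hy.2]
      · linarith [h'.2.1]
    · rfl
  refine ⟨?_, ⟨C * |l|, by positivity, fun x t => ?_⟩, hsupp⟩
  -- The domain of integration depends on `x`; encoding it as an indicator makes this a parametric
  -- integral over the whole line.
  · have h1 : StronglyMeasurable (fun p : (ℝ × ℝ) × ℝ =>
        ({p | 0 < p.2 ∧ p.2 < p.1.1} : Set ((ℝ × ℝ) × ℝ)).indicator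
          (fun p => k p.2 (p.2 - p.1.1 + p.1.2)) p) :=
      (measurable_avg_integrand hk).indicator
        ((measurableSet_lt measurable_const measurable_snd).inter
          (measurableSet_lt measurable_snd (by fun_prop)))
    have h2 := (h1.integral_prod_right' (ν := volume)).indicator
      (s := {p : ℝ × ℝ | p.1 < l}) (measurableSet_lt (by fun_prop) measurable_const)
    convert h2 using 1
    ext ⟨x, s⟩
    simp only [Function.uncurry, SkewDirac.kavg, indicator, mem_ofPred_eq]
    split_ifs with hx
    · rw [← integral_indicator measurableSet_Ioo]
      congr 1
      ext y
      simp [indicator]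
    · rfl
  · by_cases h : 0 < t ∧ t < x ∧ x < l
    · rw [SkewDirac.kavg, if_pos h.2.2]
      refine (norm_setIntegral_le_of_norm_le_const (C := C) measure_Ioo_lt_top
        fun η _ => hC' _ _).trans ?_
      have h0 : 0 < x := h.1.trans h.2.1
      rw [Real.volume_real_Ioo_of_le h0.le, sub_zero]
      exact mul_le_mul_of_nonneg_left (h.2.2.le.trans (le_abs_self l)) (by positivity)
    · rw [hsupp x t h, norm_zero]; positivity

lemma norm_kcomp_le (hk : IsVolterra l k) {C M : ℝ} {n : ℕ} (hC : 0 ≤ C)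
    (hkC : ∀ x t, ‖k x t‖ ≤ C)
    (hdM : ∀ x s, 0 < x → x < l → ‖d x s‖ ≤ M * x ^ n / n.factorial) {x s : ℝ}
    (hx : 0 < x) (hxl : x < l) :
    ‖SkewDirac.kcomp k d x s‖ ≤ C * M * x ^ (n + 1) / (n + 1).factorial := by
  rw [kcomp_eq hk d]
  refine norm_setIntegral_le_pow hx fun y hy => (norm_mul_le _ _).trans ?_
  refine (mul_le_mul (hkC _ _) (hdM y s hy.1 (hy.2.trans hxl)) (norm_nonneg _) hC).trans_eq ?_
  ring

lemma norm_kavg_le {M : ℝ} {n : ℕ}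
    (hkM : ∀ x s, 0 < x → x < l → ‖k x s‖ ≤ M * x ^ n / n.factorial) {x s : ℝ}
    (hx : 0 < x) (hxl : x < l) :
    ‖SkewDirac.kavg l k x s‖ ≤ M * x ^ (n + 1) / (n + 1).factorial := by
  rw [SkewDirac.kavg, if_pos hxl]
  exact norm_setIntegral_le_pow hx fun y hy => hkM _ _ hy.1 (hy.2.trans hxl)

/-- Picard iteration for Volterra kernels. -/
theorem exists_fixedPoint [CompleteSpace 𝔸] {C : ℝ} (hC : 0 ≤ C) (T : (ℝ → ℝ → 𝔸) → ℝ → ℝ → 𝔸)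
    (hT : ∀ k, IsVolterra l k → IsVolterra l (T k))
    (hlip : ∀ k d, IsVolterra l k → IsVolterra l d → ∀ (M : ℝ) (n : ℕ), 0 ≤ M →
      (∀ x s, 0 < x → x < l → ‖k x s - d x s‖ ≤ M * x ^ n / n.factorial) →
      ∀ x s, 0 < x → x < l →
        ‖T k x s - T d x s‖ ≤ C * M * x ^ (n + 1) / (n + 1).factorial) :
    ∃ k, IsVolterra l k ∧ T k = k := by
  set a : ℕ → ℝ → ℝ → 𝔸 := fun n => T^[n] (fun _ _ => 0) with ha
  have hsucc : ∀ n, a (n + 1) = T (a n) := fun n => Function.iterate_succ_apply' T n _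
  have haV : ∀ n, IsVolterra l (a n) := by
    intro n
    induction n with
    | zero => exact zero
    | succ n ih => rw [hsucc]; exact hT _ ih
  obtain ⟨M, hM, hM'⟩ := (haV 1).bdd
  have hstep : ∀ n x s, 0 < x → x < l →
      ‖a (n + 1) x s - a n x s‖ ≤ C ^ n * M * x ^ n / n.factorial := by
    intro n
    induction n with
    | zero =>
      intro x s _ _
      have h0 : a 0 x s = 0 := rfl
      simpa [h0] using hM' x s
    | succ n ih =>
      intro x s hx hxl
      have := hlip _ _ (haV (n + 1)) (haV n) (C ^ n * M) n (by positivity) ih x s hx hxl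
      rw [← hsucc, ← hsucc] at this
      refine this.trans_eq ?_
      ring
  -- Bounding `x` by `|l|` gives an exponential majorant independent of `x` and `s`, so the limit
  -- kernel is bounded as well as measurable.
  set c : ℕ → ℝ := fun n => M * ((C * |l|) ^ n / n.factorial) with hc
  have hcs : Summable c := (Real.summable_pow_div_factorial _).mul_left M
  have hc0 : ∀ n, 0 ≤ c n := fun n => by positivity
  have hstep' : ∀ n x s, dist (a n x s) (a (n + 1) x s) ≤ c n := by
    intro n x s
    rw [dist_comm, dist_eq_norm]
    by_cases h : 0 < s ∧ s < x ∧ x < l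
    · have hx : 0 < x := h.1.trans h.2.1
      refine (hstep n x s hx h.2.2).trans ?_
      have h1 : x ^ n ≤ |l| ^ n := pow_le_pow_left₀ hx.le (h.2.2.le.trans (le_abs_self l)) n
      calc C ^ n * M * x ^ n / n.factorial ≤ C ^ n * M * |l| ^ n / n.factorial := by gcongr
        _ = c n := by rw [hc]; ring
    · rw [(haV _).supp x s h, (haV _).supp x s h]; simpa using hc0 n
  have hcauchy : ∀ x s, ∃ b, Filter.Tendsto (fun n => a n x s) Filter.atTop (nhds b) := fun x s =>
    cauchySeq_tendsto_of_complete (cauchySeq_of_dist_le_of_summable c (fun n => hstep' n x s) hcs)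
  choose b hb using hcauchy
  set τ : ℕ → ℝ := fun n => ∑' m, c (n + m) with hτ
  have hτ0 : Filter.Tendsto τ Filter.atTop (nhds 0) := by
    have := tendsto_sum_nat_add c
    simpa only [hτ, add_comm] using this
  have hτn : ∀ n, 0 ≤ τ n := fun n => tsum_nonneg fun m => hc0 _
  have hdist : ∀ n x s, ‖b x s - a n x s‖ ≤ τ n := fun n x s => by
    rw [← dist_eq_norm, dist_comm]
    exact dist_le_tsum_of_dist_le_of_tendsto c (fun n => hstep' n x s) hcs (hb x s) n
  have hbV : IsVolterra l b := by
    refine ⟨?_, ⟨τ 0, hτn 0, fun x s => by simpa [ha] using hdist 0 x s⟩, fun x s h => ?_⟩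
    · refine stronglyMeasurable_of_tendsto (f := fun n => Function.uncurry (a n)) Filter.atTop
        (fun n => (haV n).meas) ?_
      rw [tendsto_pi_nhds]
      exact fun p => hb p.1 p.2
    · refine tendsto_nhds_unique (hb x s) ?_
      simp only [(haV _).supp x s h]
      exact tendsto_const_nhds
  refine ⟨b, hbV, ?_⟩
  ext x s
  by_cases h : 0 < s ∧ s < x ∧ x < l
  · have hx : 0 < x := h.1.trans h.2.1
    have h1 : Filter.Tendsto (fun n => a (n + 1) x s) Filter.atTop (nhds (T b x s)) := by
      rw [tendsto_iff_norm_sub_tendsto_zero]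
      -- The Lipschitz hypothesis at exponent `0`, with `M` the uniform tail bound `τ n`, passes `T`
      -- to the limit.
      refine squeeze_zero (fun _ => norm_nonneg _) (g := fun n => C * τ n * x ^ (0 + 1) / (0 + 1).factorial)
        (fun n => ?_) ?_
      · rw [norm_sub_rev, hsucc]
        exact hlip _ _ hbV (haV n) (τ n) 0 (hτn n)
          (fun x s _ _ => by simpa using hdist n x s) x s hx h.2.2
      · simpa using (hτ0.const_mul C).mul_const x
    exact tendsto_nhds_unique h1 ((hb x s).comp (Filter.tendsto_add_atTop_nat 1))
  · rw [(hT b hbV).supp x s h, hbV.supp x s h]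

lemma kcomp_sub (hk : IsVolterra l k) {d e : ℝ → ℝ → 𝔸} (hd : IsVolterra l d)
    (he : IsVolterra l e) (x s : ℝ) :
    SkewDirac.kcomp k d x s - SkewDirac.kcomp k e x s
      = SkewDirac.kcomp k (fun x s => d x s + - e x s) x s := by
  rw [SkewDirac.kcomp, SkewDirac.kcomp, SkewDirac.kcomp,
    ← integral_sub (integrable_mul hk hd x s) (integrable_mul hk he x s)]
  simp only [mul_add, mul_neg, sub_eq_add_neg]

lemma kavg_sub (hk : IsVolterra l k) (hd : IsVolterra l d) (x s : ℝ) :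
    SkewDirac.kavg l k x s - SkewDirac.kavg l d x s
      = SkewDirac.kavg l (fun x s => k x s - d x s) x s := by
  simp only [SkewDirac.kavg]
  split_ifs
  · rw [← integral_sub (integrableOn_avg hk x s) (integrableOn_avg hd x s)]
  · simp

/-- The resolvent kernel of a Volterra kernel. -/
theorem exists_resolvent [CompleteSpace 𝔸] (hk : IsVolterra l k) :
    ∃ d, IsVolterra l d ∧ ∀ x s, d x s + (k x s + SkewDirac.kcomp k d x s) = 0 := by
  obtain ⟨C, hC, hC'⟩ := hk.bdd
  obtain ⟨d, hd, hd'⟩ := exists_fixedPoint (l := l) hC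
    (fun d x s => - (k x s + SkewDirac.kcomp k d x s))
    (fun d hd => (hk.add (hk.kcomp hd)).neg) (by
      intro d e hd he M n hM hde x s hx hxl
      rw [show -(k x s + SkewDirac.kcomp k d x s) - -(k x s + SkewDirac.kcomp k e x s)
        = -(SkewDirac.kcomp k d x s - SkewDirac.kcomp k e x s) by abel, norm_neg,
        kcomp_sub hk hd he]
      exact norm_kcomp_le hk hC hC'
        (fun x s hx hxl => by rw [← sub_eq_add_neg]; exact hde x s hx hxl) hx hxl)
  refine ⟨d, hd, fun x s => ?_⟩
  nth_rewrite 1 [← hd']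
  simp

/-- The kernel `d` with `∂ₓ d + ∂ₛ d = -(k + k d)` and `d(x, 0) = 0`. -/
theorem exists_transmutation [CompleteSpace 𝔸] (hk : IsVolterra l k) :
    ∃ d, IsVolterra l d ∧ ∀ x s,
      d x s + SkewDirac.kavg l (fun x s => k x s + SkewDirac.kcomp k d x s) x s = 0 := by
  obtain ⟨C, hC, hC'⟩ := hk.bdd
  -- Composition and averaging each gain one power and one factorial; a single gain suffices, so the
  -- one from composition is spent as the factor `|l|`.
  obtain ⟨d, hd, hd'⟩ := exists_fixedPoint (l := l) (C := C * |l|) (by positivity)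
    (fun d x s => - SkewDirac.kavg l (fun x s => k x s + SkewDirac.kcomp k d x s) x s)
    (fun d hd => (hk.add (hk.kcomp hd)).kavg.neg) (by
      intro d e hd he M n hM hde x s hx hxl
      rw [neg_sub_neg, ← norm_neg, neg_sub, kavg_sub (hk.add (hk.kcomp hd)) (hk.add (hk.kcomp he))]
      refine norm_kavg_le (fun y t hy hyl => ?_) hx hxl
      rw [add_sub_add_left_eq_sub, kcomp_sub hk hd he]
      refine (norm_kcomp_le hk hC hC'
        (fun x s hx hxl => by rw [← sub_eq_add_neg]; exact hde x s hx hxl) hy hyl).trans ?_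
      have h1 : y / (n + 1 : ℕ) ≤ |l| :=
        (div_le_self hy.le (by simp)).trans (hyl.le.trans (le_abs_self l))
      calc C * M * y ^ (n + 1) / (n + 1).factorial
          = C * M * y ^ n / n.factorial * (y / (n + 1 : ℕ)) := by
            rw [Nat.factorial_succ]; push_cast; field_simp; ring
        _ ≤ C * M * y ^ n / n.factorial * |l| := by gcongr
        _ = C * |l| * M * y ^ n / n.factorial := by ring)
  refine ⟨d, hd, fun x s => ?_⟩
  nth_rewrite 1 [← hd']
  simp

end IsVolterra

end Kernel

/-! ### Volterra operators on `L²` -/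

section Operators

variable {n : ℕ} {l : ℝ} {k d : ℝ → ℝ → Matrix (Fin n) (Fin n) ℂ}

/-- The Volterra integral with kernel `k` of a function. -/
def vint (l : ℝ) (k : ℝ → ℝ → Matrix (Fin n) (Fin n) ℂ) (f : ℝ → EuclideanSpace ℂ (Fin n))
    (x : ℝ) : EuclideanSpace ℂ (Fin n) :=
  ∫ t, toEuclideanCLM (𝕜 := ℂ) (k x t) (f t) ∂(vol l)

lemma norm_toEuclideanCLM_apply_le {m : Type*} [Fintype m] [DecidableEq m] (M : Matrix m m ℂ)
    (w : EuclideanSpace ℂ m) : ‖toEuclideanCLM (𝕜 := ℂ) M w‖ ≤ ‖M‖ * ‖w‖ :=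
  ((toEuclideanCLM (𝕜 := ℂ) M).le_opNorm w).trans_eq (by rw [l2_opNorm_toEuclideanCLM])

lemma continuous_toEuclideanCLM {m : Type*} [Fintype m] [DecidableEq m] :
    Continuous (toEuclideanCLM (n := m) (𝕜 := ℂ)) :=
  (toEuclideanCLM (n := m) (𝕜 := ℂ)).toAlgEquiv.toLinearMap.continuous_of_finiteDimensional

lemma aestronglyMeasurable_toEuclideanCLM_apply {α m : Type*} [MeasurableSpace α] [Fintype m]
    [DecidableEq m] {μ : Measure α}
    {M : α → Matrix m m ℂ} {f : α → EuclideanSpace ℂ m} (hM : AEStronglyMeasurable M μ)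
    (hf : AEStronglyMeasurable f μ) :
    AEStronglyMeasurable (fun a => toEuclideanCLM (𝕜 := ℂ) (M a) (f a)) μ :=
  isBoundedBilinearMap_apply.continuous.comp_aestronglyMeasurable
    ((continuous_toEuclideanCLM.comp_aestronglyMeasurable hM).prodMk hf)

lemma vint_congr {f g : ℝ → EuclideanSpace ℂ (Fin n)} (h : f =ᵐ[vol l] g) (x : ℝ) :
    vint l k f x = vint l k g x :=
  integral_congr_ae (h.mono fun t ht => by simp only [ht])

lemma IsVolterra.integrable_row (hk : IsVolterra l k) {f : ℝ → EuclideanSpace ℂ (Fin n)}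
    (hf : Integrable f (vol l)) (x : ℝ) :
    Integrable (fun t => toEuclideanCLM (𝕜 := ℂ) (k x t) (f t)) (vol l) := by
  obtain ⟨C, hC, hC'⟩ := hk.bdd
  refine (hf.norm.const_mul C).mono' (aestronglyMeasurable_toEuclideanCLM_apply
    (hk.stronglyMeasurable_row x).aestronglyMeasurable hf.aestronglyMeasurable)
    (.of_forall fun t => (norm_toEuclideanCLM_apply_le _ _).trans ?_)
  exact mul_le_mul_of_nonneg_right (hC' x t) (norm_nonneg _)

lemma vint_add_right (hk : IsVolterra l k) {f g : ℝ → EuclideanSpace ℂ (Fin n)}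
    (hf : Integrable f (vol l)) (hg : Integrable g (vol l)) (x : ℝ) :
    vint l k (fun t => f t + g t) x = vint l k f x + vint l k g x := by
  simp only [vint, map_add]
  exact integral_add (hk.integrable_row hf x) (hk.integrable_row hg x)

lemma vint_smul_right (k : ℝ → ℝ → Matrix (Fin n) (Fin n) ℂ) (c : ℂ)
    (f : ℝ → EuclideanSpace ℂ (Fin n)) (x : ℝ) :
    vint l k (fun t => c • f t) x = c • vint l k f x := by
  simp only [vint, map_smul]
  exact integral_smul _ _

lemma vint_add_left (hk : IsVolterra l k) (hd : IsVolterra l d)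
    {f : ℝ → EuclideanSpace ℂ (Fin n)} (hf : Integrable f (vol l)) (x : ℝ) :
    vint l (fun x t => k x t + d x t) f x = vint l k f x + vint l d f x := by
  simp only [vint, map_add, _root_.add_apply]
  exact integral_add (hk.integrable_row hf x) (hd.integrable_row hf x)

/-- A Volterra integral as an integral over `(0, x)`. -/
lemma vint_eq_intervalIntegral (hk : IsVolterra l k) (f : ℝ → EuclideanSpace ℂ (Fin n)) {x : ℝ}
    (hx : x ∈ Ioo 0 l) :
    vint l k f x = ∫ t in (0 : ℝ)..x, toEuclideanCLM (𝕜 := ℂ) (k x t) (f t) := by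
  rw [intervalIntegral.integral_of_le hx.1.le, integral_Ioc_eq_integral_Ioo, vint]
  refine setIntegral_eq_of_subset_of_forall_sdiff_eq_zero measurableSet_Ioo
    (Ioo_subset_Ioo_right hx.2.le) fun t ht => ?_
  rw [hk.supp x t fun h => ht.2 ⟨h.1, h.2.1⟩]
  simp

lemma norm_vint_le {C : ℝ} (hC' : ∀ x t, ‖k x t‖ ≤ C) {f : ℝ → EuclideanSpace ℂ (Fin n)}
    (hf : Integrable f (vol l)) (x : ℝ) : ‖vint l k f x‖ ≤ C * ∫ t, ‖f t‖ ∂(vol l) := by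
  rw [← integral_const_mul]
  refine norm_integral_le_of_norm_le (hf.norm.const_mul C) (.of_forall fun t => ?_)
  exact (norm_toEuclideanCLM_apply_le _ _).trans
    (mul_le_mul_of_nonneg_right (hC' x t) (norm_nonneg _))

lemma aestronglyMeasurable_prod (hk : IsVolterra l k)
    {f : ℝ → EuclideanSpace ℂ (Fin n)} (hf : Integrable f (vol l)) :
    AEStronglyMeasurable (fun p : ℝ × ℝ => toEuclideanCLM (𝕜 := ℂ) (k p.1 p.2) (f p.2))
      ((vol l).prod (vol l)) :=
  aestronglyMeasurable_toEuclideanCLM_apply hk.meas.aestronglyMeasurable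
    hf.aestronglyMeasurable.comp_snd

lemma aestronglyMeasurable_vint (hk : IsVolterra l k) {f : ℝ → EuclideanSpace ℂ (Fin n)}
    (hf : Integrable f (vol l)) : AEStronglyMeasurable (vint l k f) (vol l) :=
  (aestronglyMeasurable_prod hk hf).integral_prod_right'

lemma integrable_coe (f : L2 n l) : Integrable (fun x => f x) (vol l) := integrableOn_coe f

lemma exists_integral_norm_le (n : ℕ) (l : ℝ) :
    ∃ B : ℝ, 0 ≤ B ∧ ∀ f : L2 n l, ∫ t, ‖f t‖ ∂(vol l) ≤ B * ‖f‖ := by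
  refine ⟨((vol l univ) ^ (1 / (1 : ℝ≥0∞).toReal - 1 / (2 : ℝ≥0∞).toReal)).toReal,
    ENNReal.toReal_nonneg, fun f => ?_⟩
  rw [integral_norm_eq_lintegral_enorm (Lp.aestronglyMeasurable f), ← eLpNorm_one_eq_lintegral_enorm]
  have h2 := eLpNorm_le_eLpNorm_mul_rpow_measure_univ (μ := vol l) (p := 1) (q := 2)
    (by norm_num) (Lp.aestronglyMeasurable f)
  have hfin : (vol l univ) ^ (1 / (1 : ℝ≥0∞).toReal - 1 / (2 : ℝ≥0∞).toReal) ≠ ⊤ :=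
    ENNReal.rpow_ne_top_of_nonneg (by norm_num) (measure_ne_top _ _)
  have h3 := ENNReal.toReal_mono (ENNReal.mul_ne_top (Lp.eLpNorm_ne_top f) hfin) h2
  rw [ENNReal.toReal_mul] at h3
  rw [Lp.norm_def, mul_comm]
  exact h3

lemma memLp_vint (hk : IsVolterra l k) {f : ℝ → EuclideanSpace ℂ (Fin n)}
    (hf : Integrable f (vol l)) : MemLp (vint l k f) 2 (vol l) := by
  obtain ⟨C, hC, hC'⟩ := hk.bdd
  exact MemLp.of_bound (aestronglyMeasurable_vint hk hf) _ (.of_forall (norm_vint_le hC' hf))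

lemma integrable_vint (hk : IsVolterra l k) {f : ℝ → EuclideanSpace ℂ (Fin n)}
    (hf : Integrable f (vol l)) : Integrable (vint l k f) (vol l) :=
  (memLp_vint hk hf).integrable (by norm_num)

/-- The Volterra operator on `L²` with kernel `k`. -/
def kernelOp (hk : IsVolterra l k) : L2 n l →L[ℂ] L2 n l :=
  LinearMap.mkContinuousOfExistsBound
    { toFun := fun f => (memLp_vint hk (integrable_coe f)).toLp _
      map_add' := fun f g => by
        rw [← MemLp.toLp_add, MemLp.toLp_eq_toLp_iff]
        refine .of_forall fun x => ?_
        rw [vint_congr (Lp.coeFn_add f g)]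
        exact vint_add_right hk (integrable_coe f) (integrable_coe g) x
      map_smul' := fun c f => by
        rw [RingHom.id_apply, ← MemLp.toLp_const_smul, MemLp.toLp_eq_toLp_iff]
        refine .of_forall fun x => ?_
        rw [vint_congr (Lp.coeFn_smul c f)]
        exact vint_smul_right k c f x }
    (by
      obtain ⟨C, hC, hC'⟩ := hk.bdd
      obtain ⟨B, hB, hB'⟩ := exists_integral_norm_le n l
      refine ⟨measureUnivNNReal (vol l) ^ (2 : ℝ≥0∞).toReal⁻¹ * (C * B), fun f => ?_⟩
      rw [mul_assoc]
      refine Lp.norm_le_of_ae_bound (by positivity) ?_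
      filter_upwards [(memLp_vint hk (integrable_coe f)).coeFn_toLp] with x hx
      simp only [LinearMap.coe_mk, AddHom.coe_mk]
      rw [hx]
      refine (norm_vint_le hC' (integrable_coe f) x).trans ?_
      rw [mul_assoc]
      exact mul_le_mul_of_nonneg_left (hB' f) hC)

lemma coeFn_kernelOp (hk : IsVolterra l k) (f : L2 n l) :
    kernelOp hk f =ᵐ[vol l] vint l k f :=
  (memLp_vint hk (integrable_coe f)).coeFn_toLp

lemma toL2_eq_toLp {f : ℝ → EuclideanSpace ℂ (Fin n)} (h : MemLp f 2 (vol l)) :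
    toL2 l f = h.toLp f := dif_pos h

lemma coeFn_toL2 {f : ℝ → EuclideanSpace ℂ (Fin n)} (h : MemLp f 2 (vol l)) :
    toL2 l f =ᵐ[vol l] f := by
  rw [toL2_eq_toLp h]; exact h.coeFn_toLp

lemma toL2_congr {f g : ℝ → EuclideanSpace ℂ (Fin n)} (hf : MemLp f 2 (vol l))
    (h : f =ᵐ[vol l] g) : toL2 l f = toL2 l g := by
  rw [toL2_eq_toLp hf, toL2_eq_toLp (hf.ae_eq h), MemLp.toLp_eq_toLp_iff]
  exact h

lemma eq_toL2_of_ae_eq {f : L2 n l} {g : ℝ → EuclideanSpace ℂ (Fin n)} (h : f =ᵐ[vol l] g) :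
    f = toL2 l g := by
  rw [toL2_eq_toLp ((Lp.memLp f).ae_eq h)]
  exact Lp.ext (h.trans ((Lp.memLp f).ae_eq h).coeFn_toLp.symm)

lemma kernelOp_toL2 (hk : IsVolterra l k) {f : ℝ → EuclideanSpace ℂ (Fin n)}
    (hf : MemLp f 2 (vol l)) : kernelOp hk (toL2 l f) = toL2 l (vint l k f) :=
  eq_toL2_of_ae_eq ((coeFn_kernelOp hk _).trans (.of_forall (vint_congr (coeFn_toL2 hf))))

lemma kernelOp_congr (hk : IsVolterra l k) (hd : IsVolterra l d) (h : ∀ x t, k x t = d x t) :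
    kernelOp hk = kernelOp hd := by
  obtain rfl : k = d := by ext1 x; ext1 t; exact h x t
  rfl

lemma kernelOp_add (hk : IsVolterra l k) (hd : IsVolterra l d) :
    kernelOp (hk.add hd) = kernelOp hk + kernelOp hd := by
  ext1 f
  refine Lp.ext ?_
  filter_upwards [coeFn_kernelOp (hk.add hd) f, coeFn_kernelOp hk f, coeFn_kernelOp hd f,
    Lp.coeFn_add (kernelOp hk f) (kernelOp hd f)] with x h1 h2 h3 h4
  rw [_root_.add_apply, h4, Pi.add_apply, h1, h2, h3,
    vint_add_left hk hd (integrable_coe f)]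

/-- Fubini: bounded kernels against an integrable function give an absolutely integrable double
integral. -/
lemma vint_vint (hk : IsVolterra l k) (hd : IsVolterra l d) {f : ℝ → EuclideanSpace ℂ (Fin n)}
    (hf : Integrable f (vol l)) (x : ℝ) :
    vint l k (vint l d f) x = vint l (kcomp k d) f x := by
  obtain ⟨C, hC, hC'⟩ := hk.bdd
  obtain ⟨B, hB, hB'⟩ := hd.bdd
  have hmeas : AEStronglyMeasurable (fun p : ℝ × ℝ =>
      toEuclideanCLM (𝕜 := ℂ) (k x p.1 * d p.1 p.2) (f p.2)) ((vol l).prod (vol l)) :=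
    aestronglyMeasurable_toEuclideanCLM_apply
      (((hk.stronglyMeasurable_row x).comp_measurable measurable_fst).mul
        hd.meas).aestronglyMeasurable hf.aestronglyMeasurable.comp_snd
  have hint : Integrable (fun p : ℝ × ℝ =>
      toEuclideanCLM (𝕜 := ℂ) (k x p.1 * d p.1 p.2) (f p.2)) ((vol l).prod (vol l)) := by
    refine ((hf.norm.comp_snd (vol l)).const_mul (C * B)).mono' hmeas (.of_forall fun p => ?_)
    refine (norm_toEuclideanCLM_apply_le _ _).trans
      (mul_le_mul_of_nonneg_right ((norm_mul_le _ _).trans ?_) (norm_nonneg _))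
    exact mul_le_mul (hC' _ _) (hB' _ _) (norm_nonneg _) hC
  have h1 : ∀ η, toEuclideanCLM (𝕜 := ℂ) (k x η) (vint l d f η)
      = ∫ t, toEuclideanCLM (𝕜 := ℂ) (k x η * d η t) (f t) ∂(vol l) := by
    intro η
    rw [vint, ← ContinuousLinearMap.integral_comp_comm _ (hd.integrable_row hf η)]
    simp only [map_mul, mul_apply_eq_comp]
  rw [vint]
  simp only [h1]
  rw [integral_integral_swap hint, vint]
  refine integral_congr_ae (.of_forall fun t => ?_)
  have h2 : kcomp k d x t = ∫ η, k x η * d η t ∂(vol l) := by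
    rw [kcomp, setIntegral_eq_integral_of_forall_compl_eq_zero]
    intro η hη
    rw [hk.supp x η fun h => hη ⟨h.1, h.2.1.trans h.2.2⟩, zero_mul]
  -- The action on the fixed vector `f t` is linear in the matrix, so it comes out of the integral
  -- that defines the composed kernel.
  let L : Matrix (Fin n) (Fin n) ℂ →L[ℂ] EuclideanSpace ℂ (Fin n) :=
    (ContinuousLinearMap.apply ℂ _ (f t)) ∘L
      ⟨(toEuclideanCLM (n := Fin n) (𝕜 := ℂ)).toAlgEquiv.toLinearMap, continuous_toEuclideanCLM⟩
  have h3 := L.integral_comp_comm (μ := vol l) (φ := fun η => k x η * d η t)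
    (hk.integrable_mul hd x t).integrableOn
  simp only [h2]
  exact h3

lemma kernelOp_comp (hk : IsVolterra l k) (hd : IsVolterra l d) :
    kernelOp hk ∘L kernelOp hd = kernelOp (hk.kcomp hd) := by
  ext1 f
  refine Lp.ext ?_
  filter_upwards [coeFn_kernelOp hk (kernelOp hd f), coeFn_kernelOp (hk.kcomp hd) f] with x h1 h2
  rw [ContinuousLinearMap.comp_apply, h1, h2, vint_congr (coeFn_kernelOp hd f),
    vint_vint hk hd (integrable_coe f)]

lemma kernelOp_eq_zero (hk : IsVolterra l k) (h : ∀ x t, k x t = 0) : kernelOp hk = 0 := by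
  ext1 f
  refine Lp.ext ?_
  filter_upwards [coeFn_kernelOp hk f, Lp.coeFn_zero (EuclideanSpace ℂ (Fin n)) 2 (vol l)]
    with x h1 h2
  rw [h1, _root_.zero_apply, h2, vint]
  simp [h]

/-- `1 + K` has a right inverse of the same form. -/
lemma exists_right_inverse (hk : IsVolterra l k) :
    ∃ (d : ℝ → ℝ → Matrix (Fin n) (Fin n) ℂ) (hd : IsVolterra l d),
      (1 + kernelOp hk) ∘L (1 + kernelOp hd) = 1 := by
  obtain ⟨d, hd, h⟩ := hk.exists_resolvent
  refine ⟨d, hd, ?_⟩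
  have h0 := kernelOp_eq_zero (hd.add (hk.add (hk.kcomp hd))) h
  rw [kernelOp_add hd (hk.add (hk.kcomp hd)), kernelOp_add hk (hk.kcomp hd),
    ← kernelOp_comp hk hd] at h0
  calc (1 + kernelOp hk) ∘L (1 + kernelOp hd)
      = 1 + (kernelOp hd + (kernelOp hk + kernelOp hk ∘L kernelOp hd)) := by
        ext1 f; simp; abel
    _ = 1 := by rw [h0, add_zero]

/-- The inverse of `1 + K`. -/
theorem exists_inverse (hk : IsVolterra l k) :
    ∃ (d : ℝ → ℝ → Matrix (Fin n) (Fin n) ℂ) (hd : IsVolterra l d),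
      (1 + kernelOp hk) ∘L (1 + kernelOp hd) = 1 ∧ (1 + kernelOp hd) ∘L (1 + kernelOp hk) = 1 := by
  obtain ⟨d, hd, h⟩ := exists_right_inverse hk
  -- The right inverse `1 + D` itself has a right inverse, which must equal its left inverse `1 +
  -- K`; so the inverse is two-sided.
  obtain ⟨e, he, h'⟩ := exists_right_inverse hd
  refine ⟨d, hd, h, ?_⟩
  have : (1 + kernelOp hk : L2 n l →L[ℂ] L2 n l) = 1 + kernelOp he :=
    left_inv_eq_right_inv (a := 1 + kernelOp hd) h h'
  rw [this, h']

end Operators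

/-! ### Transmutation of the operator of integration -/

section Shift

variable {n : ℕ} {l : ℝ} {R : ℝ → ℝ → Matrix (Fin n) (Fin n) ℂ}

lemma integrable_prod_of_bound {E : Type*} [NormedAddCommGroup E] {f : ℝ × ℝ → E} {a b c d B : ℝ}
    (hf : AEStronglyMeasurable f ((volume.restrict (Ioo a b)).prod (volume.restrict (Ioo c d))))
    (hB : ∀ x ∈ Ioo a b, ∀ y ∈ Ioo c d, ‖f (x, y)‖ ≤ B) :
    Integrable f ((volume.restrict (Ioo a b)).prod (volume.restrict (Ioo c d))) := by
  refine Integrable.of_bound hf B ?_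
  rw [Measure.prod_restrict]
  filter_upwards [ae_restrict_mem (measurableSet_Ioo.prod measurableSet_Ioo)] with p hp
  exact hB p.1 hp.1 p.2 hp.2

/-- The kernel of the operator of integration. -/
def intKernel (n : ℕ) (l x t : ℝ) : Matrix (Fin n) (Fin n) ℂ :=
  if 0 < t ∧ t < x ∧ x < l then 1 else 0

lemma isVolterra_intKernel (n : ℕ) (l : ℝ) : IsVolterra l (intKernel n l) := by
  refine ⟨?_, ⟨‖(1 : Matrix (Fin n) (Fin n) ℂ)‖, norm_nonneg _, fun x t => ?_⟩,
    fun x t h => if_neg h⟩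
  · refine StronglyMeasurable.ite ?_ stronglyMeasurable_const stronglyMeasurable_const
    exact (measurableSet_lt measurable_const measurable_snd).inter
      ((measurableSet_lt measurable_snd measurable_fst).inter
        (measurableSet_lt measurable_fst measurable_const))
  · rw [intKernel]
    split_ifs
    · rfl
    · rw [norm_zero]; exact norm_nonneg _

/-- The operator of integration. -/
abbrev opJ (n : ℕ) (l : ℝ) : L2 n l →L[ℂ] L2 n l := kernelOp (isVolterra_intKernel n l)

lemma vint_intKernel (f : ℝ → EuclideanSpace ℂ (Fin n)) {x : ℝ} (hx : x ∈ Ioo 0 l) :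
    vint l (intKernel n l) f x = ∫ t in (0 : ℝ)..x, f t := by
  rw [vint_eq_intervalIntegral (isVolterra_intKernel n l) f hx]
  rw [intervalIntegral.integral_of_le hx.1.le, intervalIntegral.integral_of_le hx.1.le,
    integral_Ioc_eq_integral_Ioo, integral_Ioc_eq_integral_Ioo]
  refine setIntegral_congr_fun measurableSet_Ioo fun t ht => ?_
  simp [intKernel, ht.1, ht.2, hx.2]

lemma opA_eq (n : ℕ) (l : ℝ) : opA n l = (-Complex.I) • opJ n l := by
  ext1 f
  refine Lp.ext ?_
  filter_upwards [(memLp_primitive f).coeFn_toLp, coeFn_kernelOp (isVolterra_intKernel n l) f,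
    Lp.coeFn_smul (-Complex.I) (opJ n l f), ae_restrict_mem measurableSet_Ioo] with x h1 h2 h3 hx
  rw [_root_.smul_apply, h3, Pi.smul_apply, h2, vint_intKernel _ hx]
  exact h1

lemma exists_bound_of_continuous {g : ℝ → EuclideanSpace ℂ (Fin n)} (hg : Continuous g) (l : ℝ) :
    ∃ B, 0 ≤ B ∧ ∀ t ∈ Ioo 0 l, ∀ z ∈ Ioo 0 l, ∀ y ∈ Ioo 0 l, ‖g (t + z - y)‖ ≤ B := by
  -- With all three variables in `(0, l)`, the argument `t + z - y` stays in `[-l, 2l]`.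
  obtain ⟨B, hB⟩ := (isCompact_Icc (a := -l) (b := 2 * l)).exists_bound_of_continuousOn
    hg.continuousOn
  refine ⟨max B 0, le_max_right _ _, fun t ht z hz y hy => (hB _ ?_).trans (le_max_left _ _)⟩
  constructor
  · linarith [ht.1, hz.1, hy.2]
  · linarith [ht.2, hz.2, hy.1]

lemma stronglyMeasurable_act {α : Type*} [MeasurableSpace α] {M : α → Matrix (Fin n) (Fin n) ℂ}
    {f : α → EuclideanSpace ℂ (Fin n)} (hM : StronglyMeasurable M) (hf : StronglyMeasurable f) :
    StronglyMeasurable (fun a => toEuclideanCLM (𝕜 := ℂ) (M a) (f a)) :=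
  isBoundedBilinearMap_apply.continuous.comp_stronglyMeasurable
    ((continuous_toEuclideanCLM.comp_stronglyMeasurable hM).prodMk hf)

/-- The integral of a kernel against a translate of a function. -/
def shiftInt (l : ℝ) (R : ℝ → ℝ → Matrix (Fin n) (Fin n) ℂ) (g : ℝ → EuclideanSpace ℂ (Fin n))
    (y z : ℝ) : EuclideanSpace ℂ (Fin n) :=
  ∫ t, toEuclideanCLM (𝕜 := ℂ) (R y t) (g (t + z - y)) ∂(vol l)

lemma stronglyMeasurable_shiftInt_integrand (hR : IsVolterra l R)
    {g : ℝ → EuclideanSpace ℂ (Fin n)} (hg : Continuous g) :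
    StronglyMeasurable fun p : (ℝ × ℝ) × ℝ =>
      toEuclideanCLM (𝕜 := ℂ) (R p.1.1 p.2) (g (p.2 + p.1.2 - p.1.1)) :=
  stronglyMeasurable_act
    (hR.meas.comp_measurable (g := fun p : (ℝ × ℝ) × ℝ => (p.1.1, p.2)) (by fun_prop))
    (hg.stronglyMeasurable.comp_measurable
      (g := fun p : (ℝ × ℝ) × ℝ => p.2 + p.1.2 - p.1.1) (by fun_prop))

lemma stronglyMeasurable_shiftInt (hR : IsVolterra l R)
    {g : ℝ → EuclideanSpace ℂ (Fin n)} (hg : Continuous g) :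
    StronglyMeasurable fun p : ℝ × ℝ => shiftInt l R g p.1 p.2 :=
  (stronglyMeasurable_shiftInt_integrand hR hg).integral_prod_right' (ν := vol l)

lemma exists_shiftInt_bound (hR : IsVolterra l R)
    {g : ℝ → EuclideanSpace ℂ (Fin n)} (hg : Continuous g) :
    ∃ B, 0 ≤ B ∧ (∀ y ∈ Ioo 0 l, ∀ z ∈ Ioo 0 l, ‖shiftInt l R g y z‖ ≤ B) ∧
      ∃ B', ∀ y ∈ Ioo 0 l, ∀ z ∈ Ioo 0 l, ∀ t ∈ Ioo 0 l,
        ‖toEuclideanCLM (𝕜 := ℂ) (R y t) (g (t + z - y))‖ ≤ B' := by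
  obtain ⟨C, hC, hC'⟩ := hR.bdd
  obtain ⟨B, hB, hB'⟩ := exists_bound_of_continuous hg l
  have h : ∀ y ∈ Ioo 0 l, ∀ z ∈ Ioo 0 l, ∀ t ∈ Ioo 0 l,
      ‖toEuclideanCLM (𝕜 := ℂ) (R y t) (g (t + z - y))‖ ≤ C * B := fun y hy z hz t ht =>
    (norm_toEuclideanCLM_apply_le _ _).trans
      (mul_le_mul (hC' _ _) (hB' t ht z hz y hy) (norm_nonneg _) hC)
  refine ⟨C * B * volume.real (Ioo 0 l), by positivity, fun y hy z hz => ?_, _, h⟩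
  exact norm_setIntegral_le_of_norm_le_const measure_Ioo_lt_top fun t ht => h y hy z hz t ht

/-- Fubini and the substitution `s = t + x - y` move the dependence on `x` from the kernel, which is
only measurable, to a translate of `g`. -/
lemma vint_kavg (hR : IsVolterra l R) {g : ℝ → EuclideanSpace ℂ (Fin n)} (hg : Continuous g)
    {x : ℝ} (hx : x ∈ Ioo 0 l) :
    vint l (kavg l R) g x = ∫ y in Ioo 0 x, shiftInt l R g y x := by
  obtain ⟨C, hC, hC'⟩ := hR.bdd
  obtain ⟨B, hB, hB'⟩ := exists_bound_of_continuous hg l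
  have h1 : ∀ s, toEuclideanCLM (𝕜 := ℂ) (kavg l R x s) (g s)
      = ∫ y in Ioo 0 x, toEuclideanCLM (𝕜 := ℂ) (R y (y - x + s)) (g s) := by
    intro s
    let L : Matrix (Fin n) (Fin n) ℂ →L[ℂ] EuclideanSpace ℂ (Fin n) :=
      (ContinuousLinearMap.apply ℂ _ (g s)) ∘L
        ⟨(toEuclideanCLM (n := Fin n) (𝕜 := ℂ)).toAlgEquiv.toLinearMap, continuous_toEuclideanCLM⟩
    rw [kavg, if_pos hx.2]
    exact (L.integral_comp_comm (hR.integrableOn_avg x s)).symm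
  have hint : Integrable (fun p : ℝ × ℝ =>
      toEuclideanCLM (𝕜 := ℂ) (R p.2 (p.2 - x + p.1)) (g p.1))
      ((vol l).prod (volume.restrict (Ioo 0 x))) := by
    refine integrable_prod_of_bound (B := C * B) ?_ fun s hs y hy => ?_
    · exact (stronglyMeasurable_act
        (hR.meas.comp_measurable (g := fun p : ℝ × ℝ => (p.2, p.2 - x + p.1)) (by fun_prop))
        (hg.stronglyMeasurable.comp_measurable measurable_fst)).aestronglyMeasurable
    · refine (norm_toEuclideanCLM_apply_le _ _).trans
        (mul_le_mul (hC' _ _) ?_ (norm_nonneg _) hC)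
      simpa using hB' s hs x hx x hx
  rw [vint]
  simp only [h1]
  rw [integral_integral_swap hint]
  refine setIntegral_congr_fun measurableSet_Ioo fun y hy => ?_
  simp only [shiftInt]
  rw [setIntegral_eq_integral_of_forall_compl_eq_zero,
    setIntegral_eq_integral_of_forall_compl_eq_zero,
    ← integral_add_right_eq_self _ (x - y)]
  · refine integral_congr_ae (.of_forall fun t => ?_)
    simp only [add_sub_assoc]
    rw [show y - x + (t + (x - y)) = t by ring]
  · intro t ht
    rw [hR.supp y t fun h => ht ⟨h.1, h.2.1.trans h.2.2⟩]; simp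
  · intro s hs
    rw [hR.supp y _ fun h => hs ⟨by linarith [h.1, hy.2], by linarith [h.2.1, hx.2]⟩]; simp

/-- With `F` the primitive of `f`, the `z`-derivative of `F (t + z - y)` is `f (t + z - y)`; at `z =
y` the translation is trivial, which produces the term `vint l R F y`. -/
lemma integral_shiftInt (hR : IsVolterra l R) {f : ℝ → EuclideanSpace ℂ (Fin n)}
    (hf : Continuous f) (c : EuclideanSpace ℂ (Fin n)) {x y : ℝ} (hx : x ∈ Ioo 0 l)
    (hy : y ∈ Ioo 0 x) :
    ∫ z in Ioo y x, shiftInt l R f y z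
      = shiftInt l R (fun x => c + ∫ t in (0 : ℝ)..x, f t) y x
        - vint l R (fun x => c + ∫ t in (0 : ℝ)..x, f t) y := by
  have hF : Continuous (fun x => c + ∫ t in (0 : ℝ)..x, f t) :=
    continuous_const.add (intervalIntegral.continuous_primitive (fun a b => hf.intervalIntegrable a b) 0)
  obtain ⟨B, hB, -, B', hB'⟩ := exists_shiftInt_bound hR hf
  have hyl : y ∈ Ioo 0 l := ⟨hy.1, hy.2.trans hx.2⟩
  have hint : Integrable (fun p : ℝ × ℝ =>
      toEuclideanCLM (𝕜 := ℂ) (R y p.2) (f (p.2 + p.1 - y)))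
      ((volume.restrict (Ioo y x)).prod (vol l)) := by
    refine integrable_prod_of_bound (B := B') ?_ fun z hz t ht =>
      hB' y hyl z ⟨hy.1.trans hz.1, hz.2.trans hx.2⟩ t ht
    exact ((stronglyMeasurable_shiftInt_integrand hR hf).comp_measurable
      (g := fun p : ℝ × ℝ => ((y, p.1), p.2)) (by fun_prop)).aestronglyMeasurable
  simp only [shiftInt]
  rw [integral_integral_swap hint, vint]
  have hFint : ∀ z : ℝ, Integrable (fun t => (fun x => c + ∫ t in (0 : ℝ)..x, f t) (t + z - y))
      (vol l) := fun z =>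
    ((hF.comp (by fun_prop : Continuous fun t : ℝ => t + z - y)).integrableOn_Icc).mono_set
      Ioo_subset_Icc_self
  rw [← integral_sub (hR.integrable_row (hFint x) y)
    (by simpa using hR.integrable_row (hFint y) y)]
  refine integral_congr_ae (.of_forall fun t => ?_)
  dsimp only
  rw [← map_sub, ContinuousLinearMap.integral_comp_comm]
  · congr 1
    rw [add_sub_add_left_eq_sub, intervalIntegral.integral_interval_sub_left
      (hf.intervalIntegrable _ _) (hf.intervalIntegrable _ _), ← integral_Ioc_eq_integral_Ioo,
      ← intervalIntegral.integral_of_le hy.2.le]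
    simp only [show ∀ z : ℝ, t + z - y = z + (t - y) from fun z => by ring]
    rw [intervalIntegral.integral_comp_add_right (fun z => f z) (t - y)]
    congr 1; ring
  · exact ((hf.comp (by fun_prop : Continuous fun z : ℝ => t + z - y)).integrableOn_Icc).mono_set
      Ioo_subset_Icc_self

/-- On primitives, averaging a kernel along the diagonals commutes with integration up to the
kernel itself. -/
theorem vint_kavg_primitive (hR : IsVolterra l R) {f : ℝ → EuclideanSpace ℂ (Fin n)}
    (hf : Continuous f) (c : EuclideanSpace ℂ (Fin n)) {x : ℝ} (hx : x ∈ Ioo 0 l) :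
    vint l (kavg l R) (fun x => c + ∫ t in (0 : ℝ)..x, f t) x
      = (∫ z in (0 : ℝ)..x, vint l (kavg l R) f z)
        + ∫ z in (0 : ℝ)..x, vint l R (fun x => c + ∫ t in (0 : ℝ)..x, f t) z := by
  have hF : Continuous (fun x => c + ∫ t in (0 : ℝ)..x, f t) :=
    continuous_const.add (intervalIntegral.continuous_primitive (fun a b => hf.intervalIntegrable a b) 0)
  obtain ⟨B, hB, hBs, -⟩ := exists_shiftInt_bound hR hf
  have hsub : ∀ z ∈ Ioo 0 x, z ∈ Ioo 0 l := fun z hz => ⟨hz.1, hz.2.trans hx.2⟩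
  rw [vint_kavg hR hF hx, intervalIntegral.integral_of_le hx.1.le,
    intervalIntegral.integral_of_le hx.1.le, integral_Ioc_eq_integral_Ioo,
    integral_Ioc_eq_integral_Ioo]
  -- The inner domain `y < z` becomes a condition on the square, so the order of integration over
  -- the triangle can be swapped; the `z`-integral is then `integral_shiftInt`.
  have h1 : ∫ z in Ioo 0 x, vint l (kavg l R) f z
      = ∫ z in Ioo 0 x, ∫ y in Ioo 0 x,
          if y < z then shiftInt l R f y z else 0 := by
    refine setIntegral_congr_fun measurableSet_Ioo fun z hz => ?_
    rw [vint_kavg hR hf (hsub z hz)]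
    refine (setIntegral_eq_of_subset_of_forall_sdiff_eq_zero measurableSet_Ioo
      (Ioo_subset_Ioo_right hz.2.le) fun y hy => if_neg fun h => hy.2 ⟨hy.1.1, h⟩
      ).trans ?_ |>.symm
    exact setIntegral_congr_fun measurableSet_Ioo fun y hy => if_pos hy.2
  have hint : Integrable (fun p : ℝ × ℝ =>
      if p.2 < p.1 then shiftInt l R f p.2 p.1 else 0)
      ((volume.restrict (Ioo 0 x)).prod (volume.restrict (Ioo 0 x))) := by
    refine integrable_prod_of_bound (B := B) ?_ fun z hz y hy => ?_
    · exact (StronglyMeasurable.ite (measurableSet_lt measurable_snd measurable_fst)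
        ((stronglyMeasurable_shiftInt hR hf).comp_measurable measurable_swap)
        stronglyMeasurable_const).aestronglyMeasurable
    · dsimp only
      split_ifs
      · exact hBs y (hsub y hy) z (hsub z hz)
      · simpa using hB
  have h2 : ∀ y ∈ Ioo 0 x, ∫ z in Ioo 0 x,
      (if y < z then shiftInt l R f y z else 0)
      = shiftInt l R (fun x => c + ∫ t in (0 : ℝ)..x, f t) y x
        - vint l R (fun x => c + ∫ t in (0 : ℝ)..x, f t) y := by
    intro y hy
    rw [← integral_shiftInt hR hf c hx hy]
    refine (setIntegral_eq_of_subset_of_forall_sdiff_eq_zero measurableSet_Ioo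
      (Ioo_subset_Ioo_left hy.1.le) fun z hz => if_neg fun h => hz.2 ⟨h, hz.1.2⟩
      ).trans ?_
    exact setIntegral_congr_fun measurableSet_Ioo fun z hz => if_pos hz.1
  rw [h1, integral_integral_swap hint, setIntegral_congr_fun measurableSet_Ioo h2,
    integral_sub, sub_add_cancel]
  · obtain ⟨B, hB, hBs, -⟩ := exists_shiftInt_bound hR hF
    refine Measure.integrableOn_of_bounded (M := B) measure_Ioo_lt_top.ne ?_ ?_
    · exact ((stronglyMeasurable_shiftInt hR hF).comp_measurable
        (measurable_id.prodMk measurable_const)).aestronglyMeasurable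
    · filter_upwards [ae_restrict_mem measurableSet_Ioo] with y hy using hBs y (hsub y hy) x hx
  · exact (integrable_vint hR ((hF.integrableOn_Icc).mono_set Ioo_subset_Icc_self)).mono_measure
      (Measure.restrict_mono (Ioo_subset_Ioo_right hx.2.le) le_rfl)

lemma memLp_of_continuous {f : ℝ → EuclideanSpace ℂ (Fin n)} (hf : Continuous f) (l : ℝ) :
    MemLp f 2 (vol l) := by
  obtain ⟨B, hB⟩ := (isCompact_Icc (a := 0) (b := l)).exists_bound_of_continuousOn hf.continuousOn
  refine MemLp.of_bound hf.aestronglyMeasurable B ?_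
  filter_upwards [ae_restrict_mem measurableSet_Ioo] with x hx using hB x (Ioo_subset_Icc_self hx)

lemma opJ_toL2 {f : ℝ → EuclideanSpace ℂ (Fin n)} (hf : MemLp f 2 (vol l)) :
    opJ n l (toL2 l f) = toL2 l (fun x => ∫ t in (0 : ℝ)..x, f t) := by
  rw [kernelOp_toL2 _ hf]
  refine toL2_congr (memLp_vint (isVolterra_intKernel n l) (hf.integrable (by norm_num))) ?_
  filter_upwards [ae_restrict_mem measurableSet_Ioo] with x hx using vint_intKernel f hx

lemma toL2_add {f g : ℝ → EuclideanSpace ℂ (Fin n)} (hf : MemLp f 2 (vol l))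
    (hg : MemLp g 2 (vol l)) : toL2 l (fun x => f x + g x) = toL2 l f + toL2 l g := by
  rw [toL2_eq_toLp hf, toL2_eq_toLp hg, ← MemLp.toLp_add]
  exact toL2_eq_toLp (hf.add hg)

lemma kernelOp_kavg_toL2 (hR : IsVolterra l R) {f : ℝ → EuclideanSpace ℂ (Fin n)}
    (hf : Continuous f) (c : EuclideanSpace ℂ (Fin n)) :
    kernelOp hR.kavg (toL2 l (fun x => c + ∫ t in (0 : ℝ)..x, f t))
      = opJ n l (kernelOp hR.kavg (toL2 l f))
        + opJ n l (kernelOp hR (toL2 l (fun x => c + ∫ t in (0 : ℝ)..x, f t))) := by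
  have hF : Continuous (fun x => c + ∫ t in (0 : ℝ)..x, f t) :=
    continuous_const.add (intervalIntegral.continuous_primitive (fun a b => hf.intervalIntegrable a b) 0)
  have hf2 := memLp_of_continuous hf l
  have hF2 := memLp_of_continuous hF l
  have h1 := memLp_vint hR.kavg (hf2.integrable (by norm_num))
  have h2 := memLp_vint hR (hF2.integrable (by norm_num))
  rw [kernelOp_toL2 hR.kavg hF2, kernelOp_toL2 hR.kavg hf2, kernelOp_toL2 hR hF2, ← map_add,
    ← toL2_add h1 h2, opJ_toL2 (f := fun x => _ + _) (h1.add h2)]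
  refine toL2_congr (memLp_vint hR.kavg (hF2.integrable (by norm_num))) ?_
  filter_upwards [ae_restrict_mem measurableSet_Ioo] with x hx
  rw [vint_kavg_primitive hR hf c hx, intervalIntegral.integral_add]
  · rw [intervalIntegrable_iff_integrableOn_Ioo_of_le hx.1.le]
    exact (h1.integrable (by norm_num)).mono_measure
      (Measure.restrict_mono (Ioo_subset_Ioo_right hx.2.le) le_rfl)
  · rw [intervalIntegrable_iff_integrableOn_Ioo_of_le hx.1.le]
    exact (h2.integrable (by norm_num)).mono_measure
      (Measure.restrict_mono (Ioo_subset_Ioo_right hx.2.le) le_rfl)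

/-- The case `f = 0`, where the primitive reduces to the constant `c`. -/
lemma kernelOp_kavg_const (hR : IsVolterra l R) (c : EuclideanSpace ℂ (Fin n)) :
    kernelOp hR.kavg (toL2 l (fun _ => c)) = opJ n l (kernelOp hR (toL2 l (fun _ => c))) := by
  have h0 : toL2 l (fun _ => (0 : EuclideanSpace ℂ (Fin n))) = 0 := by
    rw [toL2_eq_toLp (memLp_of_continuous continuous_const l)]
    exact MemLp.toLp_zero _
  simpa [h0] using kernelOp_kavg_toL2 hR (f := fun _ => 0) continuous_const c

/-- Both sides are continuous, so it suffices to test on the dense set of bounded continuous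
functions, where it is the primitive identity with constant `0`. It replaces differentiating the
kernel along the diagonals. -/
theorem kernelOp_kavg_comp_opJ (hR : IsVolterra l R) :
    kernelOp hR.kavg ∘L opJ n l
      = opJ n l ∘L kernelOp hR.kavg + opJ n l ∘L kernelOp hR ∘L opJ n l := by
  have hd := BoundedContinuousFunction.toLp_denseRange (EuclideanSpace ℂ (Fin n)) (vol l) ℂ
    (p := 2) (by norm_num)
  refine DFunLike.coe_injective (hd.equalizer (ContinuousLinearMap.continuous _)
    (ContinuousLinearMap.continuous _) ?_)
  ext1 f
  have hf : BoundedContinuousFunction.toLp (E := EuclideanSpace ℂ (Fin n)) 2 (vol l) ℂ f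
      = toL2 l f :=
    eq_toL2_of_ae_eq (BoundedContinuousFunction.coeFn_toLp 2 (vol l) ℂ f)
  have h := kernelOp_kavg_toL2 hR f.continuous 0
  simp only [zero_add] at h
  rw [← opJ_toL2 (memLp_of_continuous f.continuous l)] at h
  simp only [Function.comp_apply, hf]
  exact h

end Shift

/-! ### Absolutely continuous functions -/

section AbsCont

variable {E : Type*} [NormedAddCommGroup E] [NormedSpace ℝ E] {l : ℝ}

lemma absolutelyContinuousOnInterval_congr {X : Type*} [PseudoMetricSpace X] {f g : ℝ → X}
    {a b : ℝ} (hf : AbsolutelyContinuousOnInterval f a b) (h : EqOn f g (uIcc a b)) :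
    AbsolutelyContinuousOnInterval g a b := by
  rw [absolutelyContinuousOnInterval_iff] at hf ⊢
  intro ε hε
  obtain ⟨δ, hδ, H⟩ := hf ε hε
  refine ⟨δ, hδ, fun E hE hE' => (Finset.sum_congr rfl fun i hi => ?_).trans_lt (H E hE hE')⟩
  rw [h (hE.1 i hi).1, h (hE.1 i hi).2]

lemma absolutelyContinuousOnInterval_const {X : Type*} [PseudoMetricSpace X] (c : X) (a b : ℝ) :
    AbsolutelyContinuousOnInterval (fun _ => c) a b :=
  ((LipschitzWith.const' c (K := 0)).lipschitzOnWith).absolutelyContinuousOnInterval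

lemma absolutelyContinuousOnInterval_sum {ι : Type*} (s : Finset ι) {f : ι → ℝ → E} {a b : ℝ}
    (h : ∀ i ∈ s, AbsolutelyContinuousOnInterval (f i) a b) :
    AbsolutelyContinuousOnInterval (fun x => ∑ i ∈ s, f i x) a b := by
  classical
  induction s using Finset.induction_on with
  | empty => simpa using absolutelyContinuousOnInterval_const (0 : E) a b
  | insert i s hi ih =>
    simp only [Finset.sum_insert hi]
    exact (h i (Finset.mem_insert_self _ _)).fun_add
      (ih fun j hj => h j (Finset.mem_insert_of_mem hj))

lemma ae_uIcc_of_ae_vol (hl : 0 ≤ l) {P : ℝ → Prop} (h : ∀ᵐ x ∂(vol l), P x) :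
    ∀ᵐ x, x ∈ uIcc 0 l → P x := by
  rw [uIcc_of_le hl, ← ae_restrict_iff' measurableSet_Icc, ← restrict_Ioo_eq_restrict_Icc]
  exact h

/-- An essentially bounded integrand makes the primitive Lipschitz. -/
lemma absolutelyContinuousOnInterval_primitive {g : ℝ → E} {B : ℝ} (hl : 0 ≤ l)
    (hg : Integrable g (vol l)) (hB : ∀ᵐ x ∂(vol l), ‖g x‖ ≤ B) :
    AbsolutelyContinuousOnInterval (fun x => ∫ t in (0 : ℝ)..x, g t) 0 l := by
  have hI : IntervalIntegrable g volume 0 l :=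
    (intervalIntegrable_iff_integrableOn_Ioo_of_le hl).mpr hg
  have h : LipschitzOnWith (Real.toNNReal B) (fun x => ∫ t in (0 : ℝ)..x, g t) (uIcc 0 l) := by
    refine LipschitzOnWith.of_dist_le_mul fun x hx y hy => ?_
    have hx' : uIcc (0 : ℝ) x ⊆ uIcc 0 l := uIcc_subset_uIcc_left hx
    have hy' : uIcc (0 : ℝ) y ⊆ uIcc 0 l := uIcc_subset_uIcc_left hy
    rw [dist_eq_norm, intervalIntegral.integral_interval_sub_left (hI.mono_set hx')
      (hI.mono_set hy'), Real.dist_eq]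
    refine (intervalIntegral.norm_integral_le_of_norm_le_const_ae ?_).trans
      (mul_le_mul_of_nonneg_right (Real.le_coe_toNNReal B) (abs_nonneg _))
    filter_upwards [ae_uIcc_of_ae_vol hl hB] with t ht htxy
    exact ht (uIcc_subset_uIcc hy hx (uIoc_subset_uIcc htxy))
  exact h.absolutelyContinuousOnInterval

/-- The fundamental theorem of calculus for absolutely continuous functions with bounded
derivative. -/
theorem eq_add_integral_of_hasDerivAt [CompleteSpace E] {f g : ℝ → E} {B : ℝ} (hl : 0 ≤ l)
    (hf : AbsolutelyContinuousOnInterval f 0 l) (hfg : ∀ᵐ x ∂(vol l), HasDerivAt f (g x) x)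
    (hg : Integrable g (vol l)) (hB : ∀ᵐ x ∂(vol l), ‖g x‖ ≤ B) {x : ℝ} (hx : x ∈ Icc 0 l) :
    f x = f 0 + ∫ t in (0 : ℝ)..x, g t := by
  have hI : IntervalIntegrable g volume 0 l :=
    (intervalIntegrable_iff_integrableOn_Ioo_of_le hl).mpr hg
  -- The difference of `f` and the primitive of `g` is absolutely continuous with zero derivative
  -- a.e., hence constant.
  obtain ⟨C, hC⟩ := (hf.fun_sub (absolutelyContinuousOnInterval_primitive hl hg hB)
    ).const_of_ae_hasDerivAt_zero (by
      filter_upwards [ae_uIcc_of_ae_vol hl hfg, hI.ae_hasDerivAt_integral] with t h1 h2 ht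
      simpa using (h1 ht).fun_sub (h2 ht 0 left_mem_uIcc))
  rw [← uIcc_of_le hl] at hx
  have h0 := hC 0 left_mem_uIcc
  have hx' := hC x hx
  simp only [intervalIntegral.integral_same, sub_zero] at h0
  rw [h0, ← hx', sub_add_cancel]

end AbsCont

/-! ### Calculus of absolutely continuous matrix functions -/

section MatrixDeriv

variable {m n p : Type*} {l : ℝ}

/-- The matrix function `U` is absolutely continuous on `[0, l]` with derivative `U'` a.e. -/
structure HasACDeriv (l : ℝ) (U U' : ℝ → Matrix m n ℂ) : Prop where
  ac : ∀ i j, AbsolutelyContinuousOnInterval (fun x => U x i j) 0 l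
  deriv : ∀ᵐ x ∂(vol l), ∀ i j, HasDerivAt (fun s => U s i j) (U' x i j) x

lemma hasACDeriv_const (l : ℝ) (A : Matrix m n ℂ) : HasACDeriv l (fun _ => A) (fun _ => 0) :=
  ⟨fun _ _ => absolutelyContinuousOnInterval_const _ _ _,
    .of_forall fun x _ _ => hasDerivAt_const x _⟩

lemma HasACDeriv.congr_deriv {U U' U'' : ℝ → Matrix m n ℂ} (h : HasACDeriv l U U')
    (h' : ∀ᵐ x ∂(vol l), U' x = U'' x) : HasACDeriv l U U'' :=
  ⟨h.ac, by filter_upwards [h.deriv, h'] with x h1 h2 using h2 ▸ h1⟩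

lemma HasACDeriv.congr {U V U' : ℝ → Matrix m n ℂ} (hl : 0 ≤ l) (h : HasACDeriv l U U')
    (h' : ∀ x ∈ Icc 0 l, U x = V x) : HasACDeriv l V U' := by
  refine ⟨fun i j => absolutelyContinuousOnInterval_congr (h.ac i j) fun x hx => ?_, ?_⟩
  · rw [uIcc_of_le hl] at hx
    simp only [h' x hx]
  · filter_upwards [h.deriv, ae_restrict_mem measurableSet_Ioo] with x h1 hx i j
    refine (h1 i j).congr_of_eventuallyEq ?_
    filter_upwards [Ioo_mem_nhds hx.1 hx.2] with y hy
    rw [h' y (Ioo_subset_Icc_self hy)]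

lemma HasACDeriv.mul [Fintype n] {U U' : ℝ → Matrix m n ℂ} {V V' : ℝ → Matrix n p ℂ}
    (hU : HasACDeriv l U U') (hV : HasACDeriv l V V') :
    HasACDeriv l (fun x => U x * V x) (fun x => U' x * V x + U x * V' x) := by
  refine ⟨fun i j => ?_, ?_⟩
  · simp only [mul_apply]
    exact absolutelyContinuousOnInterval_sum _ fun k _ => (hU.ac i k).fun_smul (hV.ac k j)
  · filter_upwards [hU.deriv, hV.deriv] with x h1 h2 i j
    simp only [mul_apply, Matrix.add_apply, ← Finset.sum_add_distrib]
    exact HasDerivAt.fun_sum fun k _ => (h1 i k).fun_mul (h2 k j)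

lemma HasACDeriv.const_mul [Fintype n] (A : Matrix m n ℂ) {V V' : ℝ → Matrix n p ℂ}
    (hV : HasACDeriv l V V') : HasACDeriv l (fun x => A * V x) (fun x => A * V' x) :=
  ((hasACDeriv_const l A).mul hV).congr_deriv (.of_forall fun x => by simp)

lemma HasACDeriv.mul_const [Fintype n] {V V' : ℝ → Matrix m n ℂ} (hV : HasACDeriv l V V')
    (A : Matrix n p ℂ) : HasACDeriv l (fun x => V x * A) (fun x => V' x * A) :=
  (hV.mul (hasACDeriv_const l A)).congr_deriv (.of_forall fun x => by simp)

lemma HasACDeriv.conjTranspose {U U' : ℝ → Matrix m n ℂ} (hU : HasACDeriv l U U') :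
    HasACDeriv l (fun x => (U x)ᴴ) (fun x => (U' x)ᴴ) := by
  refine ⟨fun i j => ?_, ?_⟩
  · have h := hU.ac j i
    simp only [conjTranspose_apply, AbsolutelyContinuousOnInterval, dist_star_star] at h ⊢
    exact h
  · filter_upwards [hU.deriv] with x h1 i j
    exact (h1 j i).star

lemma HasACDeriv.cexp_smul (c : ℂ) {U U' : ℝ → Matrix m n ℂ} (hU : HasACDeriv l U U') :
    HasACDeriv l (fun x => Complex.exp (c * x) • U x)
      (fun x => Complex.exp (c * x) • (c • U x + U' x)) := by
  refine ⟨fun i j => ?_, ?_⟩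
  · have h : AbsolutelyContinuousOnInterval (fun x : ℝ => Complex.exp (c * x)) 0 l := by
      refine ContDiffOn.absolutelyContinuousOnInterval (ContDiff.contDiffOn ?_)
      exact (contDiff_const.mul Complex.ofRealCLM.contDiff).cexp
    exact h.fun_smul (hU.ac i j)
  · filter_upwards [hU.deriv] with x h1 i j
    have h2 : HasDerivAt (fun x : ℝ => Complex.exp (c * x)) (Complex.exp (c * x) * c) x := by
      have := ((Complex.ofRealCLM.hasDerivAt (x := x)).const_mul c).cexp
      simpa using this
    refine (h2.fun_mul (h1 i j)).congr_deriv ?_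
    simp only [Matrix.smul_apply, Matrix.add_apply, smul_eq_mul]
    ring

lemma HasACDeriv.eq_of_deriv_eq_zero {U : ℝ → Matrix m n ℂ} (hl : 0 ≤ l)
    (hU : HasACDeriv l U (fun _ => 0)) {x : ℝ} (hx : x ∈ Icc 0 l) : U x = U 0 := by
  ext i j
  have := eq_add_integral_of_hasDerivAt (g := fun _ => 0) (B := 0) hl (hU.ac i j)
    (hU.deriv.mono fun x h => h i j) (integrable_zero _ _ _) (by simp) hx
  simpa using this

variable [Fintype m] [Fintype n] [Fintype p] [DecidableEq m] [DecidableEq n] [DecidableEq p]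

lemma HasACDeriv.continuousOn {U U' : ℝ → Matrix m n ℂ} (hl : 0 ≤ l) (hU : HasACDeriv l U U') :
    ContinuousOn U (Icc 0 l) := by
  refine continuousOn_pi.mpr fun i => continuousOn_pi.mpr fun j => ?_
  rw [← uIcc_of_le hl]
  exact (hU.ac i j).continuousOn

/-- Essentially bounded measurable matrix functions on `(0, l)`. -/
structure EssBdd (l : ℝ) (M : ℝ → Matrix m n ℂ) : Prop where
  meas : AEStronglyMeasurable M (vol l)
  bdd : ∃ B, 0 ≤ B ∧ ∀ᵐ x ∂(vol l), ‖M x‖ ≤ B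

lemma HasACDeriv.essBdd {U U' : ℝ → Matrix m n ℂ} (hl : 0 ≤ l) (hU : HasACDeriv l U U') :
    EssBdd l U := by
  have hc := hU.continuousOn hl
  obtain ⟨B, hB⟩ := isCompact_Icc.exists_bound_of_continuousOn hc
  refine ⟨(hc.mono Ioo_subset_Icc_self).aestronglyMeasurable measurableSet_Ioo, max B 0,
    le_max_right _ _, ?_⟩
  filter_upwards [ae_restrict_mem measurableSet_Ioo] with x hx
    using (hB x (Ioo_subset_Icc_self hx)).trans (le_max_left _ _)

lemma EssBdd.const (l : ℝ) (A : Matrix m n ℂ) : EssBdd l fun _ => A :=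
  ⟨aestronglyMeasurable_const, ‖A‖, norm_nonneg _, .of_forall fun _ => le_rfl⟩

lemma EssBdd.mul {M : ℝ → Matrix m n ℂ} {N : ℝ → Matrix n p ℂ} (hM : EssBdd l M)
    (hN : EssBdd l N) : EssBdd l fun x => M x * N x := by
  obtain ⟨B, hB, hB'⟩ := hM.bdd
  obtain ⟨C, hC, hC'⟩ := hN.bdd
  refine ⟨?_, B * C, by positivity, ?_⟩
  · exact (continuous_fst.matrix_mul continuous_snd).comp_aestronglyMeasurable
      (hM.meas.prodMk hN.meas)
  · filter_upwards [hB', hC'] with x h1 h2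
    exact (l2_opNorm_mul _ _).trans (mul_le_mul h1 h2 (norm_nonneg _) hB)

lemma EssBdd.conjTranspose {M : ℝ → Matrix m n ℂ} (hM : EssBdd l M) :
    EssBdd l fun x => (M x)ᴴ := by
  obtain ⟨B, hB, hB'⟩ := hM.bdd
  refine ⟨?_, B, hB, ?_⟩
  · exact (continuous_id.matrix_conjTranspose).comp_aestronglyMeasurable hM.meas
  · filter_upwards [hB'] with x h1
    rwa [l2_opNorm_conjTranspose]

lemma EssBdd.smul {M : ℝ → Matrix m n ℂ} (c : ℂ) (hM : EssBdd l M) :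
    EssBdd l fun x => c • M x := by
  obtain ⟨B, hB, hB'⟩ := hM.bdd
  refine ⟨hM.meas.const_smul c, ‖c‖ * B, by positivity, ?_⟩
  filter_upwards [hB'] with x h1
  rw [norm_smul]
  exact mul_le_mul_of_nonneg_left h1 (norm_nonneg c)

lemma EssBdd.integrable {M : ℝ → Matrix m n ℂ} (hM : EssBdd l M) : Integrable M (vol l) := by
  obtain ⟨B, hB, hB'⟩ := hM.bdd
  exact Integrable.of_bound hM.meas B hB'

lemma EssBdd.intervalIntegrable {M : ℝ → Matrix m n ℂ} (hM : EssBdd l M) {a b : ℝ} (ha : 0 ≤ a)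
    (hab : a ≤ b) (hb : b ≤ l) : IntervalIntegrable M volume a b :=
  (intervalIntegrable_iff_integrableOn_Ioo_of_le hab).mpr
    (hM.integrable.mono_measure (Measure.restrict_mono (Ioo_subset_Ioo ha hb) le_rfl))

lemma norm_entry_le (A : Matrix m n ℂ) (i : m) (j : n) : ‖A i j‖ ≤ ‖A‖ := by
  have h := l2_opNorm_mulVec A (EuclideanSpace.single j 1)
  rw [PiLp.norm_single, norm_one, mul_one] at h
  refine le_trans ?_ h
  have h3 := PiLp.norm_apply_le ((EuclideanSpace.equiv m ℂ).symm
    (A *ᵥ (EuclideanSpace.single j (1 : ℂ)).ofLp)) i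
  simpa using h3

/-- Matrix entries, as a continuous linear map. -/
def entryCLM (i : m) (j : n) : Matrix m n ℂ →L[ℂ] ℂ :=
  LinearMap.mkContinuous
    { toFun := fun A => A i j, map_add' := fun _ _ => rfl, map_smul' := fun _ _ => rfl }
    1 fun A => (norm_entry_le A i j).trans_eq (one_mul _).symm

lemma intervalIntegral_entry {M : ℝ → Matrix m n ℂ} {a b : ℝ}
    (hM : IntervalIntegrable M volume a b) (i : m) (j : n) :
    (∫ t in a..b, M t) i j = ∫ t in a..b, M t i j :=
  ((entryCLM i j).intervalIntegral_comp_comm hM).symm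

/-- The fundamental theorem of calculus for matrix functions. -/
theorem HasACDeriv.integral_eq_sub {U U' : ℝ → Matrix m n ℂ} (hU : HasACDeriv l U U')
    (hU' : EssBdd l U') {a b : ℝ} (ha : 0 ≤ a) (hab : a ≤ b) (hb : b ≤ l) :
    ∫ t in a..b, U' t = U b - U a := by
  have hl : 0 ≤ l := ha.trans (hab.trans hb)
  obtain ⟨B, hB, hB'⟩ := hU'.bdd
  ext i j
  have key : ∀ x ∈ Icc 0 l, U x i j = U 0 i j + ∫ t in (0 : ℝ)..x, U' t i j := fun x hx =>
    eq_add_integral_of_hasDerivAt (B := B) hl (hU.ac i j)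
      (hU.deriv.mono fun x h => h i j) ((entryCLM i j).integrable_comp hU'.integrable)
      (hB'.mono fun x hx => (norm_entry_le _ i j).trans hx) hx
  have hI : ∀ x ∈ Icc 0 l, IntervalIntegrable (fun t => U' t i j) volume 0 x := fun x hx =>
    (intervalIntegrable_iff_integrableOn_Ioo_of_le hx.1).mpr
      ((entryCLM i j).integrable_comp
        (hU'.integrable.mono_measure (Measure.restrict_mono (Ioo_subset_Ioo le_rfl hx.2) le_rfl)))
  have haI : a ∈ Icc 0 l := ⟨ha, hab.trans hb⟩
  have hbI : b ∈ Icc 0 l := ⟨ha.trans hab, hb⟩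
  rw [intervalIntegral_entry (hU'.intervalIntegrable ha hab hb), Matrix.sub_apply, key b hbI, key a haI,
    add_sub_add_left_eq_sub, intervalIntegral.integral_interval_sub_left (hI b hbI) (hI a haI)]

lemma intervalIntegral_mul_mul {q : Type*} [Fintype q] [DecidableEq q] (A : Matrix m n ℂ)
    {M : ℝ → Matrix n p ℂ} (B : Matrix p q ℂ)
    {a b : ℝ} (hM : IntervalIntegrable M volume a b) :
    ∫ t in a..b, A * M t * B = A * (∫ t in a..b, M t) * B := by
  let L : Matrix n p ℂ →ₗ[ℂ] Matrix m q ℂ :=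
    { toFun := fun X => A * X * B
      map_add' := fun X Y => by rw [Matrix.mul_add, Matrix.add_mul]
      map_smul' := fun c X => by simp }
  exact (LinearMap.toContinuousLinearMap L).intervalIntegral_comp_comm hM

end MatrixDeriv

/-! ### The Dirac system -/

section System

variable {m₁ m₂ : ℕ} {l : ℝ}

/-- The projection onto the first `m₁` coordinates. -/
def topProj (m₁ m₂ : ℕ) : Matrix (Fin m₁) (Fin m₁ ⊕ Fin m₂) ℂ := fromCols 1 0

/-- The projection onto the last `m₂` coordinates. -/
def botProj (m₁ m₂ : ℕ) : Matrix (Fin m₂) (Fin m₁ ⊕ Fin m₂) ℂ := fromCols 0 1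

lemma diracCoeff_eq (v : Matrix (Fin m₁) (Fin m₂) ℂ) (z : ℂ) :
    diracCoeff v z = fromBlocks ((Complex.I * z) • 1) v (-vᴴ) (-((Complex.I * z) • 1)) := by
  simp [diracCoeff, fromBlocks_smul, fromBlocks_multiply, fromBlocks_add]

/-- This is the skew-self-adjointness that makes `u x 0` unitary. -/
lemma conjTranspose_diracCoeff_zero (v : Matrix (Fin m₁) (Fin m₂) ℂ) :
    (diracCoeff v 0)ᴴ = - diracCoeff v 0 := by
  simp [diracCoeff_eq, fromBlocks_conjTranspose, fromBlocks_neg]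

/-- At `z = 0` the coefficient exchanges the block rows: this is `γ' = -v*β`, and its companion for
the top rows is `β' = vγ`. -/
lemma botProj_mul_diracCoeff (v : Matrix (Fin m₁) (Fin m₂) ℂ) :
    botProj m₁ m₂ * diracCoeff v 0 = -vᴴ * topProj m₁ m₂ := by
  simp [diracCoeff_eq, botProj, topProj, fromCols_mul_fromBlocks, mul_fromCols]

lemma topProj_mul_diracCoeff (v : Matrix (Fin m₁) (Fin m₂) ℂ) :
    topProj m₁ m₂ * diracCoeff v 0 = v * botProj m₁ m₂ := by
  simp [diracCoeff_eq, botProj, topProj, fromCols_mul_fromBlocks, mul_fromCols]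

lemma botProj_mul_conjTranspose : botProj m₁ m₂ * (botProj m₁ m₂)ᴴ = 1 := by
  simp [botProj, conjTranspose_fromCols_eq_fromRows_conjTranspose, fromCols_mul_fromRows]

lemma topProj_mul_conjTranspose_botProj : topProj m₁ m₂ * (botProj m₁ m₂)ᴴ = 0 := by
  simp [botProj, topProj, conjTranspose_fromCols_eq_fromRows_conjTranspose, fromCols_mul_fromRows]

/-- The potential cancels against its adjoint, and `izj - iz` vanishes on the top block and equals
`-2iz` on the bottom one. The spectral parameter of the canonical system is therefore `2z`. -/
lemma diracCoeff_sub (v : Matrix (Fin m₁) (Fin m₂) ℂ) (z : ℂ) :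
    (-(Complex.I * z)) • (1 : Matrix (Fin m₁ ⊕ Fin m₂) (Fin m₁ ⊕ Fin m₂) ℂ)
      + (diracCoeff v 0)ᴴ + diracCoeff v z
      = (-(Complex.I * (2 * z))) • ((botProj m₁ m₂)ᴴ * botProj m₁ m₂) := by
  rw [conjTranspose_diracCoeff_zero, diracCoeff_eq, diracCoeff_eq, botProj,
    conjTranspose_fromCols_eq_fromRows_conjTranspose, fromRows_mul_fromCols, ← fromBlocks_one,
    fromBlocks_smul, fromBlocks_neg, fromBlocks_add, fromBlocks_add, fromBlocks_smul]
  congr 1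
  · simp
  · simp
  · simp
  · simp only [neg_smul, conjTranspose_one, Matrix.mul_one, mul_zero, zero_smul, neg_zero,
      add_zero, ← neg_add, ← add_smul]
    congr 2
    ring

variable {v : ℝ → Matrix (Fin m₁) (Fin m₂) ℂ}
  {u : ℝ → ℂ → Matrix (Fin m₁ ⊕ Fin m₂) (Fin m₁ ⊕ Fin m₂) ℂ}

lemma IsSolution.hasACDeriv {n p : Type*} [Fintype n] {C : ℝ → Matrix n n ℂ}
    {U : ℝ → Matrix n p ℂ} (h : IsSolution l C U) : HasACDeriv l U (fun x => C x * U x) :=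
  ⟨h.ac, h.eqn⟩

section

variable (hl : 0 < l) (hu : ∀ z : ℂ, IsFundamentalSolution l (fun x => diracCoeff (v x) z)
  (fun x => u x z))

include hl hu

/-- A skew-Hermitian coefficient makes the derivative of `u*u` vanish. -/
lemma conjTranspose_mul_self_eq_one {x : ℝ} (hx : x ∈ Icc 0 l) : (u x 0)ᴴ * u x 0 = 1 := by
  have h := (hu 0).toIsSolution.hasACDeriv
  have h2 : HasACDeriv l (fun x => (u x 0)ᴴ * u x 0) (fun _ => 0) :=
    (h.conjTranspose.mul h).congr_deriv (.of_forall fun x => by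
      rw [conjTranspose_mul, conjTranspose_diracCoeff_zero]
      simp [Matrix.mul_assoc])
  rw [h2.eq_of_deriv_eq_zero hl.le hx, (hu 0).init]
  simp

lemma mul_conjTranspose_self_eq_one {x : ℝ} (hx : x ∈ Icc 0 l) : u x 0 * (u x 0)ᴴ = 1 :=
  mul_eq_one_comm.mp (conjTranspose_mul_self_eq_one hl hu hx)

end

/-- The fundamental solution of `W' = -i z γ* γ W`, in terms of that of the Dirac system. -/
def canonicalSol (u : ℝ → ℂ → Matrix (Fin m₁ ⊕ Fin m₂) (Fin m₁ ⊕ Fin m₂) ℂ) (z : ℂ) (x : ℝ) :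
    Matrix (Fin m₁ ⊕ Fin m₂) (Fin m₁ ⊕ Fin m₂) ℂ :=
  Complex.exp (-(Complex.I * (z / 2)) * x) • ((u x 0)ᴴ * u x (z / 2))

section

variable (hl : 0 < l) (hu : ∀ z : ℂ, IsFundamentalSolution l (fun x => diracCoeff (v x) z)
  (fun x => u x z)) {γ : ℝ → Matrix (Fin m₂) (Fin m₁ ⊕ Fin m₂) ℂ}
  (hγ : ∀ x, γ x = botProj m₁ m₂ * u x 0)

include hl hu

lemma canonicalSol_zero (z : ℂ) : canonicalSol u z 0 = 1 := by
  have h0 := (hu 0).init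
  have h1 := (hu (z / 2)).init
  simp [canonicalSol, h0, h1]

lemma hasACDeriv_top : HasACDeriv l (fun x => topProj m₁ m₂ * u x 0)
    (fun x => v x * (botProj m₁ m₂ * u x 0)) :=
  ((hu 0).toIsSolution.hasACDeriv.const_mul _).congr_deriv (.of_forall fun x => by
    rw [← Matrix.mul_assoc, topProj_mul_diracCoeff, Matrix.mul_assoc])

lemma eq_exp_smul_canonicalSol {x : ℝ} (hx : x ∈ Icc 0 l) (z : ℂ) :
    u x z = Complex.exp (Complex.I * x * z) • (u x 0 * canonicalSol u (2 * z) x) := by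
  rw [canonicalSol, Matrix.mul_smul, ← Matrix.mul_assoc, mul_conjTranspose_self_eq_one hl hu hx,
    Matrix.one_mul, smul_smul, ← Complex.exp_add, mul_div_cancel_left₀ z two_ne_zero,
    show Complex.I * x * z + -(Complex.I * z) * x = 0 by ring, Complex.exp_zero, one_smul]

include hγ

lemma hasACDeriv_gamma : HasACDeriv l γ (fun x => -((v x)ᴴ * (topProj m₁ m₂ * u x 0))) := by
  have : γ = fun x => botProj m₁ m₂ * u x 0 := funext hγ
  rw [this]
  refine ((hu 0).toIsSolution.hasACDeriv.const_mul _).congr_deriv (.of_forall fun x => ?_)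
  rw [← Matrix.mul_assoc, botProj_mul_diracCoeff, Matrix.mul_assoc, Matrix.neg_mul]

lemma gamma_mul_conjTranspose {x : ℝ} (hx : x ∈ Icc 0 l) : γ x * (γ x)ᴴ = 1 := by
  rw [hγ, conjTranspose_mul, Matrix.mul_assoc, ← Matrix.mul_assoc (u x 0),
    mul_conjTranspose_self_eq_one hl hu hx, Matrix.one_mul, botProj_mul_conjTranspose]

/-- Different block rows of a unitary matrix are orthogonal. This gives `γ'γ* = 0`, hence a constant
`ρ`, and the zero initial value of `βγ(s)*` at `s`. -/
lemma top_mul_conjTranspose_gamma {x : ℝ} (hx : x ∈ Icc 0 l) :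
    topProj m₁ m₂ * u x 0 * (γ x)ᴴ = 0 := by
  rw [hγ, conjTranspose_mul, Matrix.mul_assoc, ← Matrix.mul_assoc (u x 0),
    mul_conjTranspose_self_eq_one hl hu hx, Matrix.one_mul, topProj_mul_conjTranspose_botProj]

lemma gamma_zero : γ 0 = botProj m₁ m₂ := by
  have h0 := (hu 0).init
  rw [hγ, h0, Matrix.mul_one]

lemma hasACDeriv_canonicalSol (z : ℂ) : HasACDeriv l (canonicalSol u z)
    (fun x => (-(Complex.I * z)) • ((γ x)ᴴ * γ x) * canonicalSol u z x) := by
  have h0 := (hu 0).toIsSolution.hasACDeriv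
  have h1 := (hu (z / 2)).toIsSolution.hasACDeriv
  refine ((h0.conjTranspose.mul h1).cexp_smul (-(Complex.I * (z / 2)))).congr_deriv ?_
  filter_upwards [ae_restrict_mem measurableSet_Ioo] with x hx
  have hxI := Ioo_subset_Icc_self hx
  -- The scalar factor, the flow at `0` and the flow at `z / 2` contribute one coefficient each;
  -- gathered between `u(x,0)*` and `u(x,z/2)` they form the sum evaluated by `diracCoeff_sub`.
  have e1 : (-(Complex.I * (z / 2))) • ((u x 0)ᴴ * u x (z / 2))
      + ((diracCoeff (v x) 0 * u x 0)ᴴ * u x (z / 2)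
        + (u x 0)ᴴ * (diracCoeff (v x) (z / 2) * u x (z / 2)))
      = (u x 0)ᴴ * (((-(Complex.I * (z / 2))) •
          (1 : Matrix (Fin m₁ ⊕ Fin m₂) (Fin m₁ ⊕ Fin m₂) ℂ)
          + (diracCoeff (v x) 0)ᴴ + diracCoeff (v x) (z / 2)) * u x (z / 2)) := by
    simp only [conjTranspose_mul, Matrix.add_mul, Matrix.mul_add, Matrix.smul_mul, Matrix.mul_smul,
      Matrix.one_mul, Matrix.mul_assoc, add_assoc]
  have e2 : (γ x)ᴴ * γ x * (u x 0)ᴴ = (u x 0)ᴴ * ((botProj m₁ m₂)ᴴ * botProj m₁ m₂) := by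
    rw [hγ, conjTranspose_mul, Matrix.mul_assoc, Matrix.mul_assoc (botProj m₁ m₂),
      mul_conjTranspose_self_eq_one hl hu hxI, Matrix.mul_one, Matrix.mul_assoc]
  rw [e1, diracCoeff_sub, mul_div_cancel₀ z two_ne_zero, canonicalSol, Matrix.smul_mul,
    Matrix.mul_smul, Matrix.smul_mul, Matrix.mul_smul, ← Matrix.mul_assoc ((γ x)ᴴ * γ x), e2]
  simp only [Matrix.mul_assoc]
  rw [smul_comm]

lemma integral_canonicalSol (z : ℂ) {x : ℝ} (hx : x ∈ Icc 0 l) :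
    ∫ t in (0 : ℝ)..x, (-(Complex.I * z)) • ((γ t)ᴴ * (γ t * canonicalSol u z t))
      = canonicalSol u z x - 1 := by
  have h := hasACDeriv_canonicalSol hl hu hγ z
  have hg := (hasACDeriv_gamma hl hu hγ).essBdd hl.le
  have h2 := h.congr_deriv (U'' := fun t =>
    (-(Complex.I * z)) • ((γ t)ᴴ * (γ t * canonicalSol u z t)))
    (.of_forall fun t => by rw [Matrix.smul_mul, Matrix.mul_assoc])
  rw [h2.integral_eq_sub ((hg.conjTranspose.mul (hg.mul (h.essBdd hl.le))).smul _) le_rfl hx.1 hx.2,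
    canonicalSol_zero hl hu]

variable (hv : EssBdd l v)

include hv

/-- Integrates `(βγ(s)*)' = vγγ(s)*` from `s`, where `β(s)γ(s)* = 0`. -/
lemma integral_v_gamma {s w : ℝ} (hs : 0 ≤ s) (hsw : s ≤ w) (hw : w ≤ l) :
    ∫ t in s..w, v t * (γ t * (γ s)ᴴ) = topProj m₁ m₂ * u w 0 * (γ s)ᴴ := by
  have h := (hasACDeriv_top hl hu).mul_const (γ s)ᴴ
  have hg := (hasACDeriv_gamma hl hu hγ).essBdd hl.le
  have h2 := h.congr_deriv (U'' := fun t => v t * (γ t * (γ s)ᴴ))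
    (.of_forall fun t => by rw [hγ t, Matrix.mul_assoc])
  rw [h2.integral_eq_sub (hv.mul (hg.mul (EssBdd.const l _))) hs hsw hw,
    top_mul_conjTranspose_gamma hl hu hγ ⟨hs, hsw.trans hw⟩, sub_zero]

/-- Integrates `(γγ(s)*)' = -v*βγ(s)*` from `s`, where `γ(s)γ(s)* = 1`. -/
lemma integral_v_top {s x : ℝ} (hs : 0 ≤ s) (hsx : s ≤ x) (hx : x ≤ l) :
    ∫ t in s..x, (v t)ᴴ * (topProj m₁ m₂ * u t 0 * (γ s)ᴴ) = 1 - γ x * (γ s)ᴴ := by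
  have h := ((hasACDeriv_gamma hl hu hγ).mul_const (γ s)ᴴ)
  have ht := (hasACDeriv_top hl hu).essBdd hl.le
  have h2 := h.congr_deriv (U'' := fun t => -((v t)ᴴ * (topProj m₁ m₂ * u t 0 * (γ s)ᴴ)))
    (.of_forall fun t => by rw [Matrix.neg_mul, Matrix.mul_assoc (v t)ᴴ])
  have hb : EssBdd l fun t => -((v t)ᴴ * (topProj m₁ m₂ * u t 0 * (γ s)ᴴ)) := by
    simpa using (hv.conjTranspose.mul (ht.mul (EssBdd.const l (γ s)ᴴ))).smul (-1)
  have h3 := h2.integral_eq_sub hb hs hsx hx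
  rw [intervalIntegral.integral_neg, gamma_mul_conjTranspose hl hu hγ ⟨hs, hsx.trans hx⟩] at h3
  rw [neg_eq_iff_eq_neg.mp h3, neg_sub]

end

end System

/-! ### Causal operators and their compressions -/

section Causal

variable {n : ℕ} {l r : ℝ}

lemma coeFn_opP (hr : r ≤ l) (f : L2 n l) : opP n l r f =ᵐ[vol r] f := by
  filter_upwards [(memLp_cut r f).coeFn_toLp, ae_restrict_mem measurableSet_Ioo] with x h1 hx
  exact h1.trans (indicator_of_mem (Ioo_subset_Ioo_right hr hx) _)

/-- Either inner product is the integral over the intersection of `(0, l)` and `(0, r)`: extension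
by zero is the same cut-off construction with the intervals interchanged. -/
lemma adjoint_opP (n : ℕ) (l r : ℝ) :
    ContinuousLinearMap.adjoint (opP n l r) = opP n r l := by
  refine ((ContinuousLinearMap.eq_adjoint_iff _ _).mpr fun g f => ?_).symm
  rw [L2.inner_def, L2.inner_def]
  have h1 : ∫ x, inner ℂ (opP n r l g x) (f x) ∂(vol l) = ∫ x in Ioo 0 l ∩ Ioo 0 r, inner ℂ (g x) (f x) := by
    rw [← setIntegral_indicator measurableSet_Ioo]
    refine integral_congr_ae ?_
    filter_upwards [(memLp_cut l g).coeFn_toLp] with x h1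
    rw [show opP n r l g x = _ from h1]
    by_cases hx : x ∈ Ioo 0 r <;> simp [hx]
  have h2 : ∫ x, inner ℂ (g x) (opP n l r f x) ∂(vol r) = ∫ x in Ioo 0 r ∩ Ioo 0 l, inner ℂ (g x) (f x) := by
    rw [← setIntegral_indicator measurableSet_Ioo]
    refine integral_congr_ae ?_
    filter_upwards [(memLp_cut r f).coeFn_toLp] with x h1
    rw [show opP n l r f x = _ from h1]
    by_cases hx : x ∈ Ioo 0 l <;> simp [hx]
  rw [h1, h2, inter_comm]

lemma opP_comp_adjoint (hr : r ≤ l) :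
    opP n l r ∘L ContinuousLinearMap.adjoint (opP n l r) = 1 := by
  rw [adjoint_opP]
  ext1 g
  refine Lp.ext ?_
  have h := (memLp_cut l g).coeFn_toLp
  have h2 : ∀ᵐ x ∂(vol r), opP n r l g x = (Ioo 0 r).indicator (fun x => g x) x :=
    ae_restrict_of_ae_restrict_of_subset (Ioo_subset_Ioo_right hr) h
  filter_upwards [coeFn_opP hr (opP n r l g), h2, ae_restrict_mem measurableSet_Ioo] with x h1 h2 hx
  rw [ContinuousLinearMap.comp_apply, h1, h2, indicator_of_mem hx]
  rfl

/-- The restriction of `T f` to `(0, r)` depends only on the restriction of `f`. -/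
def IsCausal (T : L2 n l →L[ℂ] L2 n l) : Prop :=
  ∀ r ≤ l, ∀ f, opP n l r f = 0 → opP n l r (T f) = 0

lemma IsTriangular.isCausal {T : L2 n l →L[ℂ] L2 n l} {ρ : ℝ → Matrix (Fin n) (Fin n) ℂ}
    {k : ℝ → ℝ → Matrix (Fin n) (Fin n) ℂ} (h : IsTriangular T ρ k) : IsCausal T := by
  intro r hr f hf
  have h0 : ∀ᵐ x ∂(vol r), f x = 0 := by
    filter_upwards [coeFn_opP hr f, Lp.coeFn_zero (EuclideanSpace ℂ (Fin n)) 2 (vol r)]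
      with x h1 h2
    rw [← h1, hf, h2, Pi.zero_apply]
  refine Lp.ext ?_
  have hT : ∀ᵐ x ∂(vol r), T f x = toEuclideanCLM (𝕜 := ℂ) (ρ x) (f x)
      + ∫ t in (0 : ℝ)..x, toEuclideanCLM (𝕜 := ℂ) (k x t) (f t) :=
    ae_restrict_of_ae_restrict_of_subset (Ioo_subset_Ioo_right hr) (h f)
  filter_upwards [coeFn_opP hr (T f), h0, hT,
    Lp.coeFn_zero (EuclideanSpace ℂ (Fin n)) 2 (vol r), ae_restrict_mem measurableSet_Ioo]
    with x h1 h2 h3 h4 hx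
  rw [h1, h3, h4, h2, map_zero, zero_add, Pi.zero_apply,
    intervalIntegral.integral_of_le hx.1.le, integral_Ioc_eq_integral_Ioo]
  refine integral_eq_zero_of_ae ?_
  filter_upwards [ae_restrict_of_ae_restrict_of_subset (Ioo_subset_Ioo_right hx.2.le) h0] with t ht
  rw [ht, map_zero, Pi.zero_apply]

lemma IsCausal.comp {S T : L2 n l →L[ℂ] L2 n l} (hS : IsCausal S) (hT : IsCausal T) :
    IsCausal (S ∘L T) := fun r hr f hf => hS r hr _ (hT r hr f hf)

/-- As `P P* = 1`, the vector `f - P*P f` lies in the kernel of `P`, which `T` preserves. -/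
lemma comp_eq_comp_adjoint_comp {H H' : Type*} [NormedAddCommGroup H] [InnerProductSpace ℂ H]
    [CompleteSpace H] [NormedAddCommGroup H'] [InnerProductSpace ℂ H'] [CompleteSpace H']
    {P : H →L[ℂ] H'} {T : H →L[ℂ] H} (hP : P ∘L ContinuousLinearMap.adjoint P = 1)
    (h : ∀ f, P f = 0 → P (T f) = 0) :
    P ∘L T = (P ∘L T ∘L ContinuousLinearMap.adjoint P) ∘L P := by
  ext1 f
  have h0 : P (ContinuousLinearMap.adjoint P (P f)) = P f := congrArg (fun S => S (P f)) hP
  have h1 : P (f - ContinuousLinearMap.adjoint P (P f)) = 0 := by rw [map_sub, h0, sub_self]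
  have h2 := h _ h1
  rw [map_sub, map_sub, sub_eq_zero] at h2
  exact h2

lemma compress_def (r : ℝ) (T : L2 n l →L[ℂ] L2 n l) :
    compress r T = opP n l r ∘L T ∘L ContinuousLinearMap.adjoint (opP n l r) := rfl

lemma IsCausal.opP_comp {T : L2 n l →L[ℂ] L2 n l} (hT : IsCausal T) (hr : r ≤ l) :
    opP n l r ∘L T = compress r T ∘L opP n l r := by
  rw [compress_def]
  exact comp_eq_comp_adjoint_comp (opP_comp_adjoint hr) (hT r hr)

/-- Causality of the left factor gives `P S = S_r P`, so nothing is required of `T`; this matters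
for `opS`, whose right factor is an adjoint. -/
lemma compress_comp {S T : L2 n l →L[ℂ] L2 n l} (hS : IsCausal S) (hr : r ≤ l) :
    compress r (S ∘L T) = compress r S ∘L compress r T := by
  rw [compress_def r (S ∘L T), compress_def r T, ContinuousLinearMap.comp_assoc,
    ← ContinuousLinearMap.comp_assoc (opP n l r) S, hS.opP_comp hr,
    ContinuousLinearMap.comp_assoc]

lemma compress_one (hr : r ≤ l) : compress r (1 : L2 n l →L[ℂ] L2 n l) = 1 :=
  opP_comp_adjoint hr

lemma compress_one_sub_smul (hr : r ≤ l) (z : ℂ) (T : L2 n l →L[ℂ] L2 n l) :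
    compress r (1 - z • T) = 1 - z • compress r T := by
  rw [← compress_one (n := n) hr, compress_def, compress_def, compress_def,
    ContinuousLinearMap.sub_comp, ContinuousLinearMap.comp_sub, ContinuousLinearMap.smul_comp,
    ContinuousLinearMap.comp_smul]

lemma compress_adjoint (T : L2 n l →L[ℂ] L2 n l) :
    compress r (ContinuousLinearMap.adjoint T) = ContinuousLinearMap.adjoint (compress r T) := by
  rw [compress_def, compress_def, ContinuousLinearMap.adjoint_comp,
    ContinuousLinearMap.adjoint_comp, ContinuousLinearMap.adjoint_adjoint,
    ContinuousLinearMap.comp_assoc]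

lemma ring_inverse_eq {R : Type*} [Ring R] {a b : R} (h : a * b = 1) (h' : b * a = 1) :
    Ring.inverse a = b :=
  Ring.inverse_unit ⟨a, b, h, h'⟩

end Causal

/-! ### Compressions of Volterra operators -/

section VolterraCausal

variable {n : ℕ} {l r : ℝ} {k : ℝ → ℝ → Matrix (Fin n) (Fin n) ℂ}

lemma isTriangular_kernelOp (hk : IsVolterra l k) : IsTriangular (kernelOp hk) (fun _ => 0) k := by
  intro f
  filter_upwards [coeFn_kernelOp hk f, ae_restrict_mem measurableSet_Ioo] with x h1 hx
  rw [h1, vint_eq_intervalIntegral hk _ hx, map_zero, _root_.zero_apply, zero_add]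

lemma isTriangular_one_add_kernelOp (hk : IsVolterra l k) :
    IsTriangular (1 + kernelOp hk) (fun _ => 1) k := by
  intro f
  filter_upwards [coeFn_kernelOp hk f, ae_restrict_mem measurableSet_Ioo,
    Lp.coeFn_add f (kernelOp hk f)] with x h1 hx h2
  rw [_root_.add_apply, one_apply_eq_self, h2, Pi.add_apply, h1,
    vint_eq_intervalIntegral hk _ hx, map_one, one_apply_eq_self]

lemma IsVolterra.const_smul (c : ℂ) (hk : IsVolterra l k) :
    IsVolterra l (fun x t => c • k x t) := by
  obtain ⟨C, hC, hC'⟩ := hk.bdd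
  refine ⟨hk.meas.const_smul c, ⟨‖c‖ * C, by positivity, fun x t => ?_⟩, fun x t h => ?_⟩
  · rw [norm_smul]; exact mul_le_mul_of_nonneg_left (hC' x t) (norm_nonneg c)
  · rw [hk.supp x t h, smul_zero]

lemma kernelOp_smul (c : ℂ) (hk : IsVolterra l k) :
    kernelOp (hk.const_smul c) = c • kernelOp hk := by
  ext1 f
  refine Lp.ext ?_
  filter_upwards [coeFn_kernelOp (hk.const_smul c) f, coeFn_kernelOp hk f,
    Lp.coeFn_smul c (kernelOp hk f)] with x h1 h2 h3
  rw [h1, _root_.smul_apply, h3, Pi.smul_apply, h2, vint, vint, ← integral_smul]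
  simp only [map_smul, _root_.smul_apply]

lemma isCausal_opA (n : ℕ) (l : ℝ) : IsCausal (opA n l) := by
  rw [opA_eq, ← kernelOp_smul]
  exact (isTriangular_kernelOp _).isCausal

/-- The compressions of `I - z A` are invertible. -/
theorem isUnit_one_sub_smul_compress_opA (n : ℕ) (hr : r ≤ l) (z : ℂ) :
    IsUnit (1 - z • compress r (opA n l)) := by
  -- On the whole interval this is the identity plus a Volterra operator; its inverse has the same
  -- form, so both are causal and their compressions remain mutually inverse.
  have h0 : 1 - z • opA n l
      = 1 + kernelOp ((isVolterra_intKernel n l).const_smul (z * Complex.I)) := by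
    rw [kernelOp_smul, opA_eq, smul_smul, mul_neg, neg_smul, sub_neg_eq_add]
  obtain ⟨d, hd, h1, h2⟩ := exists_inverse ((isVolterra_intKernel n l).const_smul (z * Complex.I))
  have c1 := (isTriangular_one_add_kernelOp
    ((isVolterra_intKernel n l).const_smul (z * Complex.I))).isCausal
  have c2 := (isTriangular_one_add_kernelOp hd).isCausal
  rw [← h0] at h1 h2 c1
  rw [← compress_one_sub_smul hr]
  refine ⟨⟨_, compress r (1 + kernelOp hd), ?_, ?_⟩, rfl⟩
  · exact (compress_comp c1 hr).symm.trans ((congrArg (compress r) h1).trans (compress_one hr))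
  · exact (compress_comp c2 hr).symm.trans ((congrArg (compress r) h2).trans (compress_one hr))

end VolterraCausal

/-! ### Operators given by columns -/

section Columns

variable {n n' : ℕ} {p : Type*} [Fintype p] [DecidableEq p] {l r : ℝ}

/-- The columns of a matrix, as a continuous linear map. -/
def colCLM (n : ℕ) (j : p) : Matrix (Fin n) p ℂ →L[ℂ] EuclideanSpace ℂ (Fin n) :=
  LinearMap.toContinuousLinearMap
    { toFun := fun M => WithLp.toLp 2 fun i => M i j
      map_add' := fun _ _ => rfl
      map_smul' := fun _ _ => rfl }

lemma col_eq_colCLM (θ : ℝ → Matrix (Fin n) p ℂ) (j : p) (x : ℝ) :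
    col θ j x = colCLM n j (θ x) := rfl

lemma colCLM_apply (j : p) (M : Matrix (Fin n) p ℂ) (i : Fin n) : colCLM n j M i = M i j := rfl

lemma toEuclideanCLM_col (M : Matrix (Fin n) (Fin n) ℂ) (θ : ℝ → Matrix (Fin n) p ℂ) (j : p)
    (x : ℝ) : toEuclideanCLM (𝕜 := ℂ) M (col θ j x) = colCLM n j (M * θ x) := by
  rw [col, toEuclideanCLM_toLp]
  rfl

lemma EssBdd.memLp_col {θ : ℝ → Matrix (Fin n) p ℂ} (hθ : EssBdd l θ) (j : p) :
    MemLp (col θ j) 2 (vol l) := by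
  obtain ⟨B, hB, hB'⟩ := hθ.bdd
  refine MemLp.of_bound ((colCLM n j).continuous.comp_aestronglyMeasurable hθ.meas)
    (‖colCLM n j‖ * B) ?_
  filter_upwards [hB'] with x hx
  exact ((colCLM n j).le_opNorm _).trans (mul_le_mul_of_nonneg_left hx (norm_nonneg _))

lemma ofCols_apply (c : p → L2 n l) (g : EuclideanSpace ℂ p) :
    ofCols c g = ∑ j, g j • c j := by
  simp [ofCols]

lemma comp_ofCols (T : L2 n l →L[ℂ] L2 n' r) (c : p → L2 n l) :
    T ∘L ofCols c = ofCols fun j => T (c j) := by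
  ext1 g
  rw [ContinuousLinearMap.comp_apply, ofCols_apply, ofCols_apply, map_sum]
  simp only [map_smul]

lemma ofCols_sub_smul (z : ℂ) (c d : p → L2 n l) :
    ofCols c - z • ofCols d = ofCols fun j => c j - z • d j := by
  ext1 g
  rw [_root_.sub_apply, _root_.smul_apply, ofCols_apply, ofCols_apply, ofCols_apply,
    Finset.smul_sum, ← Finset.sum_sub_distrib]
  simp only [smul_sub, smul_comm z]

lemma adjoint_ofCols_apply (c : p → L2 n l) (f : L2 n l) (i : p) :
    ContinuousLinearMap.adjoint (ofCols c) f i = inner ℂ (c i) f := by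
  have h := ContinuousLinearMap.adjoint_inner_right (ofCols c) (EuclideanSpace.single i 1) f
  rw [EuclideanSpace.inner_single_left, map_one, one_mul] at h
  rw [h, ofCols_apply, Finset.sum_eq_single i]
  · simp
  · intro b _ hb
    simp [hb]
  · simp

lemma toEuclideanCLM_symm_apply (T : EuclideanSpace ℂ p →L[ℂ] EuclideanSpace ℂ p) (i j : p) :
    (toEuclideanCLM (n := p) (𝕜 := ℂ)).symm T i j = T (EuclideanSpace.single j 1) i := by
  obtain ⟨M, rfl⟩ : ∃ M, toEuclideanCLM (n := p) (𝕜 := ℂ) M = T :=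
    ⟨_, (toEuclideanCLM (n := p) (𝕜 := ℂ)).apply_symm_apply T⟩
  rw [StarAlgEquiv.symm_apply_apply, ofLp_toEuclideanCLM]
  simp

lemma toEuclideanCLM_symm_adjoint_ofCols_comp (c d : p → L2 n l) (i j : p) :
    (toEuclideanCLM (n := p) (𝕜 := ℂ)).symm
      (ContinuousLinearMap.adjoint (ofCols c) ∘L ofCols d) i j = inner ℂ (c i) (d j) := by
  rw [toEuclideanCLM_symm_apply, ContinuousLinearMap.comp_apply, adjoint_ofCols_apply,
    ofCols_apply, Finset.sum_eq_single j]
  · simp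
  · intro b _ hb
    simp [hb]
  · simp

lemma inner_ofCols_adjoint (c : p → L2 n l) (f g : L2 n l) :
    inner ℂ f (ofCols c (ContinuousLinearMap.adjoint (ofCols c) g))
      = ∑ i, inner ℂ f (c i) * inner ℂ (c i) g := by
  rw [ofCols_apply, inner_sum]
  refine Finset.sum_congr rfl fun i _ => ?_
  rw [inner_smul_right, adjoint_ofCols_apply, mul_comm]

/-- The expansion of `M N*` into rank-one terms over the columns; it identifies the full kernel
`γ(x)γ(t)*` with `ΓΓ*`. -/
lemma toEuclideanCLM_mul_conjTranspose (M N : Matrix (Fin n) p ℂ) (w : EuclideanSpace ℂ (Fin n)) :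
    toEuclideanCLM (𝕜 := ℂ) (M * Nᴴ) w = ∑ i, inner ℂ (colCLM n i N) w • colCLM n i M := by
  ext k
  rw [ofLp_toEuclideanCLM]
  simp only [mulVec, dotProduct, mul_apply, conjTranspose_apply, WithLp.ofLp_sum, Finset.sum_apply,
    WithLp.ofLp_smul, Pi.smul_apply, smul_eq_mul, Finset.sum_mul, colCLM_apply,
    PiLp.inner_apply, RCLike.inner_apply]
  rw [Finset.sum_comm]
  refine Finset.sum_congr rfl fun i _ => Finset.sum_congr rfl fun a _ => ?_
  simp only [RCLike.star_def]
  ring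

lemma inner_colCLM (M N : Matrix (Fin n) p ℂ) (i j : p) :
    inner ℂ (colCLM n i M) (colCLM n j N) = (Mᴴ * N) i j := by
  simp only [mul_apply, conjTranspose_apply, colCLM_apply, PiLp.inner_apply,
    RCLike.inner_apply, RCLike.star_def]
  exact Finset.sum_congr rfl fun a _ => mul_comm _ _

end Columns

/-! ### The model operator -/

section Model

variable {n : ℕ} {l : ℝ}

lemma isVolterra_ite {M : ℝ → ℝ → Matrix (Fin n) (Fin n) ℂ} {C : ℝ}
    (hM : StronglyMeasurable (Function.uncurry M))
    (hC : ∀ x t, 0 < t → t < x → x < l → ‖M x t‖ ≤ C) :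
    IsVolterra l (fun x t => if 0 < t ∧ t < x ∧ x < l then M x t else 0) := by
  refine ⟨?_, ⟨max C 0, le_max_right _ _, fun x t => ?_⟩, fun x t h => if_neg h⟩
  · refine StronglyMeasurable.ite ?_ hM stronglyMeasurable_const
    exact (measurableSet_lt measurable_const measurable_snd).inter
      ((measurableSet_lt measurable_snd measurable_fst).inter
        (measurableSet_lt measurable_fst measurable_const))
  · split_ifs with h
    · exact (hC x t h.1 h.2.1 h.2.2).trans (le_max_left _ _)
    · rw [norm_zero]; exact le_max_right _ _

variable {p : Type*} [Fintype p] [DecidableEq p]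

/-- The Volterra kernel `γ(x) γ(t)*`. -/
def gramKernel (l : ℝ) (γ : ℝ → Matrix (Fin n) p ℂ) (x t : ℝ) : Matrix (Fin n) (Fin n) ℂ :=
  if 0 < t ∧ t < x ∧ x < l then γ x * (γ t)ᴴ else 0

lemma isVolterra_gramKernel {γ : ℝ → Matrix (Fin n) p ℂ} (hγ : ContinuousOn γ (Icc 0 l)) :
    IsVolterra l (gramKernel l γ) := by
  obtain ⟨C, hC⟩ := isCompact_Icc.exists_bound_of_continuousOn hγ
  rcases lt_or_ge 0 l with hl | hl
  -- Nothing is known about `γ` off `[0, l]`; the constant extension gives global measurability and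
  -- does not change the kernel on the triangle.
  · have hc : Continuous (IccExtend hl.le ((Icc 0 l).domRestrict γ)) :=
      hγ.domRestrict.Icc_extend'
    have hM : StronglyMeasurable (Function.uncurry fun x t =>
        IccExtend hl.le ((Icc 0 l).domRestrict γ) x * (IccExtend hl.le ((Icc 0 l).domRestrict γ) t)ᴴ) :=
      Continuous.stronglyMeasurable ((hc.comp continuous_fst).matrix_mul
        (hc.comp continuous_snd).matrix_conjTranspose)
    have he : ∀ x ∈ Icc 0 l, IccExtend hl.le ((Icc 0 l).domRestrict γ) x = γ x := fun x hx =>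
      IccExtend_of_mem _ _ hx
    have h := isVolterra_ite (l := l) (C := C * C) hM fun x t h1 h2 h3 => by
      have hx : x ∈ Icc 0 l := ⟨(h1.trans h2).le, h3.le⟩
      have ht : t ∈ Icc 0 l := ⟨h1.le, (h2.trans h3).le⟩
      rw [he x hx, he t ht]
      refine (l2_opNorm_mul _ _).trans ?_
      rw [l2_opNorm_conjTranspose]
      exact mul_le_mul (hC x hx) (hC t ht) (norm_nonneg _) ((norm_nonneg _).trans (hC x hx))
    convert h using 1
    ext1 x; ext1 t
    rw [gramKernel]
    split_ifs with hc
    · rw [he x ⟨(hc.1.trans hc.2.1).le, hc.2.2.le⟩, he t ⟨hc.1.le, (hc.2.1.trans hc.2.2).le⟩]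
    · rfl
  · convert IsVolterra.zero (𝔸 := Matrix (Fin n) (Fin n) ℂ) (l := l) using 1
    ext1 x; ext1 t
    exact if_neg fun h => absurd (h.1.trans (h.2.1.trans h.2.2)) (not_lt.mpr hl)

lemma integrable_inner_act {M : ℝ × ℝ → Matrix (Fin n) (Fin n) ℂ} {C : ℝ}
    (hM : StronglyMeasurable M) (hC : ∀ q, ‖M q‖ ≤ C) (f g : L2 n l) :
    Integrable (fun q : ℝ × ℝ => inner ℂ (f q.1) (toEuclideanCLM (𝕜 := ℂ) (M q) (g q.2)))
      ((vol l).prod (vol l)) := by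
  refine (((integrable_coe f).norm.mul_prod (integrable_coe g).norm).const_mul C).mono' ?_
    (.of_forall fun q => ?_)
  · exact (Lp.aestronglyMeasurable f).comp_fst.inner (aestronglyMeasurable_toEuclideanCLM_apply
      hM.aestronglyMeasurable (Lp.aestronglyMeasurable g).comp_snd)
  · refine (norm_inner_le_norm _ _).trans ?_
    calc ‖f q.1‖ * ‖toEuclideanCLM (𝕜 := ℂ) (M q) (g q.2)‖
        ≤ ‖f q.1‖ * (C * ‖g q.2‖) := by
          refine mul_le_mul_of_nonneg_left ((norm_toEuclideanCLM_apply_le _ _).trans ?_)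
            (norm_nonneg _)
          exact mul_le_mul_of_nonneg_right (hC q) (norm_nonneg _)
      _ = C * (‖f q.1‖ * ‖g q.2‖) := by ring

lemma inner_kernelOp {k : ℝ → ℝ → Matrix (Fin n) (Fin n) ℂ} (hk : IsVolterra l k) (f g : L2 n l) :
    inner ℂ f (kernelOp hk g)
      = ∫ x, ∫ t, inner ℂ (f x) (toEuclideanCLM (𝕜 := ℂ) (k x t) (g t)) ∂(vol l) ∂(vol l) := by
  rw [L2.inner_def]
  refine integral_congr_ae ?_
  filter_upwards [coeFn_kernelOp hk g] with x hx
  rw [hx, vint]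
  exact (integral_inner (hk.integrable_row (integrable_coe g) x) (f x)).symm

lemma inner_adjoint_kernelOp {k : ℝ → ℝ → Matrix (Fin n) (Fin n) ℂ} (hk : IsVolterra l k)
    (f g : L2 n l) :
    inner ℂ (kernelOp hk f) g
      = ∫ x, ∫ t, inner ℂ (f x) (toEuclideanCLM (𝕜 := ℂ) (k t x)ᴴ (g t)) ∂(vol l) ∂(vol l) := by
  obtain ⟨C, hC, hC'⟩ := hk.bdd
  rw [← inner_conj_symm, inner_kernelOp, ← integral_conj]
  simp only [← integral_conj, inner_conj_symm]
  have hadj : ∀ x t, inner ℂ (toEuclideanCLM (𝕜 := ℂ) (k x t) (f t)) (g x)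
      = inner ℂ (f t) (toEuclideanCLM (𝕜 := ℂ) (k x t)ᴴ (g x)) := by
    intro x t
    rw [← star_eq_conjTranspose, map_star, ContinuousLinearMap.star_eq_adjoint,
      ContinuousLinearMap.adjoint_inner_right]
  simp only [hadj]
  refine (integral_integral_swap (f := fun x t =>
    inner ℂ (f x) (toEuclideanCLM (𝕜 := ℂ) (k t x)ᴴ (g t))) ?_).symm
  refine integrable_inner_act (M := fun q => (k q.2 q.1)ᴴ) (C := C) ?_ (fun q => ?_) f g
  · exact (continuous_id.matrix_conjTranspose).comp_stronglyMeasurable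
      (hk.meas.comp_measurable measurable_swap)
  · rw [l2_opNorm_conjTranspose]; exact hC' _ _

/-- The operator integrates `γ(x)γ(t)*` over `t < x` and its adjoint integrates the same expression
over `t > x`. Off the null diagonal they make up the whole square. -/
theorem gramKernel_add_adjoint {γ : ℝ → Matrix (Fin n) p ℂ} (hγ : ContinuousOn γ (Icc 0 l))
    (hγ' : EssBdd l γ) :
    kernelOp (isVolterra_gramKernel hγ)
        + ContinuousLinearMap.adjoint (kernelOp (isVolterra_gramKernel hγ))
      = ofCols (fun j => toL2 l (col γ j))
        ∘L ContinuousLinearMap.adjoint (ofCols fun j => toL2 l (col γ j)) := by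
  have hk := isVolterra_gramKernel hγ
  obtain ⟨C, hC, hC'⟩ := hk.bdd
  ext1 g
  refine ext_inner_left ℂ fun f => ?_
  have i1 := integrable_inner_act (M := fun q => gramKernel l γ q.1 q.2) hk.meas
    (fun q => hC' q.1 q.2) f g
  have i2 := integrable_inner_act (M := fun q => (gramKernel l γ q.2 q.1)ᴴ) (C := C)
    ((continuous_id.matrix_conjTranspose).comp_stronglyMeasurable
      (hk.meas.comp_measurable measurable_swap))
    (fun q => by rw [l2_opNorm_conjTranspose]; exact hC' _ _) f g
  rw [_root_.add_apply, inner_add_right, ContinuousLinearMap.adjoint_inner_right,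
    ContinuousLinearMap.comp_apply, inner_ofCols_adjoint, inner_kernelOp, inner_adjoint_kernelOp]
  have e1 := integral_prod _ i1
  have e2 := integral_prod _ i2
  rw [← e1, ← e2, ← integral_add i1 i2]
  have e3 : ∀ i, inner ℂ f (toL2 l (col γ i)) * inner ℂ (toL2 l (col γ i)) g
      = ∫ q : ℝ × ℝ, inner ℂ (f q.1) (col γ i q.1) * inner ℂ (col γ i q.2) (g q.2)
        ∂((vol l).prod (vol l)) := by
    intro i
    rw [integral_prod_mul (fun x => inner ℂ (f x) (col γ i x)) (fun x => inner ℂ (col γ i x) (g x)),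
      L2.inner_def, L2.inner_def]
    congr 1
    · refine integral_congr_ae ?_
      filter_upwards [coeFn_toL2 (hγ'.memLp_col i)] with x hx
      rw [hx]
    · refine integral_congr_ae ?_
      filter_upwards [coeFn_toL2 (hγ'.memLp_col i)] with x hx
      rw [hx]
  simp only [e3]
  rw [← integral_finsetSum]
  · refine integral_congr_ae ?_
    have hne : ∀ᵐ q ∂((vol l).prod (vol l)), q.1 ≠ q.2 := by
      refine (Measure.ae_prod_iff_ae_ae (p := fun q : ℝ × ℝ => q.1 ≠ q.2)
        (measurableSet_eq_fun measurable_fst measurable_snd).compl).mpr (.of_forall fun x => ?_)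
      have : ∀ᵐ y ∂(vol l), y ≠ x := ae_restrict_of_ae (by simp [ae_iff])
      exact this.mono fun y hy => hy.symm
    have hmem : ∀ᵐ q ∂((vol l).prod (vol l)), q ∈ Ioo 0 l ×ˢ Ioo 0 l := by
      rw [Measure.prod_restrict]
      exact ae_restrict_mem (measurableSet_Ioo.prod measurableSet_Ioo)
    filter_upwards [hne, hmem] with q h1 h2
    have hsum : gramKernel l γ q.1 q.2 + (gramKernel l γ q.2 q.1)ᴴ = γ q.1 * (γ q.2)ᴴ := by
      rcases lt_or_gt_of_ne h1 with h | h
      · rw [gramKernel, if_neg (fun h' => absurd h'.2.1 (not_lt.mpr h.le)), gramKernel,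
          if_pos ⟨h2.1.1, h, h2.2.2⟩, zero_add, conjTranspose_mul, conjTranspose_conjTranspose]
      · rw [gramKernel, if_pos ⟨h2.2.1, h, h2.1.2⟩, gramKernel,
          if_neg (fun h' => absurd h'.2.1 (not_lt.mpr h.le)), conjTranspose_zero, add_zero]
    rw [← inner_add_right, ← _root_.add_apply, ← map_add, hsum, toEuclideanCLM_mul_conjTranspose,
      inner_sum]
    refine Finset.sum_congr rfl fun i _ => ?_
    rw [inner_smul_right, mul_comm]
    rfl
  · intro i _
    refine Integrable.mul_prod (f := fun x => inner ℂ (f x) (col γ i x))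
      (g := fun x => inner ℂ (col γ i x) (g x)) ?_ ?_
    · refine (L2.integrable_inner f (toL2 l (col γ i))).congr ?_
      filter_upwards [coeFn_toL2 (hγ'.memLp_col i)] with x hx
      rw [hx]
    · refine (L2.integrable_inner (toL2 l (col γ i)) g).congr ?_
      filter_upwards [coeFn_toL2 (hγ'.memLp_col i)] with x hx
      rw [hx]

end Model

/-! ### The `S`-node and the transfer matrix function of a similarity operator -/

section Abstract

variable {H H' : Type*} [NormedAddCommGroup H] [InnerProductSpace ℂ H] [CompleteSpace H]
  [NormedAddCommGroup H'] [InnerProductSpace ℂ H'] [CompleteSpace H']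

open ContinuousLinearMap in
-- Used with `f = E⁻¹`: both terms on the left become conjugates by `f`, of `K` and of `K*`, and `K
-- - K* = -i(Y + Y*)`.
lemma node_identity {A f K Y : H →L[ℂ] H} {G : H' →L[ℂ] H} (hf : A ∘L f = f ∘L K)
    (hK : K = (-Complex.I) • Y) (hY : Y + adjoint Y = G ∘L adjoint G) :
    A ∘L (f ∘L adjoint f) - (f ∘L adjoint f) ∘L adjoint A
      = (-Complex.I) • ((f ∘L G) ∘L adjoint (f ∘L G)) := by
  have h1 : A ∘L (f ∘L adjoint f) = f ∘L K ∘L adjoint f := by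
    rw [← comp_assoc, hf, comp_assoc]
  have h2 : (f ∘L adjoint f) ∘L adjoint A = f ∘L adjoint K ∘L adjoint f := by
    rw [comp_assoc, ← adjoint_comp, hf, adjoint_comp]
  have h3 : adjoint K = Complex.I • adjoint Y := by
    rw [hK, map_smulₛₗ]
    simp
  have h4 : (f ∘L G) ∘L adjoint (f ∘L G) = f ∘L (G ∘L adjoint G) ∘L adjoint f := by
    rw [adjoint_comp, comp_assoc, comp_assoc]
  rw [h1, h2, h4, ← hY, h3, hK]
  ext1 g
  simp only [ContinuousLinearMap.comp_apply, _root_.sub_apply, _root_.smul_apply, _root_.add_apply, map_smul, map_add,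
    smul_add]
  module

open ContinuousLinearMap in
-- Applying `f = e⁻¹` to `X - zKX = eπ` gives `(1 - zA) f X = π`; then `R` and `e` recover `X`. The
-- resolvent of `K` is thus replaced by one explicit solution.
lemma resolvent_identity {A e f K R : H →L[ℂ] H} {π G X : H' →L[ℂ] H} {z : ℂ}
    (hef : e ∘L f = 1) (hfe : f ∘L e = 1) (hK : K = e ∘L A ∘L f) (hR : R ∘L (1 - z • A) = 1)
    (hG : G = e ∘L π) (hX : X - z • (K ∘L X) = G) : e ∘L R ∘L π = X := by
  have hfe' : ∀ w, f (e w) = w := fun w => congrArg (fun S => S w) hfe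
  have hef' : ∀ w, e (f w) = w := fun w => congrArg (fun S => S w) hef
  have hR' : ∀ w, R (w - z • A w) = w := fun w => congrArg (fun S => S w) hR
  ext1 g
  have h1 : X g - z • K (X g) = e (π g) := by
    have := congrArg (fun S => S g) hX
    rw [hG] at this
    exact this
  have h2 : π g = f (X g) - z • A (f (X g)) := by
    rw [← hfe' (π g), ← h1, map_sub, map_smul, hK, ContinuousLinearMap.comp_apply,
      ContinuousLinearMap.comp_apply, hfe']
  rw [ContinuousLinearMap.comp_apply, ContinuousLinearMap.comp_apply, h2, hR', hef']

open ContinuousLinearMap in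
lemma ring_inverse_comp_adjoint {e f : H →L[ℂ] H} (hef : e ∘L f = 1) (hfe : f ∘L e = 1) :
    IsUnit (f ∘L adjoint f) ∧ Ring.inverse (f ∘L adjoint f) = adjoint e ∘L e := by
  have h1 : adjoint f ∘L adjoint e = 1 := by rw [← adjoint_comp, hef]; exact adjoint_id
  have h2 : adjoint e ∘L adjoint f = 1 := by rw [← adjoint_comp, hfe]; exact adjoint_id
  have h3 : (f ∘L adjoint f) * (adjoint e ∘L e) = 1 := by
    rw [mul_def, comp_assoc, ← comp_assoc (adjoint f), h1]; exact hfe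
  have h4 : (adjoint e ∘L e) * (f ∘L adjoint f) = 1 := by
    rw [mul_def, comp_assoc, ← comp_assoc e, hef]; exact h2
  exact ⟨⟨⟨_, _, h3, h4⟩, rfl⟩, ring_inverse_eq h3 h4⟩

open ContinuousLinearMap in
-- With `S⁻¹ = e*e`, one factor `e*` is absorbed into `G* = (ePπ)*`, and the other factor `e` turns
-- the resolvent of `A` into a solution of the equation for `K`.
lemma transfer_operator_eq {H₀ : Type*} [NormedAddCommGroup H₀] [InnerProductSpace ℂ H₀]
    [CompleteSpace H₀] {A e f K S R : H →L[ℂ] H} {P : H₀ →L[ℂ] H} {π : H' →L[ℂ] H₀}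
    {G X : H' →L[ℂ] H} {z : ℂ} (hef : e ∘L f = 1) (hfe : f ∘L e = 1) (hS : S = f ∘L adjoint f)
    (hK : K = e ∘L A ∘L f) (hR : R ∘L (1 - z • A) = 1) (hG : G = e ∘L (P ∘L π))
    (hX : X - z • (K ∘L X) = G) :
    adjoint π ∘L adjoint P ∘L Ring.inverse S ∘L R ∘L P ∘L π = adjoint G ∘L X := by
  rw [← resolvent_identity hef hfe hK hR hG hX, hS, (ring_inverse_comp_adjoint hef hfe).2, hG,
    adjoint_comp, adjoint_comp]
  simp only [comp_assoc]

end Abstract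

lemma IsTriangular.congr {n : ℕ} {l : ℝ} {T : L2 n l →L[ℂ] L2 n l}
    {ρ : ℝ → Matrix (Fin n) (Fin n) ℂ} {k k' : ℝ → ℝ → Matrix (Fin n) (Fin n) ℂ}
    (h : IsTriangular T ρ k) (hk : ∀ x t, 0 < t → t < x → x < l → k x t = k' x t) :
    IsTriangular T ρ k' := by
  intro f
  filter_upwards [h f, ae_restrict_mem measurableSet_Ioo] with x h1 hx
  rw [h1, intervalIntegral.integral_of_le hx.1.le, intervalIntegral.integral_of_le hx.1.le,
    integral_Ioc_eq_integral_Ioo, integral_Ioc_eq_integral_Ioo]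
  congr 1
  refine setIntegral_congr_fun measurableSet_Ioo fun t ht => ?_
  simp only [hk x t ht.1 ht.2 hx.2]

lemma IsTriangular.unique {n : ℕ} {l : ℝ} {T T' : L2 n l →L[ℂ] L2 n l}
    {ρ : ℝ → Matrix (Fin n) (Fin n) ℂ} {k : ℝ → ℝ → Matrix (Fin n) (Fin n) ℂ}
    (h : IsTriangular T ρ k) (h' : IsTriangular T' ρ k) : T = T' := by
  ext1 f
  refine Lp.ext ?_
  filter_upwards [h f, h' f] with x h1 h2
  rw [h1, h2]

/-- The operator with kernel `-i γ(x) γ(t)*` is triangular with zero diagonal term. -/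
lemma isTriangular_smul_gramKernel {n : ℕ} {p : Type*} [Fintype p] [DecidableEq p] {l : ℝ}
    {γ : ℝ → Matrix (Fin n) p ℂ} (hγ : ContinuousOn γ (Icc 0 l)) :
    IsTriangular ((-Complex.I) • kernelOp (isVolterra_gramKernel hγ)) (fun _ => 0)
      (fun x t => γ x * ((-Complex.I) • (γ t)ᴴ)) := by
  rw [← kernelOp_smul]
  refine (isTriangular_kernelOp _).congr fun x t h1 h2 h3 => ?_
  rw [gramKernel, if_pos ⟨h1, h2, h3⟩, Matrix.mul_smul]

/-! ### Compressed similarity operators and the transfer matrix function -/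

section Transfer

variable {m₁ m₂ : ℕ} {l : ℝ} {γ : ℝ → Matrix (Fin m₂) (Fin m₁ ⊕ Fin m₂) ℂ}
  {E : L2 m₂ l ≃L[ℂ] L2 m₂ l}

lemma coe_comp_symm (E : L2 m₂ l ≃L[ℂ] L2 m₂ l) :
    (E : L2 m₂ l →L[ℂ] L2 m₂ l) ∘L (E.symm : L2 m₂ l →L[ℂ] L2 m₂ l) = 1 := by
  ext1 f
  exact E.apply_symm_apply f

lemma symm_comp_coe (E : L2 m₂ l ≃L[ℂ] L2 m₂ l) :
    (E.symm : L2 m₂ l →L[ℂ] L2 m₂ l) ∘L (E : L2 m₂ l →L[ℂ] L2 m₂ l) = 1 := by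
  ext1 f
  exact E.symm_apply_apply f

/-- The normalization makes the constant block of `Π` equal to `E⁻¹γ₂`, so both blocks have the same
form. -/
lemma IsSimilarityOperator.opPi_eq (hE : IsSimilarityOperator l γ E) :
    opPi γ E = (E.symm : L2 m₂ l →L[ℂ] L2 m₂ l) ∘L ofCols fun j => toL2 l (col γ j) := by
  rw [comp_ofCols, opPi]
  congr 1
  ext1 j
  rcases j with j | j
  · rfl
  · exact (hE.normalized j).symm

lemma IsSimilarityOperator.conj_opA_eq (hE : IsSimilarityOperator l γ E)
    (hγ : ContinuousOn γ (Icc 0 l)) :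
    (E : L2 m₂ l →L[ℂ] L2 m₂ l) ∘L opA m₂ l ∘L (E.symm : L2 m₂ l →L[ℂ] L2 m₂ l)
      = (-Complex.I) • kernelOp (isVolterra_gramKernel hγ) :=
  hE.similar.unique (isTriangular_smul_gramKernel hγ)

lemma IsSimilarityOperator.isCausal (hE : IsSimilarityOperator l γ E) :
    IsCausal (E : L2 m₂ l →L[ℂ] L2 m₂ l) := by
  obtain ⟨ρ, k, k', -, -, -, h, -, -⟩ := hE.triangular
  exact h.isCausal

lemma IsSimilarityOperator.isCausal_symm (hE : IsSimilarityOperator l γ E) :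
    IsCausal (E.symm : L2 m₂ l →L[ℂ] L2 m₂ l) := by
  obtain ⟨ρ, k, k', -, -, -, -, -, h⟩ := hE.triangular
  exact h.isCausal

theorem IsSimilarityOperator.isSNode (hE : IsSimilarityOperator l γ E)
    (hγ : ContinuousOn γ (Icc 0 l)) (hγ' : EssBdd l γ) :
    IsSNode (opA m₂ l) (opS E) (opPi γ E) := by
  rw [IsSNode, hE.opPi_eq, opS]
  refine node_identity ?_ (hE.conj_opA_eq hγ) (gramKernel_add_adjoint hγ hγ')
  rw [← ContinuousLinearMap.comp_assoc, symm_comp_coe]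
  rfl

variable {r : ℝ}

lemma compress_coe_comp_symm (hE : IsSimilarityOperator l γ E) (hr : r ≤ l) :
    compress r (E : L2 m₂ l →L[ℂ] L2 m₂ l) ∘L compress r (E.symm : L2 m₂ l →L[ℂ] L2 m₂ l) = 1 := by
  rw [← compress_comp hE.isCausal hr, coe_comp_symm, compress_one hr]

lemma compress_symm_comp_coe (hE : IsSimilarityOperator l γ E) (hr : r ≤ l) :
    compress r (E.symm : L2 m₂ l →L[ℂ] L2 m₂ l) ∘L compress r (E : L2 m₂ l →L[ℂ] L2 m₂ l) = 1 := by
  rw [← compress_comp hE.isCausal_symm hr, symm_comp_coe, compress_one hr]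

lemma compress_opS (hE : IsSimilarityOperator l γ E) (hr : r ≤ l) :
    compress r (opS E) = compress r (E.symm : L2 m₂ l →L[ℂ] L2 m₂ l)
      ∘L ContinuousLinearMap.adjoint (compress r (E.symm : L2 m₂ l →L[ℂ] L2 m₂ l)) := by
  rw [opS, compress_comp hE.isCausal_symm hr, compress_adjoint]

theorem IsSimilarityOperator.isUnit_compress_opS (hE : IsSimilarityOperator l γ E) (hr : r ≤ l) :
    IsUnit (compress r (opS E)) := by
  rw [compress_opS hE hr]
  exact (ring_inverse_comp_adjoint (compress_coe_comp_symm hE hr)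
    (compress_symm_comp_coe hE hr)).1

lemma IsSimilarityOperator.opP_comp_ofCols (hE : IsSimilarityOperator l γ E) (hr : r ≤ l) :
    ofCols (fun j => opP m₂ l r (toL2 l (col γ j)))
      = compress r (E : L2 m₂ l →L[ℂ] L2 m₂ l) ∘L (opP m₂ l r ∘L opPi γ E) := by
  rw [← comp_ofCols, ← ContinuousLinearMap.comp_assoc, ← hE.isCausal.opP_comp hr,
    ContinuousLinearMap.comp_assoc, hE.opPi_eq,
    ← ContinuousLinearMap.comp_assoc (E : L2 m₂ l →L[ℂ] L2 m₂ l), coe_comp_symm]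
  rfl

/-- By causality, a solution on the full interval restricts to a solution of the compressed
equation; one family of columns then serves every `r`. -/
lemma IsCausal.ofCols_sub_smul_comp {K : L2 m₂ l →L[ℂ] L2 m₂ l} (hK : IsCausal K) (hr : r ≤ l)
    {p : Type*} [Fintype p] [DecidableEq p] {z : ℂ} {c d : p → L2 m₂ l}
    (hc : ∀ j, c j - z • K (c j) = d j) :
    ofCols (fun j => opP m₂ l r (c j))
      - z • (compress r K ∘L ofCols fun j => opP m₂ l r (c j))
      = ofCols fun j => opP m₂ l r (d j) := by
  rw [← comp_ofCols, ← ContinuousLinearMap.comp_assoc, ← hK.opP_comp hr,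
    ContinuousLinearMap.comp_assoc, comp_ofCols K, comp_ofCols, comp_ofCols, ofCols_sub_smul]
  congr 1
  ext1 j
  rw [← hc j, map_sub, map_smul]

lemma IsSimilarityOperator.compress_conj_opA (hE : IsSimilarityOperator l γ E) (hr : r ≤ l) :
    compress r ((E : L2 m₂ l →L[ℂ] L2 m₂ l) ∘L opA m₂ l ∘L (E.symm : L2 m₂ l →L[ℂ] L2 m₂ l))
      = compress r (E : L2 m₂ l →L[ℂ] L2 m₂ l) ∘L compress r (opA m₂ l)
        ∘L compress r (E.symm : L2 m₂ l →L[ℂ] L2 m₂ l) := by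
  rw [compress_comp hE.isCausal hr, compress_comp (isCausal_opA m₂ l) hr]

/-- The transfer matrix function in terms of a solution `X` of `(I - z K) X = Γ`. -/
lemma IsSimilarityOperator.transfer_eq (hE : IsSimilarityOperator l γ E) (hr : r ≤ l) {z : ℂ}
    {c : Fin m₁ ⊕ Fin m₂ → L2 m₂ l}
    (hc : ∀ j, c j - z • ((E : L2 m₂ l →L[ℂ] L2 m₂ l) ∘L opA m₂ l
      ∘L (E.symm : L2 m₂ l →L[ℂ] L2 m₂ l)) (c j) = toL2 l (col γ j)) (i j : Fin m₁ ⊕ Fin m₂) :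
    transfer (opA m₂ l) (opS E) (opPi γ E) r z i j
      = (1 : Matrix (Fin m₁ ⊕ Fin m₂) (Fin m₁ ⊕ Fin m₂) ℂ) i j
        - Complex.I * z * inner ℂ (opP m₂ l r (toL2 l (col γ i))) (opP m₂ l r (c j)) := by
  have hKc := hE.isCausal.comp ((isCausal_opA m₂ l).comp hE.isCausal_symm)
  have hop := transfer_operator_eq (compress_coe_comp_symm hE hr) (compress_symm_comp_coe hE hr)
    (compress_opS hE hr) (hE.compress_conj_opA hr)
    (Ring.inverse_mul_cancel _ (isUnit_one_sub_smul_compress_opA m₂ hr z))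
    (hE.opP_comp_ofCols hr) (hKc.ofCols_sub_smul_comp hr hc)
  rw [transfer, hop, Matrix.sub_apply, Matrix.smul_apply, toEuclideanCLM_symm_adjoint_ofCols_comp,
    smul_eq_mul]

variable {v : ℝ → Matrix (Fin m₁) (Fin m₂) ℂ}
  {u : ℝ → ℂ → Matrix (Fin m₁ ⊕ Fin m₂) (Fin m₁ ⊕ Fin m₂) ℂ}

/-- The transfer matrix function solves the canonical system. -/
theorem IsSimilarityOperator.transfer_eq_canonicalSol (hl : 0 < l)
    (hu : ∀ z : ℂ, IsFundamentalSolution l (fun x => diracCoeff (v x) z) (fun x => u x z))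
    (hγ : ∀ x, γ x = botProj m₁ m₂ * u x 0)
    (hE : IsSimilarityOperator l γ E) (hr : r ∈ Icc 0 l) (z : ℂ) :
    transfer (opA m₂ l) (opS E) (opPi γ E) r z = canonicalSol u z r := by
  set W := canonicalSol u z with hW
  have hgb : EssBdd l γ := (hasACDeriv_gamma hl hu hγ).essBdd hl.le
  have hWb : EssBdd l W := (hasACDeriv_canonicalSol hl hu hγ z).essBdd hl.le
  have hθ : EssBdd l fun t => γ t * W t := hgb.mul hWb
  have hgθ : EssBdd l fun t => (γ t)ᴴ * (γ t * W t) := hgb.conjTranspose.mul hθ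
  have hint : ∀ x ∈ Icc 0 l, (-(Complex.I * z)) • ∫ t in (0 : ℝ)..x, (γ t)ᴴ * (γ t * W t)
      = W x - 1 := fun x hx => by
    rw [← intervalIntegral.integral_smul]
    exact integral_canonicalSol hl hu hγ z hx
  -- The columns of `γW` solve `(I - zK)X = Γ`, since `γ(W - 1) = -iz γ∫γ*γW = zK(γW)`.
  have hc : ∀ j, toL2 l (col (fun t => γ t * W t) j) - z • ((E : L2 m₂ l →L[ℂ] L2 m₂ l) ∘L opA m₂ l
      ∘L (E.symm : L2 m₂ l →L[ℂ] L2 m₂ l)) (toL2 l (col (fun t => γ t * W t) j))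
      = toL2 l (col γ j) := by
    intro j
    set f := toL2 l (col (fun t => γ t * W t) j) with hf
    set K := (E : L2 m₂ l →L[ℂ] L2 m₂ l) ∘L opA m₂ l ∘L (E.symm : L2 m₂ l →L[ℂ] L2 m₂ l)
    have hfc := coeFn_toL2 (hθ.memLp_col j)
    refine eq_toL2_of_ae_eq ?_
    filter_upwards [Lp.coeFn_sub f (z • K f), Lp.coeFn_smul z (K f), hE.similar f, hfc,
      ae_restrict_mem measurableSet_Ioo] with x h1 h2 h3 h4 hx
    have hxI := Ioo_subset_Icc_self hx
    have h5 : ∫ t in (0 : ℝ)..x, toEuclideanCLM (𝕜 := ℂ) (γ x * ((-Complex.I) • (γ t)ᴴ)) (f t)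
        = colCLM m₂ j (γ x * ((-Complex.I) • ∫ t in (0 : ℝ)..x, (γ t)ᴴ * (γ t * W t))) := by
      have hI := hgθ.intervalIntegrable le_rfl hxI.1 hxI.2
      have h6 : ∫ t in (0 : ℝ)..x, toEuclideanCLM (𝕜 := ℂ) (γ x * ((-Complex.I) • (γ t)ᴴ)) (f t)
          = ∫ t in (0 : ℝ)..x, colCLM m₂ j
            ((-Complex.I) • (γ x) * ((γ t)ᴴ * (γ t * W t))
              * (1 : Matrix (Fin m₁ ⊕ Fin m₂) (Fin m₁ ⊕ Fin m₂) ℂ)) := by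
        rw [intervalIntegral.integral_of_le hx.1.le, intervalIntegral.integral_of_le hx.1.le,
          integral_Ioc_eq_integral_Ioo, integral_Ioc_eq_integral_Ioo]
        refine integral_congr_ae ?_
        filter_upwards [ae_restrict_of_ae_restrict_of_subset (Ioo_subset_Ioo_right hx.2.le) hfc]
          with t ht
        rw [ht, toEuclideanCLM_col]
        simp only [Matrix.mul_smul, Matrix.smul_mul, Matrix.mul_assoc, Matrix.mul_one]
      rw [h6, ContinuousLinearMap.intervalIntegral_comp_comm (colCLM m₂ j),
        intervalIntegral_mul_mul _ _ hI]
      · simp only [Matrix.mul_smul, Matrix.smul_mul, Matrix.mul_one]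
      · exact (((EssBdd.const l ((-Complex.I) • γ x)).mul hgθ).mul
          (EssBdd.const l (1 : Matrix (Fin m₁ ⊕ Fin m₂) (Fin m₁ ⊕ Fin m₂) ℂ))).intervalIntegrable le_rfl hxI.1 hxI.2
    rw [h1, Pi.sub_apply, h2, Pi.smul_apply, h3, map_zero, _root_.zero_apply, zero_add, h5, h4,
      col_eq_colCLM, col_eq_colCLM, ← map_smul, ← map_sub, ← Matrix.mul_smul, smul_smul]
    rw [show z * -Complex.I = -(Complex.I * z) by ring, hint x hxI, Matrix.mul_sub, Matrix.mul_one,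
      sub_sub_cancel]
  ext i j
  rw [hE.transfer_eq hr.2 hc]
  -- The inner products over `(0, r)` are the entries of `∫₀ʳ γ*γW`, so the transfer matrix is `1 +
  -- (W(r) - 1)`.
  have hin : inner ℂ (opP m₂ l r (toL2 l (col γ i)))
      (opP m₂ l r (toL2 l (col (fun t => γ t * W t) j)))
      = (∫ t in (0 : ℝ)..r, (γ t)ᴴ * (γ t * W t)) i j := by
    rw [intervalIntegral_entry (hgθ.intervalIntegrable le_rfl hr.1 hr.2), L2.inner_def,
      intervalIntegral.integral_of_le hr.1, integral_Ioc_eq_integral_Ioo]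
    refine integral_congr_ae ?_
    filter_upwards [coeFn_opP hr.2 (toL2 l (col γ i)),
      coeFn_opP hr.2 (toL2 l (col (fun t => γ t * W t) j)),
      ae_restrict_of_ae_restrict_of_subset (Ioo_subset_Ioo_right hr.2)
        (coeFn_toL2 (hgb.memLp_col i)),
      ae_restrict_of_ae_restrict_of_subset (Ioo_subset_Ioo_right hr.2)
        (coeFn_toL2 (hθ.memLp_col j))] with x h1 h2 h3 h4
    rw [h1, h2, h3, h4, col_eq_colCLM, col_eq_colCLM, inner_colCLM]
  have h := congrArg (fun M => M i j) (hint r hr)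
  simp only [Matrix.smul_apply, Matrix.sub_apply, smul_eq_mul] at h
  rw [hin]
  linear_combination h

end Transfer

/-! ### Bounded potentials -/

/-- A bounded measurable potential agrees a.e. with a strongly measurable one which is bounded
everywhere. -/
lemma exists_stronglyMeasurable_modification {m n : Type*} [Fintype m] [Fintype n] [DecidableEq m]
    [DecidableEq n] {l : ℝ} {v : ℝ → Matrix m n ℂ}
    (hv : ∀ i j, AEMeasurable (fun x => v x i j) (vol l))
    (hb : ∃ M : ℝ, ∀ x ∈ Ioo 0 l, ‖v x‖ ≤ M) :
    ∃ (w : ℝ → Matrix m n ℂ) (C : ℝ), StronglyMeasurable w ∧ (∀ x, ‖w x‖ ≤ C) ∧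
      ∀ᵐ x ∂(vol l), v x = w x := by
  obtain ⟨M, hM⟩ := hb
  let w : ℝ → Matrix m n ℂ := fun x => Matrix.of fun i j => (hv i j).mk _ x
  have hw : StronglyMeasurable w := by
    have h : w = fun x => ∑ i, ∑ j, (hv i j).mk _ x • Matrix.single i j (1 : ℂ) := by
      ext1 x
      conv_lhs => rw [matrix_eq_sum_single (w x)]
      simp only [smul_single, smul_eq_mul, mul_one]
      rfl
    rw [h]
    exact Finset.stronglyMeasurable_fun_sum _ fun i _ => Finset.stronglyMeasurable_fun_sum _
      fun j _ => (hv i j).measurable_mk.stronglyMeasurable.smul_const _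
  -- Truncating at level `M` makes the bound hold everywhere and changes nothing where `w` agrees
  -- with `v` on `(0, l)`.
  refine ⟨fun x => if ‖w x‖ ≤ M then w x else 0, max M 0, ?_, fun x => ?_, ?_⟩
  · exact StronglyMeasurable.ite (measurableSet_le hw.norm.measurable measurable_const) hw
      stronglyMeasurable_const
  · dsimp only
    split_ifs with h
    · exact h.trans (le_max_left _ _)
    · rw [norm_zero]; exact le_max_right _ _
  · have h : ∀ᵐ x ∂(vol l), ∀ i j, v x i j = w x i j :=
      ae_all_iff.mpr fun i => ae_all_iff.mpr fun j => (hv i j).ae_eq_mk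
    filter_upwards [h, ae_restrict_mem measurableSet_Ioo] with x hx hxl
    have hx' : v x = w x := by ext i j; exact hx i j
    rw [if_pos (hx' ▸ hM x hxl), hx']

/-- The equation is imposed only a.e., so modifying the potential on a null set keeps the same `u`
and `γ`. -/
lemma IsFundamentalSolution.congr_coeff {n : Type*} [Fintype n] [DecidableEq n] {l : ℝ}
    {C C' : ℝ → Matrix n n ℂ} {U : ℝ → Matrix n n ℂ} (h : IsFundamentalSolution l C U)
    (hC : ∀ᵐ x ∂(vol l), C x = C' x) : IsFundamentalSolution l C' U :=
  ⟨⟨h.ac, by filter_upwards [h.eqn, hC] with x h1 h2 using h2 ▸ h1⟩, h.init⟩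

/-! ### Existence of the similarity operator -/

section Existence

lemma kcomp_eq_intervalIntegral {n : ℕ} {l : ℝ} {k d : ℝ → ℝ → Matrix (Fin n) (Fin n) ℂ}
    (hk : IsVolterra l k) (hd : IsVolterra l d) {x s : ℝ} (hsx : s ≤ x) :
    kcomp k d x s = ∫ t in s..x, k x t * d t s := by
  rw [kcomp, intervalIntegral.integral_of_le hsx, integral_Ioc_eq_integral_Ioo,
    setIntegral_eq_integral_of_forall_compl_eq_zero]
  intro t ht
  by_cases hts : s < t
  · rw [hk.supp x t fun h => ht ⟨hts, h.2.1⟩, zero_mul]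
  · rw [hd.supp t s fun h => hts h.2.1, mul_zero]

lemma intervalIntegral_congr_Ioo {E : Type*} [NormedAddCommGroup E] [NormedSpace ℝ E] {a b : ℝ}
    (hab : a ≤ b) {f g : ℝ → E} (h : ∀ t ∈ Ioo a b, f t = g t) :
    ∫ t in a..b, f t = ∫ t in a..b, g t := by
  rw [intervalIntegral.integral_of_le hab, intervalIntegral.integral_of_le hab,
    integral_Ioc_eq_integral_Ioo, integral_Ioc_eq_integral_Ioo]
  exact setIntegral_congr_fun measurableSet_Ioo h

variable {m₁ m₂ : ℕ} {l : ℝ}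

/-- The Volterra kernel `v(x)* v(t)`. -/
def potKernel (l : ℝ) (v : ℝ → Matrix (Fin m₁) (Fin m₂) ℂ) (x t : ℝ) :
    Matrix (Fin m₂) (Fin m₂) ℂ :=
  if 0 < t ∧ t < x ∧ x < l then (v x)ᴴ * v t else 0

variable {v : ℝ → Matrix (Fin m₁) (Fin m₂) ℂ} {C : ℝ}

lemma isVolterra_potKernel (hvm : StronglyMeasurable v) (hvb : ∀ x, ‖v x‖ ≤ C) :
    IsVolterra l (potKernel l v) := by
  refine isVolterra_ite (M := fun x t => (v x)ᴴ * v t) (C := C * C) ?_ fun x t _ _ _ => ?_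
  · exact (continuous_fst.matrix_mul continuous_snd).comp_stronglyMeasurable
      ((continuous_id.matrix_conjTranspose.comp_stronglyMeasurable
        (hvm.comp_measurable measurable_fst)).prodMk (hvm.comp_measurable measurable_snd))
  · refine (l2_opNorm_mul _ _).trans ?_
    rw [l2_opNorm_conjTranspose]
    exact mul_le_mul (hvb x) (hvb t) (norm_nonneg _) ((norm_nonneg _).trans (hvb x))

variable {u : ℝ → ℂ → Matrix (Fin m₁ ⊕ Fin m₂) (Fin m₁ ⊕ Fin m₂) ℂ}
  {γ : ℝ → Matrix (Fin m₂) (Fin m₁ ⊕ Fin m₂) ℂ}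

/-- Since `γ(0) = [0 I]`, the block `γ₂` is the case `s = 0` of `γ(x)γ(s)*`, and the same integral
identities apply to it. -/
lemma toCols₂_gamma (hl : 0 < l)
    (hu : ∀ z : ℂ, IsFundamentalSolution l (fun x => diracCoeff (v x) z) (fun x => u x z))
    (hγ : ∀ x, γ x = botProj m₁ m₂ * u x 0) (x : ℝ) : (γ x).toCols₂ = γ x * (γ 0)ᴴ := by
  rw [gamma_zero hl hu hγ, botProj, conjTranspose_fromCols_eq_fromRows_conjTranspose]
  conv_rhs => rw [← fromCols_toCols (γ x)]
  rw [fromCols_mul_fromRows]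
  simp

variable (hl : 0 < l)
  (hu : ∀ z : ℂ, IsFundamentalSolution l (fun x => diracCoeff (v x) z) (fun x => u x z))
  (hγ : ∀ x, γ x = botProj m₁ m₂ * u x 0) (hvm : StronglyMeasurable v) (hvb : ∀ x, ‖v x‖ ≤ C)

include hl hu hγ hvm hvb

/-- On the triangle, the kernel of `QY` at `(y, s)` is `v(y)*β(y)γ(s)*` by `integral_v_gamma`, and
integrating it over `(s, x)` gives `1 - γ(x)γ(s)*` by `integral_v_top`. -/
lemma gramKernel_add_kcomp (x s : ℝ) :
    gramKernel l γ x s + kcomp (intKernel m₂ l) (kcomp (potKernel l v) (gramKernel l γ)) x s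
      = intKernel m₂ l x s := by
  have hv : EssBdd l v := ⟨hvm.aestronglyMeasurable, max C 0, le_max_right _ _,
    .of_forall fun x => (hvb x).trans (le_max_left _ _)⟩
  have hg := isVolterra_gramKernel ((hasACDeriv_gamma hl hu hγ).continuousOn hl.le)
  have hgb := (hasACDeriv_gamma hl hu hγ).essBdd hl.le
  have hq := isVolterra_potKernel (l := l) hvm hvb
  have hJ := isVolterra_intKernel m₂ l
  by_cases h : 0 < s ∧ s < x ∧ x < l
  swap
  · rw [hg.supp x s h, (hJ.kcomp (hq.kcomp hg)).supp x s h, hJ.supp x s h, add_zero]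
  obtain ⟨hs, hsx, hxl⟩ := h
  have h1 : ∀ y ∈ Ioo s x, kcomp (potKernel l v) (gramKernel l γ) y s
      = (v y)ᴴ * (topProj m₁ m₂ * u y 0 * (γ s)ᴴ) := by
    intro y hy
    have hyl := hy.2.trans hxl
    rw [kcomp_eq_intervalIntegral hq hg hy.1.le, ← integral_v_gamma hl hu hγ hv hs.le hy.1.le hyl.le]
    have hI := (hv.mul (hgb.mul (EssBdd.const l (γ s)ᴴ))).intervalIntegrable hs.le hy.1.le hyl.le
    have h2 := intervalIntegral_mul_mul (v y)ᴴ (1 : Matrix (Fin m₂) (Fin m₂) ℂ) hI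
    rw [Matrix.mul_one] at h2
    rw [← h2]
    refine intervalIntegral_congr_Ioo hy.1.le fun t ht => ?_
    rw [potKernel, if_pos ⟨hs.trans ht.1, ht.2, hyl⟩, gramKernel,
      if_pos ⟨hs, ht.1, ht.2.trans hyl⟩, Matrix.mul_one, Matrix.mul_assoc]
  rw [kcomp_eq_intervalIntegral hJ (hq.kcomp hg) hsx.le, intervalIntegral_congr_Ioo hsx.le
    (g := fun t => (v t)ᴴ * (topProj m₁ m₂ * u t 0 * (γ s)ᴴ)), integral_v_top hl hu hγ hv hs.le
    hsx.le hxl.le, gramKernel, if_pos ⟨hs, hsx, hxl⟩, intKernel, if_pos ⟨hs, hsx, hxl⟩,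
    add_sub_cancel]
  intro t ht
  rw [h1 t ht, intKernel, if_pos ⟨hs.trans ht.1, ht.2, hxl⟩, Matrix.one_mul]

/-- `(I + J Q) Y = J` for the operators `J`, `Q`, `Y` of integration and with the kernels
`v(x)* v(t)` and `γ(x) γ(t)*`. -/
lemma gramOp_add (f : L2 m₂ l) :
    kernelOp (isVolterra_gramKernel ((hasACDeriv_gamma hl hu hγ).continuousOn hl.le)) f
      + opJ m₂ l (kernelOp (isVolterra_potKernel hvm hvb)
        (kernelOp (isVolterra_gramKernel ((hasACDeriv_gamma hl hu hγ).continuousOn hl.le)) f))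
      = opJ m₂ l f := by
  have hg := isVolterra_gramKernel ((hasACDeriv_gamma hl hu hγ).continuousOn hl.le)
  have hq := isVolterra_potKernel (l := l) hvm hvb
  have hJ := isVolterra_intKernel m₂ l
  have h := kernelOp_congr (hg.add (hJ.kcomp (hq.kcomp hg))) hJ
    (gramKernel_add_kcomp hl hu hγ hvm hvb)
  rw [kernelOp_add hg (hJ.kcomp (hq.kcomp hg)), ← kernelOp_comp hJ (hq.kcomp hg),
    ← kernelOp_comp hq hg] at h
  exact congrArg (fun T => T f) h

/-- `(I + J Q) γ₂ = I`, columnwise. -/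
lemma col_gamma_add (j : Fin m₂) :
    toL2 l (col (fun x => (γ x).toCols₂) j)
      + opJ m₂ l (kernelOp (isVolterra_potKernel hvm hvb)
        (toL2 l (col (fun x => (γ x).toCols₂) j)))
      = toL2 l (col (fun _ => 1) j) := by
  have hv : EssBdd l v := ⟨hvm.aestronglyMeasurable, max C 0, le_max_right _ _,
    .of_forall fun x => (hvb x).trans (le_max_left _ _)⟩
  have hgb := (hasACDeriv_gamma hl hu hγ).essBdd hl.le
  have hq := isVolterra_potKernel (l := l) hvm hvb
  simp only [toCols₂_gamma hl hu hγ]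
  have hθ : EssBdd l fun x => γ x * (γ 0)ᴴ := hgb.mul (EssBdd.const l _)
  have hθ2 := hθ.memLp_col j
  have htop : EssBdd l fun t => (v t)ᴴ * (topProj m₁ m₂ * u t 0 * (γ 0)ᴴ) :=
    hv.conjTranspose.mul (((hasACDeriv_top hl hu).essBdd hl.le).mul (EssBdd.const l _))
  -- The computation behind `(I + JQ)Y = J`, now with the base point `s = 0`.
  have hvint : ∀ x ∈ Ioo 0 l, vint l (potKernel l v) (col (fun x => γ x * (γ 0)ᴴ) j) x
      = colCLM m₂ j ((v x)ᴴ * (topProj m₁ m₂ * u x 0 * (γ 0)ᴴ)) := by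
    intro x hx
    have hI := (hv.mul hθ).intervalIntegrable le_rfl hx.1.le hx.2.le
    rw [vint_eq_intervalIntegral hq _ hx, ← integral_v_gamma hl hu hγ hv le_rfl hx.1.le hx.2.le]
    have h2 := intervalIntegral_mul_mul (v x)ᴴ (1 : Matrix (Fin m₂) (Fin m₂) ℂ) hI
    rw [Matrix.mul_one] at h2
    rw [← h2, ← ContinuousLinearMap.intervalIntegral_comp_comm]
    · refine intervalIntegral_congr_Ioo hx.1.le fun t ht => ?_
      rw [toEuclideanCLM_col, potKernel, if_pos ⟨ht.1, ht.2, hx.2⟩, Matrix.mul_one,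
        Matrix.mul_assoc]
    · exact (((EssBdd.const l (v x)ᴴ).mul (hv.mul hθ)).mul
        (EssBdd.const l 1)).intervalIntegrable le_rfl hx.1.le hx.2.le
  rw [kernelOp_toL2 hq hθ2, opJ_toL2 (memLp_vint hq (hθ2.integrable (by norm_num)))]
  refine eq_toL2_of_ae_eq ?_
  have hm : MemLp (fun x => ∫ t in (0 : ℝ)..x,
      vint l (potKernel l v) (col (fun x => γ x * (γ 0)ᴴ) j) t) 2 (vol l) := by
    refine (memLp_vint (isVolterra_intKernel m₂ l)
      (integrable_vint hq (hθ2.integrable (by norm_num)))).ae_eq ?_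
    filter_upwards [ae_restrict_mem measurableSet_Ioo] with x hx using vint_intKernel _ hx
  rw [← toL2_add hθ2 hm]
  refine (coeFn_toL2 (hθ2.add hm)).trans ?_
  filter_upwards [ae_restrict_mem measurableSet_Ioo] with x hx
  rw [Pi.add_apply, intervalIntegral_congr_Ioo hx.1.le
    fun t ht => hvint t ⟨ht.1, ht.2.trans hx.2⟩,
    ContinuousLinearMap.intervalIntegral_comp_comm _ (htop.intervalIntegrable le_rfl hx.1.le hx.2.le),
    integral_v_top hl hu hγ hv le_rfl hx.1.le hx.2.le, col_eq_colCLM, col_eq_colCLM, ← map_add,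
    add_sub_cancel]

end Existence

/-! ### Boundedly differentiable functions -/

section BoundedDeriv

variable {n : ℕ} {l : ℝ}

/-- Essentially bounded classes. -/
def IsEssBdd (f : L2 n l) : Prop := ∃ C : ℝ, ∀ᵐ x ∂(vol l), ‖f x‖ ≤ C

lemma IsEssBdd.add {f g : L2 n l} (hf : IsEssBdd f) (hg : IsEssBdd g) : IsEssBdd (f + g) := by
  obtain ⟨C, hC⟩ := hf
  obtain ⟨B, hB⟩ := hg
  refine ⟨C + B, ?_⟩
  filter_upwards [Lp.coeFn_add f g, hC, hB] with x h1 h2 h3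
  rw [h1]
  exact norm_add_le_of_le h2 h3

lemma IsEssBdd.neg {f : L2 n l} (hf : IsEssBdd f) : IsEssBdd (-f) := by
  obtain ⟨C, hC⟩ := hf
  refine ⟨C, ?_⟩
  filter_upwards [Lp.coeFn_neg f, hC] with x h1 h2
  rwa [h1, Pi.neg_apply, norm_neg]

lemma isEssBdd_kernelOp {k : ℝ → ℝ → Matrix (Fin n) (Fin n) ℂ} (hk : IsVolterra l k) (f : L2 n l) :
    IsEssBdd (kernelOp hk f) := by
  obtain ⟨C, hC, hC'⟩ := hk.bdd
  refine ⟨C * ∫ t, ‖f t‖ ∂(vol l), ?_⟩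
  filter_upwards [coeFn_kernelOp hk f] with x hx
  rw [hx]
  exact norm_vint_le hC' (integrable_coe f) x

/-- The class of a boundedly differentiable function is a constant plus the integral of an
essentially bounded class. -/
lemma MemB1.exists_eq_add {f : ℝ → EuclideanSpace ℂ (Fin n)} (hl : 0 ≤ l) (hf : MemB1 l f) :
    ∃ g : L2 n l, IsEssBdd g ∧ toL2 l f = toL2 l (fun _ => f 0) + opJ n l g := by
  obtain ⟨hac, C, hC⟩ := hf
  have hm : MemLp (deriv f) 2 (vol l) :=
    MemLp.of_bound (stronglyMeasurable_deriv f).aestronglyMeasurable C hC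
  -- Absolute continuity gives bounded variation, hence differentiability a.e.; otherwise `deriv`
  -- could be a default value.
  have hd : ∀ᵐ x ∂(vol l), HasDerivAt f (deriv f x) x := by
    rw [ae_restrict_iff' measurableSet_Ioo]
    filter_upwards [hac.boundedVariationOn.ae_differentiableAt_of_mem_uIcc] with x hx hxl
    rw [uIcc_of_le hl] at hx
    exact (hx (Ioo_subset_Icc_self hxl)).hasDerivAt
  refine ⟨toL2 l (deriv f), ⟨C, ?_⟩, ?_⟩
  · filter_upwards [coeFn_toL2 hm, hC] with x h1 h2
    rwa [h1]
  · have hc : MemLp (fun _ : ℝ => f 0) 2 (vol l) := memLp_of_continuous continuous_const l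
    have hi : MemLp (fun x => ∫ t in (0 : ℝ)..x, deriv f t) 2 (vol l) := by
      refine (memLp_vint (isVolterra_intKernel n l) (hm.integrable (by norm_num))).ae_eq ?_
      filter_upwards [ae_restrict_mem measurableSet_Ioo] with x hx using vint_intKernel _ hx
    rw [opJ_toL2 hm, ← toL2_add hc hi]
    refine (toL2_congr (hc.add hi) ?_).symm
    filter_upwards [ae_restrict_mem measurableSet_Ioo] with x hx
    exact (eq_add_integral_of_hasDerivAt hl hac hd (hm.integrable (by norm_num)) hC
      (Ioo_subset_Icc_self hx)).symm

lemma IsEssBdd.exists_memB1 {g : L2 n l} (hl : 0 ≤ l) (hg : IsEssBdd g)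
    (c : EuclideanSpace ℂ (Fin n)) :
    ∃ f, MemB1 l f ∧ toL2 l (fun _ => c) + opJ n l g = toL2 l f := by
  obtain ⟨C, hC⟩ := hg
  have hI : IntervalIntegrable (fun x => g x) volume 0 l :=
    (intervalIntegrable_iff_integrableOn_Ioo_of_le hl).mpr (integrable_coe g)
  refine ⟨fun x => c + ∫ t in (0 : ℝ)..x, g t, ⟨?_, C, ?_⟩, ?_⟩
  · exact (absolutelyContinuousOnInterval_const c 0 l).fun_add
      (absolutelyContinuousOnInterval_primitive hl (integrable_coe g) hC)
  · have h : ∀ᵐ x ∂(vol l), HasDerivAt (fun x => ∫ t in (0 : ℝ)..x, g t) (g x) x := by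
      rw [ae_restrict_iff' measurableSet_Ioo]
      filter_upwards [hI.ae_hasDerivAt_integral] with x hx hxl
      rw [uIcc_of_le hl] at hx
      exact hx (Ioo_subset_Icc_self hxl) 0 (left_mem_Icc.mpr hl)
    filter_upwards [h, hC] with x h1 h2
    rwa [(h1.const_add c).deriv]
  · refine eq_toL2_of_ae_eq ?_
    filter_upwards [Lp.coeFn_add (toL2 l (fun _ => c)) (opJ n l g),
      coeFn_toL2 (memLp_of_continuous (continuous_const (y := c)) l),
      coeFn_kernelOp (isVolterra_intKernel n l) g, ae_restrict_mem measurableSet_Ioo]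
      with x h1 h2 h3 hx
    rw [h1, Pi.add_apply, h2, h3, vint_intKernel _ hx]

end BoundedDeriv

/-! ### The transmutation operator -/

section Transmutation

variable {n : ℕ} {l : ℝ} {q d : ℝ → ℝ → Matrix (Fin n) (Fin n) ℂ}

lemma injective_of_comp_eq_one {H : Type*} [NormedAddCommGroup H] [NormedSpace ℂ H]
    {S T : H →L[ℂ] H} (h : S ∘L T = 1) : Function.Injective T :=
  Function.LeftInverse.injective (g := S) fun f => congrArg (fun L => L f) h

/-- `I + JQ` is the identity plus a Volterra operator, hence invertible. It can then be cancelled,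
so identities for `E` need only be checked after applying it. -/
lemma injective_add_opJ_kernelOp (hq : IsVolterra l q) {f g : L2 n l}
    (hfg : f + opJ n l (kernelOp hq f) = g + opJ n l (kernelOp hq g)) : f = g := by
  obtain ⟨d, hd, -, h⟩ := exists_inverse ((isVolterra_intKernel n l).kcomp hq)
  refine injective_of_comp_eq_one h ?_
  rw [_root_.add_apply, _root_.add_apply, one_apply_eq_self, one_apply_eq_self,
    ← kernelOp_comp (isVolterra_intKernel n l) hq, ContinuousLinearMap.comp_apply,
    ContinuousLinearMap.comp_apply, hfg]

variable (hq : IsVolterra l q) (hd : IsVolterra l d)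
  (h : ∀ x s, d x s + kavg l (fun x s => q x s + kcomp q d x s) x s = 0)

include h

lemma kernelOp_add_kavg (f : L2 n l) :
    kernelOp hd f + kernelOp (hq.add (hq.kcomp hd)).kavg f = 0 := by
  have h0 := kernelOp_eq_zero (hd.add (hq.add (hq.kcomp hd)).kavg) h
  rw [kernelOp_add] at h0
  exact congrArg (fun T => T f) h0

/-- `(I + JQ)E c = c` for `E = 1 + D`: on constants the averaged operator is `J(Q + QD) = JQE`, and
the kernel equation makes it `-D`. -/
lemma transmutation_const (c : EuclideanSpace ℂ (Fin n)) :
    (1 + kernelOp hd) (toL2 l fun _ => c)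
      + opJ n l (kernelOp hq ((1 + kernelOp hd) (toL2 l fun _ => c))) = toL2 l fun _ => c := by
  have h1 := kernelOp_add_kavg hq hd h (toL2 l fun _ => c)
  rw [kernelOp_kavg_const (hq.add (hq.kcomp hd)), kernelOp_add hq (hq.kcomp hd),
    ← kernelOp_comp hq hd] at h1
  simp only [_root_.add_apply, one_apply_eq_self, map_add, ContinuousLinearMap.comp_apply] at h1 ⊢
  refine eq_of_sub_eq_zero (Eq.trans ?_ h1)
  abel

/-- `(I + JQ)EJ = JE`: with `D = -M`, the relation `MJ = JM + J(Q + QD)J` reads `DJ = JD - JQEJ`. -/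
lemma transmutation_opJ (f : L2 n l) :
    (1 + kernelOp hd) (opJ n l f) + opJ n l (kernelOp hq ((1 + kernelOp hd) (opJ n l f)))
      = opJ n l ((1 + kernelOp hd) f) := by
  have h1 := kernelOp_add_kavg hq hd h (opJ n l f)
  have h2 := kernelOp_add_kavg hq hd h f
  have h3 := congrArg (fun T => T f) (kernelOp_kavg_comp_opJ (hq.add (hq.kcomp hd)))
  simp only [ContinuousLinearMap.comp_apply, _root_.add_apply] at h3
  rw [h3, eq_neg_of_add_eq_zero_right h2, kernelOp_add hq (hq.kcomp hd),
    ← kernelOp_comp hq hd] at h1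
  simp only [_root_.add_apply, one_apply_eq_self, map_add, map_neg,
    ContinuousLinearMap.comp_apply] at h1 ⊢
  refine eq_of_sub_eq_zero (Eq.trans ?_ h1)
  abel

end Transmutation

lemma IsVolterra.isBoundedKernel {n : ℕ} {l : ℝ} {k : ℝ → ℝ → Matrix (Fin n) (Fin n) ℂ}
    (hk : IsVolterra l k) : IsBoundedKernel l k := by
  obtain ⟨C, hC, hC'⟩ := hk.bdd
  exact ⟨fun i j => ((entryCLM i j).continuous.comp_stronglyMeasurable hk.meas).measurable,
    C, fun x t _ _ _ => hC' x t⟩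

lemma exists_continuousLinearEquiv {H : Type*} [NormedAddCommGroup H] [NormedSpace ℂ H]
    {S T : H →L[ℂ] H} (h₁ : S ∘L T = 1) (h₂ : T ∘L S = 1) :
    ∃ E : H ≃L[ℂ] H, (E : H →L[ℂ] H) = S ∧ (E.symm : H →L[ℂ] H) = T :=
  ⟨ContinuousLinearEquiv.equivOfInverse S T (fun f => congrArg (fun L => L f) h₂)
    (fun f => congrArg (fun L => L f) h₁), by ext1 f; rfl, by ext1 f; rfl⟩

/-! ### Construction of the normalized similarity operator -/

section Existence

variable {m₁ m₂ : ℕ} {l : ℝ} {v : ℝ → Matrix (Fin m₁) (Fin m₂) ℂ} {C : ℝ}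
  {u : ℝ → ℂ → Matrix (Fin m₁ ⊕ Fin m₂) (Fin m₁ ⊕ Fin m₂) ℂ}
  {γ : ℝ → Matrix (Fin m₂) (Fin m₁ ⊕ Fin m₂) ℂ}

/-- `γ'γ* = -v*βγ* = 0`, so the diagonal term may be constant. -/
lemma isSolution_one_gamma (hl : 0 < l)
    (hu : ∀ z : ℂ, IsFundamentalSolution l (fun x => diracCoeff (v x) z) (fun x => u x z))
    (hγ : ∀ x, γ x = botProj m₁ m₂ * u x 0) :
    IsSolution l (fun x => Complex.I • (mderiv γ x * ((-Complex.I) • (γ x)ᴴ)))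
      (fun _ => (1 : Matrix (Fin m₂) (Fin m₂) ℂ)) := by
  refine ⟨fun i j => absolutelyContinuousOnInterval_const _ _ _, ?_⟩
  filter_upwards [(hasACDeriv_gamma hl hu hγ).deriv, ae_restrict_mem measurableSet_Ioo]
    with x h1 hx i j
  have h2 : mderiv γ x = -((v x)ᴴ * (topProj m₁ m₂ * u x 0)) := by
    ext i j
    exact (h1 i j).deriv
  rw [h2, Matrix.mul_smul, Matrix.neg_mul, Matrix.mul_assoc,
    top_mul_conjTranspose_gamma hl hu hγ (Ioo_subset_Icc_self hx)]
  simpa using hasDerivAt_const x ((1 : Matrix (Fin m₂) (Fin m₂) ℂ) i j)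

theorem exists_isSimilarityOperator (hl : 0 < l)
    (hu : ∀ z : ℂ, IsFundamentalSolution l (fun x => diracCoeff (v x) z) (fun x => u x z))
    (hγ : ∀ x, γ x = botProj m₁ m₂ * u x 0) (hvm : StronglyMeasurable v)
    (hvb : ∀ x, ‖v x‖ ≤ C) : ∃ E : L2 m₂ l ≃L[ℂ] L2 m₂ l, IsSimilarityOperator l γ E := by
  have hq := isVolterra_potKernel (l := l) hvm hvb
  have hγc := (hasACDeriv_gamma hl hu hγ).continuousOn hl.le
  have hg := isVolterra_gramKernel hγc
  obtain ⟨d, hd, h⟩ := hq.exists_transmutation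
  obtain ⟨d', hd', h₁, h₂⟩ := exists_inverse hd
  obtain ⟨E, hE, hE'⟩ := exists_continuousLinearEquiv h₁ h₂
  have hconst : ∀ c, E (toL2 l fun _ => c) + opJ m₂ l (kernelOp hq (E (toL2 l fun _ => c)))
      = toL2 l fun _ => c := fun c => by
    rw [← ContinuousLinearEquiv.coe_coe E, hE]; exact transmutation_const hq hd h c
  have hJ : ∀ f, E (opJ m₂ l f) + opJ m₂ l (kernelOp hq (E (opJ m₂ l f)))
      = opJ m₂ l (E f) := fun f => by
    rw [← ContinuousLinearEquiv.coe_coe E, hE]; exact transmutation_opJ hq hd h f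
  have hbdd : ∀ {f}, IsEssBdd f → IsEssBdd (E f) := fun {f} hf => by
    rw [← ContinuousLinearEquiv.coe_coe E, hE]; exact hf.add (isEssBdd_kernelOp hd f)
  have hbdd' : ∀ {f}, IsEssBdd f → IsEssBdd (E.symm f) := fun {f} hf => by
    rw [← ContinuousLinearEquiv.coe_coe E.symm, hE']; exact hf.add (isEssBdd_kernelOp hd' f)
  refine ⟨E, ?_, ?_, fun f hf => ?_, fun f hf => ?_, fun j => ?_⟩
  · have hEA : (E : L2 m₂ l →L[ℂ] L2 m₂ l) ∘L opA m₂ l ∘L (E.symm : L2 m₂ l →L[ℂ] L2 m₂ l)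
        = (-Complex.I) • kernelOp hg := by
      ext1 f
      -- After applying `I + JQ` both sides equal `J f`: the left by intertwining, the right by `(I
      -- + JQ)Y = J`.
      have h3 : E (opJ m₂ l (E.symm f)) = kernelOp hg f := by
        refine injective_add_opJ_kernelOp hq ?_
        rw [hJ, gramOp_add hl hu hγ hvm hvb, E.apply_symm_apply]
      rw [opA_eq, ContinuousLinearMap.comp_apply, ContinuousLinearMap.comp_apply,
        _root_.smul_apply, map_smul, _root_.smul_apply, ← h3]
      rfl
    rw [hEA]
    exact isTriangular_smul_gramKernel hγc
  · refine ⟨fun _ => 1, d, d', isSolution_one_gamma hl hu hγ, by simp, hd.isBoundedKernel, ?_,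
      hd'.isBoundedKernel, ?_⟩
    · rw [hE]; exact isTriangular_one_add_kernelOp hd
    · simp only [inv_one]
      rw [hE']
      exact isTriangular_one_add_kernelOp hd'
  · obtain ⟨g, hgb, hfg⟩ := hf.exists_eq_add hl.le
    -- Writing `f = f(0) + Jg` gives `E f + JQE f = f(0) + JE g`, so `E f` is a constant plus `J` of
    -- a bounded class.
    have h3 : E (toL2 l f) = toL2 l (fun _ => f 0)
        + opJ m₂ l (E g + -kernelOp hq (E (toL2 l f))) := by
      have h4 := hconst (f 0)
      have h5 := hJ g
      have h6 : E (toL2 l f) = E (toL2 l fun _ => f 0) + E (opJ m₂ l g) := by rw [hfg, map_add]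
      have h7 : E (toL2 l f) + opJ m₂ l (kernelOp hq (E (toL2 l f)))
          = toL2 l (fun _ => f 0) + opJ m₂ l (E g) := by
        rw [← h4, ← h5, h6, map_add, map_add]
        abel
      rw [map_add, map_neg, ← add_assoc, ← h7, add_neg_cancel_right]
    obtain ⟨w, hw, hw'⟩ := ((hbdd hgb).add (isEssBdd_kernelOp hq _).neg).exists_memB1 hl.le (f 0)
    exact ⟨w, hw, h3.trans hw'⟩
  · obtain ⟨g, hgb, hfg⟩ := hf.exists_eq_add hl.le
    -- The candidate comes from solving `(I + JQ)f = f(0) + J(g + Qf)` through the two intertwining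
    -- relations.
    have h3 : E.symm (toL2 l f) = toL2 l (fun _ => f 0)
        + opJ m₂ l (E.symm (g + kernelOp hq (toL2 l f))) := by
      rw [E.symm_apply_eq]
      refine injective_add_opJ_kernelOp hq ?_
      have h4 := hconst (f 0)
      have h5 := hJ (E.symm (g + kernelOp hq (toL2 l f)))
      rw [E.apply_symm_apply, map_add (opJ m₂ l) g] at h5
      rw [map_add E, map_add (kernelOp hq), map_add (opJ m₂ l), add_add_add_comm, h4, h5,
        ← add_assoc, ← hfg]
    obtain ⟨w, hw, hw'⟩ := (hbdd' (hgb.add (isEssBdd_kernelOp hq _))).exists_memB1 hl.le (f 0)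
    exact ⟨w, hw, h3.trans hw'⟩
  · rw [E.symm_apply_eq]
    -- Both `γ₂` and `E` of the constant columns are sent by `I + JQ` to the identity columns.
    refine injective_add_opJ_kernelOp hq ?_
    rw [col_gamma_add hl hu hγ hvm hvb]
    exact (hconst _).symm

end Existence

end SkewDirac

end

/-! ### Proof of the theorem -/

theorem mainTheorem11 (m₁ m₂ : ℕ) (l : ℝ) (hl : 0 < l)
    (v : ℝ → Matrix (Fin m₁) (Fin m₂) ℂ)
    (hv_meas : ∀ i j, AEMeasurable (fun x => v x i j) (vol l))
    (hv_bdd : ∃ M : ℝ, ∀ x ∈ Set.Ioo 0 l, ‖v x‖ ≤ M)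
    (u : ℝ → ℂ → Matrix (Fin m₁ ⊕ Fin m₂) (Fin m₁ ⊕ Fin m₂) ℂ)
    (hu : ∀ z : ℂ, IsFundamentalSolution l (fun x => diracCoeff (v x) z) (fun x => u x z))
    (γ : ℝ → Matrix (Fin m₂) (Fin m₁ ⊕ Fin m₂) ℂ)
    (hγ : ∀ x, γ x = Matrix.fromCols 0 1 * u x 0) :
    (∃ E : L2 m₂ l ≃L[ℂ] L2 m₂ l, IsSimilarityOperator l γ E) ∧
    ∀ E : L2 m₂ l ≃L[ℂ] L2 m₂ l, IsSimilarityOperator l γ E →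
      IsSNode (opA m₂ l) (opS E) (opPi γ E) ∧
      (∀ r ∈ Set.Icc 0 l, IsUnit (compress r (opS E)) ∧
        ∀ z : ℂ, IsUnit (1 - z • compress r (opA m₂ l))) ∧
      (∀ z : ℂ, IsFundamentalSolution l (fun x => (-(Complex.I * z)) • ((γ x)ᴴ * γ x))
        (fun x => transfer (opA m₂ l) (opS E) (opPi γ E) x z)) ∧
      ∀ x ∈ Set.Icc 0 l, ∀ z : ℂ,
        u x z = Complex.exp (Complex.I * x * z) •
          (u x 0 * transfer (opA m₂ l) (opS E) (opPi γ E) x (2 * z)) := by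
  have hγac := hasACDeriv_gamma hl hu hγ
  refine ⟨?_, fun E hE => ?_⟩
  · obtain ⟨w, C, hwm, hwb, hvw⟩ := exists_stronglyMeasurable_modification hv_meas hv_bdd
    exact exists_isSimilarityOperator hl (v := w)
      (fun z => (hu z).congr_coeff (hvw.mono fun x hx => by rw [hx])) hγ hwm hwb
  · have hW : ∀ r ∈ Icc 0 l, ∀ z, transfer (opA m₂ l) (opS E) (opPi γ E) r z
        = canonicalSol u z r := fun r hr z => hE.transfer_eq_canonicalSol hl hu hγ hr z
    refine ⟨hE.isSNode (hγac.continuousOn hl.le) (hγac.essBdd hl.le),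
      fun r hr => ⟨hE.isUnit_compress_opS hr.2, isUnit_one_sub_smul_compress_opA m₂ hr.2⟩,
      fun z => ?_, fun x hx z => ?_⟩
    -- The transfer matrix is identified with `W` only on `[0, l]`; this suffices, as the
    -- derivatives are taken at interior points.
    · have h := (hasACDeriv_canonicalSol hl hu hγ z).congr hl.le fun x hx => (hW x hx z).symm
      have h' := h.congr_deriv (U'' := fun x => (-(Complex.I * z)) • ((γ x)ᴴ * γ x)
          * transfer (opA m₂ l) (opS E) (opPi γ E) x z) (by
        filter_upwards [ae_restrict_mem measurableSet_Ioo] with x hx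
        rw [hW x (Ioo_subset_Icc_self hx) z])
      exact ⟨⟨h'.ac, h'.deriv⟩, (hW 0 (left_mem_Icc.mpr hl.le) z).trans
        (canonicalSol_zero hl hu z)⟩
    · rw [hW x hx]
      exact eq_exp_smul_canonicalSol hl hu hx z
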